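/- **Setting.** Let $d\ge 1$, $p\in\{1,2,\infty\}$, $h=1/N$ with $N\in\mathbb N$, and let $\Omega^h=\{0,h,\dots,1\}^d$. For $\rho^0,\rho^1:\mathbb R^d\to\mathbb R$ put $\rho_h=(\rho^0-\rho^1)|_{\Omega^h}$. For $m:\Omega^h\to\mathbb R^d$ let $A_hm=\sum_{i=1}^d D_{h,i}m$, where $D_{h,i}m(x)$ equals $m_i(x)/h$ if $x_i=0$, $(m_i(x)-m_i(x-he_i))/h$ if $0<x_i<1$, and $-m_i(x-he_i)/h$ if $x_i=1$. Let $\langle u,v\rangle_h=\sum_{x}u(x)\cdot v(x)\,h^d$, $\|u\|_{L^2}^2=\langle u,u\rangle_h$, $f(m)=\sum_x\|m(x)\|_p h^d$, $f^*(\varphi)=\sup_u\langle\varphi,u\rangle_h-f(u)$, and $$\tilde L(m,\varphi)=\delta_{A_hm=\rho_h}(m)-f^*(\varphi)+\langle\varphi,m\rangle_h ,$$ and let $Y_h^*$ be the set of saddle points $(m,\varphi)$ (min in $m$, max in $\varphi$) of $\tilde L$ with finite value. **Algorithm 2** (tolerance $\varepsilon$, initial point $y^0=(m^0,\varphi^0)$).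 With $\mu=\tau=\frac12$ and $\bar\varphi^0=\varphi^0$, iterate $$m^{k+1}=\arg\min_m \tilde L(m,\bar\varphi^k)+\tfrac1{2\mu}\|m-m^k\|_{L^2}^2,\quad \varphi^{k+1}=\arg\max_\varphi \tilde L(m^{k+1},\varphi)-\tfrac1{2\tau}\|\varphi-\varphi^k\|_{L^2}^2,\quad \bar\varphi^{k+1}=2\varphi^{k+1}-\varphi^k$$ (terms of $\tilde L$ not depending on the unknown are dropped), and output $y^K=(m^K,\varphi^K)$, where $K$ is the first $k$ with $G^k<\varepsilon$ and $$G^k=\tfrac1\mu\|m^{k+1}-m^k\|_{L^2}^2+\tfrac1\tau\|\varphi^{k+1}-\varphi^k\|_{L^2}^2+2\langle\varphi^{k+1}-\varphi^k,m^{k+1}-m^k\rangle_h .$$ **Algorithm 4** (levels $l=1,\dots,L$, $h_l=2^{L-l}h$, tolerances $\varepsilon_l$). On level $1$ run Algorithm 2 with step $h_1$ and tolerance $\varepsilon_1$ from $0$; on level $l\ge2$ run it with step $h_l$ and tolerance $\varepsilon_l$ from the interpolation of the output of level $l-1$. The output is $m$ and $\varphi$ on level $L$ and a potential $\phi$ with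 $A_hA_h^*\phi=A_h\varphi$. The interpolation of a field from $\Omega^{h_{l-1}}$ to $\Omega^{h_l}$ is, for the $i$-th component at $x$, the average over the $y\in\Omega^{h_{l-1}}$ such that $y_j=x_j$ whenever $x_j$ is a coarse coordinate, and, for the other coordinates, $|y_j-x_j|=h_l$ if $j\ne i$ and $y_i=x_i-h_l$ if $j=i$. **Good tolerances.** On a grid with step $h$ and for an initial point, $\varepsilon>0$ is good if there is $\bar K$ such that for every $k\ge\bar K$ some $y^*\in Y_h^*$ satisfies $\|y^k-y^*\|_{L^2}^2\le C_4h^\nu$, and $\varepsilon\le\min_{k\le\bar K}G^k$. Let $\mathcal T_2$ be the set of good tolerances for the initial point $0$, and $\mathcal T_{2M}$ the set of $(\varepsilon_l)_{l=1}^L$ such that each $\varepsilon_l$ is good on level $l$ for the initial point that Algorithm 4 uses there. **Assumptions**, with constants $C_3,C_4,\nu>0$. (A) $Y^*_{h_l}\neq\emptyset$ and $\|y\|_{L^2}^2\le C_3$ for all $y\in Y_{h_l}^*$, $l=1,\dots,L$. (B) For every $y\in Y^*_{h_l}$ there is $z\in Y^*_{h_{l+1}}$ with $\|\mathrm{Interpolate}(y)-z\|_{L^2}^2\le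 C_4h_l^\nu$, $l=1,\dots,L-1$. **Cost.** Complexity is the number of operations executed by a program on real registers (loads of constants, copies, $+,-,\times,\div,\sqrt{\ }$ and comparisons, each of cost $1$) that starts from the grid values of $\rho^0,\rho^1$ and the tolerances and halts with the output in its registers; the program may depend on $p,d,h$ (and, for Algorithm 4, on $L$) only. "The cost is $O(B)$" means: there is a constant $C$, independent of $d,h,\rho^0,\rho^1$ and the tolerances, such that for every $d$ the cost is at most $C\,B$ for all sufficiently small $h$ (how small may depend on $d$ and on the given $C_3,C_4,\nu,\alpha$, but not on $\rho^0,\rho^1$ or the tolerances). **Theorem 4.6.** 0. One iteration of Algorithm 2, including $G^k$, costs $O\big(\frac d{h^d}\log\frac1h\big)$, the cost of a $d$-dimensional FFT, from any state, if $A_hm=\rho_h$ is solvable; here $C$ is absolute. 1. Let (A) hold on $\Omega^h$ and $\varepsilon\in\mathcal T_2$. Then Algorithm 2 started at $0$ stops, and costs $O\big(\frac1\varepsilon\frac d{h^d}\log\frac1h\big)$, with $C$ depending only on $p,C_3,C_4,\nu$. 2. Let $h$ be a power $2^{-n}$, $n\in\mathbb N$, $L=1+\log_2(1/h)$, let (A)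 and (B) hold, and let $\alpha\in\mathbb R$ and $\varepsilon_l=\varepsilon_L(h_l/h)^\alpha$ with $(\varepsilon_l)_{l=1}^L\in\mathcal T_{2M}$. Then Algorithm 4 stops on every level, and it costs $$\begin{cases}O\Big(\frac1{\varepsilon_L}\frac d{h^{d-\nu}}\log\frac1h\Big)+O\Big(\frac{d2^d}{h^d}\Big),&\alpha>\nu-d,\\[2mm] O\Big(\frac1{\varepsilon_L}\frac d{h^{d-\nu}}\log^2\frac1h\Big)+O\Big(\frac{d2^d}{h^d}\Big),&\alpha=\nu-d,\\[2mm] O\Big(\frac1{\varepsilon_L}\frac d{h^{-\alpha}}\log\frac1h\Big)+O\Big(\frac{d2^d}{h^d}\Big),&\alpha<\nu-d,\end{cases}$$ with $C$ depending only on $p,C_3,C_4,\nu,\alpha$. -/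

import Mathlib

open scoped ENNReal

noncomputable section

namespace EMD

/-! ### Grids, fields and the discrete divergence -/

/-- The grid `{0, h, 2h, …, 1}^d` with `h = 1/N`; the index `x` stands for the point `(x_j h)_j`. -/
abbrev Grid (d N : ℕ) : Type := Fin d → Fin (N + 1)

/-- Scalar functions on the grid. -/
abbrev Scalar (d N : ℕ) : Type := Grid d N → ℝ

/-- Vector fields on the grid with values in `ℝ^d`. -/
abbrev Field (d N : ℕ) : Type := Grid d N → Fin d → ℝ

/-- The grid step size `h = 1/N`. -/
def gridStep (N : ℕ) : ℝ := 1 / (N : ℝ)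

/-- The values on the grid of a function of the space variable. -/
def sample {d : ℕ} (ρ : (Fin d → ℝ) → ℝ) (N : ℕ) : Scalar d N :=
  fun x => ρ (fun j => ((x j : ℕ) : ℝ) * gridStep N)

/-- The right-hand side `ρ_h = ρ⁰_h - ρ¹_h`. -/
def rhs {d : ℕ} (ρ₀ ρ₁ : (Fin d → ℝ) → ℝ) (N : ℕ) : Scalar d N :=
  fun x => sample ρ₀ N x - sample ρ₁ N x

/-- The neighbour `x - h e_i` (used for `x_i > 0` only). -/
def prev {d N : ℕ} (x : Grid d N) (i : Fin d) : Grid d N :=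
  Function.update x i ⟨(x i : ℕ) - 1, by have := (x i).isLt; omega⟩

/-- The backward difference `D_{h,i} m (x)` with zero-flux boundary conditions. -/
def diff {d N : ℕ} (m : Field d N) (i : Fin d) (x : Grid d N) : ℝ :=
  if (x i : ℕ) = 0 then m x i / gridStep N
  else if (x i : ℕ) < N then (m x i - m (prev x i) i) / gridStep N
  else (-m (prev x i) i) / gridStep N

/-- The discrete divergence `A_h`. -/
def divh {d N : ℕ} (m : Field d N) : Scalar d N := fun x => ∑ i, diff m i x

/-- `⟨φ, ψ⟩_h` for scalar functions. -/
def sInner {d N : ℕ} (φ ψ : Scalar d N) : ℝ := ∑ x, φ x * ψ x * gridStep N ^ d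

/-- `⟨φ, m⟩_h` for vector fields. -/
def vInner {d N : ℕ} (φ m : Field d N) : ℝ := ∑ x, ∑ i, φ x i * m x i * gridStep N ^ d

/-- `‖m‖²_{L²}` for vector fields. -/
def normSq {d N : ℕ} (m : Field d N) : ℝ := vInner m m

/-! ### The saddle point problem -/

/-- The transport cost `f(m) = ∑_x ‖m(x)‖_p h^d`. -/
def cost {d N : ℕ} (p : ℝ≥0∞) (m : Field d N) : ℝ :=
  ∑ x, ‖(WithLp.toLp p (m x) : PiLp p fun _ : Fin d => ℝ)‖ * gridStep N ^ d

/-- The convex conjugate `f^*(φ) = sup_u ⟨φ, u⟩_h - f(u)`. -/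
def costConj {d N : ℕ} (p : ℝ≥0∞) (φ : Field d N) : EReal :=
  ⨆ u : Field d N, ((vInner φ u - cost p u : ℝ) : EReal)

open Classical in
/-- The indicator function of the constraint `A_h m = ρ`. -/
def indicator {d N : ℕ} (ρ : Scalar d N) (m : Field d N) : EReal :=
  if divh m = ρ then 0 else ⊤

/-- The function `L(m, φ) = δ(m) - f^*(φ) + ⟨φ, m⟩_h`. -/
def lagr {d N : ℕ} (p : ℝ≥0∞) (ρ : Scalar d N) (m φ : Field d N) : EReal :=
  indicator ρ m - costConj p φ + ((vInner φ m : ℝ) : EReal)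

/-- The solution set: saddle points `(m, φ)` of `L` (with finite saddle value). -/
def solSet {d N : ℕ} (p : ℝ≥0∞) (ρ : Scalar d N) : Set (Field d N × Field d N) :=
  {y | lagr p ρ y.1 y.2 ≠ ⊤ ∧ lagr p ρ y.1 y.2 ≠ ⊥ ∧
    (∀ φ, lagr p ρ y.1 φ ≤ lagr p ρ y.1 y.2) ∧ ∀ m, lagr p ρ y.1 y.2 ≤ lagr p ρ m y.2}

/-- `‖y‖²_{L²} = ‖m‖²_{L²} + ‖φ‖²_{L²}` for `y = (m, φ)`. -/
def pairNormSq {d N : ℕ} (y : Field d N × Field d N) : ℝ := normSq y.1 + normSq y.2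

/-! ### The primal-dual iteration -/

/-- A minimizer of `F`, if there is one. -/
def argmin {E : Type} [Nonempty E] (F : E → EReal) : E :=
  Classical.epsilon fun x => ∀ y, F x ≤ F y

/-- The primal step size. -/
def stepμ : ℝ := 1 / 2

/-- The dual step size. -/
def stepτ : ℝ := 1 / 2

/-- The state `(m^k, φ^k, φbar^k)` of the iteration. -/
structure State (d N : ℕ) where
  flux : Field d N
  dual : Field d N
  bar : Field d N

/-- One iteration: `m^{k+1} = argmin_m L(m, φbar^k) + ‖m - m^k‖² / (2μ)`,
`φ^{k+1} = argmax_φ L(m^{k+1}, φ) - ‖φ - φ^k‖² / (2τ)`, `φbar^{k+1} = 2 φ^{k+1} - φ^k`.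
In each subproblem the part of `L` that does not depend on the unknown is left out (it may be
infinite), and the maximization is written as the minimization of the negative. -/
def pdStep {d N : ℕ} (p : ℝ≥0∞) (ρ : Scalar d N) (s : State d N) : State d N :=
  let m' : Field d N := argmin fun m =>
    indicator ρ m + ((vInner s.bar m + 1 / (2 * stepμ) * normSq (m - s.flux) : ℝ) : EReal)
  let φ' : Field d N := argmin fun φ =>
    costConj p φ + ((-vInner φ m' + 1 / (2 * stepτ) * normSq (φ - s.dual) : ℝ) : EReal)
  ⟨m', φ', (2 : ℝ) • φ' - s.dual⟩

/-- The iterates from the initial point `y = (m⁰, φ⁰)`, with `φbar⁰ = φ⁰`. -/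
def iter {d N : ℕ} (p : ℝ≥0∞) (ρ : Scalar d N) (y : Field d N × Field d N) : ℕ → State d N
  | 0 => ⟨y.1, y.2, y.2⟩
  | k + 1 => pdStep p ρ (iter p ρ y k)

/-- The pair `(m^k, φ^k)`. -/
def iterPair {d N : ℕ} (p : ℝ≥0∞) (ρ : Scalar d N) (y : Field d N × Field d N) (k : ℕ) :
    Field d N × Field d N :=
  ((iter p ρ y k).flux, (iter p ρ y k).dual)

/-- The fixed point residual of two consecutive states. -/
def residual {d N : ℕ} (s s' : State d N) : ℝ :=
  1 / stepμ * normSq (s'.flux - s.flux) + 1 / stepτ * normSq (s'.dual - s.dual) +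
    2 * vInner (s'.dual - s.dual) (s'.flux - s.flux)

/-- The residual `G^k`. -/
def resid {d N : ℕ} (p : ℝ≥0∞) (ρ : Scalar d N) (y : Field d N × Field d N) (k : ℕ) : ℝ :=
  residual (iter p ρ y k) (iter p ρ y (k + 1))

/-- The stopping condition `G^k < ε` is met at some iteration. -/
def Stops {d N : ℕ} (p : ℝ≥0∞) (ρ : Scalar d N) (y : Field d N × Field d N) (ε : ℝ) : Prop :=
  ∃ k, resid p ρ y k < ε

/-- The number `K` of iterations: the first `k` with `G^k < ε`. -/
def stopIter {d N : ℕ} (p : ℝ≥0∞) (ρ : Scalar d N) (y : Field d N × Field d N) (ε : ℝ) : ℕ :=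
  sInf {k | resid p ρ y k < ε}

/-- The output `(m^K, φ^K)` of the single-level algorithm. -/
def output {d N : ℕ} (p : ℝ≥0∞) (ρ : Scalar d N) (y : Field d N × Field d N) (ε : ℝ) :
    Field d N × Field d N :=
  iterPair p ρ y (stopIter p ρ y ε)

/-- Good stopping tolerances on one grid, for the initial point `y` and the accuracy `δ`:
positive tolerances below a threshold, the threshold being the residual reached at an index `K₀`
from which on all iterates are `δ`-close to the solution set (precisely, the smallest residual up
to `K₀`; so the algorithm does not stop before `K₀`). -/
def GoodTol {d N : ℕ} (p : ℝ≥0∞) (ρ : Scalar d N) (y : Field d N × Field d N) (δ ε : ℝ) : Prop :=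
  0 < ε ∧ ∃ K₀ : ℕ,
    (∀ k, K₀ ≤ k → ∃ z ∈ solSet p ρ, pairNormSq (iterPair p ρ y k - z) ≤ δ) ∧
    ∀ k, k ≤ K₀ → ε ≤ resid p ρ y k

/-! ### Interpolation and the multilevel algorithm -/

/-- Coarse nodes `y` (step `1/N`) in the partial neighbourhood of the fine node `x` (step `1/M`,
`M = 2N`; the coarse index `y_j` is the fine index `2 y_j`) for the interpolation of the `i`-th
component of a field. A coordinate that belongs to the coarse grid is kept. For a coordinate that
does not, both neighbours are taken, except in direction `i`, where the nearest neighbour is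
taken (the lower one: the two are equally near). -/
def IsNbr {d N M : ℕ} (i : Fin d) (x : Grid d M) (y : Grid d N) : Prop :=
  ∀ j, if Even (x j : ℕ) then 2 * (y j : ℕ) = x j
    else if j = i then 2 * (y j : ℕ) + 1 = x j
    else (2 * (y j : ℕ) + 1 = x j ∨ 2 * (y j : ℕ) = x j + 1)

open Classical in
/-- The neighbourhood as a finite set. -/
def nbrs {d N M : ℕ} (i : Fin d) (x : Grid d M) : Finset (Grid d N) :=
  Finset.univ.filter (IsNbr i x)

/-- Interpolation of fields (fluxes and dual variables) from step `1/N` to step `1/M`,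
`M = 2N`. -/
def interp {d N : ℕ} (M : ℕ) (m : Field d N) : Field d M :=
  fun x i => (∑ y ∈ nbrs i x, m y i) / ((nbrs (N := N) i x).card : ℝ)

/-- Interpolation of pairs. -/
def interpPair {d N : ℕ} (M : ℕ) (y : Field d N × Field d N) : Field d M × Field d M :=
  (interp M y.1, interp M y.2)

/-- The initial point on the `(j+1)`-st level (step `2^{-j}`) of the multilevel algorithm with
tolerance `ε j` on that level: zero on the coarsest level, and the interpolation of the output of
the previous level on the others. -/
def levelStart {d : ℕ} (p : ℝ≥0∞) (ρ₀ ρ₁ : (Fin d → ℝ) → ℝ) (ε : ℕ → ℝ) :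
    (j : ℕ) → Field d (2 ^ j) × Field d (2 ^ j)
  | 0 => (0, 0)
  | j + 1 => interpPair (2 ^ (j + 1))
      (output p (rhs ρ₀ ρ₁ (2 ^ j)) (levelStart p ρ₀ ρ₁ ε j) (ε j))

/-- The output `(m^{K_l}, φ^{K_l})` on the `(j+1)`-st level. -/
def levelOutput {d : ℕ} (p : ℝ≥0∞) (ρ₀ ρ₁ : (Fin d → ℝ) → ℝ) (ε : ℕ → ℝ) (j : ℕ) :
    Field d (2 ^ j) × Field d (2 ^ j) :=
  output p (rhs ρ₀ ρ₁ (2 ^ j)) (levelStart p ρ₀ ρ₁ ε j) (ε j)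

/-- `ψ` is a potential recovered from `φ`: `A_h A_h^* ψ = A_h φ`, where `g = A_h^* ψ` is given by
the defining property of the adjoint. -/
def IsPotential {d N : ℕ} (φ : Field d N) (ψ : Scalar d N) : Prop :=
  ∃ g : Field d N, (∀ m : Field d N, vInner g m = sInner ψ (divh m)) ∧ divh g = divh φ

/-- The tolerances `ε_l = ε_L (h_l / h)^α`, where `h = 2^{-n}` and `h_l = 2^{-j}`. -/
def tolerance (εL α : ℝ) (n j : ℕ) : ℝ :=
  εL * (gridStep (2 ^ j) / gridStep (2 ^ n)) ^ α

/-! ### The assumptions -/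

/-- The solution set on the grid is nonempty and bounded by `C₃`. -/
def SolBounded {d N : ℕ} (p : ℝ≥0∞) (ρ : Scalar d N) (C₃ : ℝ) : Prop :=
  (solSet p ρ).Nonempty ∧ ∀ y ∈ solSet p ρ, pairNormSq y ≤ C₃

/-- Every solution for the step `1/N`, interpolated, is `C₄ h^ν`-close to a solution for the step
`1/M`, `M = 2N`. -/
def SolInterp {d : ℕ} (p : ℝ≥0∞) (ρ₀ ρ₁ : (Fin d → ℝ) → ℝ) (N M : ℕ) (C₄ ν : ℝ) : Prop :=
  ∀ y ∈ solSet p (rhs ρ₀ ρ₁ N), ∃ z ∈ solSet p (rhs ρ₀ ρ₁ M),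
    pairNormSq (interpPair M y - z) ≤ C₄ * gridStep N ^ ν

/-! ### Real-arithmetic programs with unit costs -/

/-- Programs over registers named by `ι` that hold real numbers. -/
inductive Prog (ι : Type) : Type
  | skip : Prog ι
  | const (r : ι) (c : ℝ) : Prog ι
  | copy (r a : ι) : Prog ι
  | add (r a b : ι) : Prog ι
  | sub (r a b : ι) : Prog ι
  | mul (r a b : ι) : Prog ι
  | div (r a b : ι) : Prog ι
  | sqrt (r a : ι) : Prog ι
  | seq (P Q : Prog ι) : Prog ι
  | ifLt (a b : ι) (P Q : Prog ι) : Prog ι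
  | untilLt (P : Prog ι) (a b : ι) : Prog ι

open Classical in
/-- The memory after writing `v` into the register `r`. -/
def write {ι : Type} (s : ι → ℝ) (r : ι) (v : ℝ) : ι → ℝ := fun q => if q = r then v else s q

/-- `Exec P s t c`: started with memory `s`, the program `P` halts with memory `t` after `c`
operations. Every arithmetic operation, square root, load, copy and comparison counts as one.
`ifLt a b P Q` runs `P` if register `a` is smaller than register `b`, and `Q` otherwise;
`untilLt P a b` repeats `P` until register `a` is smaller than register `b`. -/
inductive Exec {ι : Type} : Prog ι → (ι → ℝ) → (ι → ℝ) → ℕ → Prop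
  | skip (s) : Exec .skip s s 0
  | const (s r c) : Exec (.const r c) s (write s r c) 1
  | copy (s r a) : Exec (.copy r a) s (write s r (s a)) 1
  | add (s r a b) : Exec (.add r a b) s (write s r (s a + s b)) 1
  | sub (s r a b) : Exec (.sub r a b) s (write s r (s a - s b)) 1
  | mul (s r a b) : Exec (.mul r a b) s (write s r (s a * s b)) 1
  | div (s r a b) : Exec (.div r a b) s (write s r (s a / s b)) 1
  | sqrt (s r a) : Exec (.sqrt r a) s (write s r (Real.sqrt (s a))) 1
  | seq {P Q s t u c e} : Exec P s t c → Exec Q t u e → Exec (.seq P Q) s u (c + e)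
  | ifTrue {P Q s t c a b} : s a < s b → Exec P s t c → Exec (.ifLt a b P Q) s t (c + 1)
  | ifFalse {P Q s t c a b} : ¬ s a < s b → Exec Q s t c → Exec (.ifLt a b P Q) s t (c + 1)
  | untilStop {P s t c a b} : Exec P s t c → t a < t b → Exec (.untilLt P a b) s t (c + 1)
  | untilLoop {P s t u c e a b} : Exec P s t c → ¬ t a < t b → Exec (.untilLt P a b) t u e →
      Exec (.untilLt P a b) s u (c + 1 + e)

/-- The registers for the grid with step `1/N` and `L` tolerances: input data, tolerances, the
state of the iteration, the potential, the residual, and unlimited working registers. -/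
inductive Reg (d N L : ℕ) : Type
  | rho0 (x : Grid d N)
  | rho1 (x : Grid d N)
  | tol (l : Fin L)
  | flux (x : Grid d N) (i : Fin d)
  | dual (x : Grid d N) (i : Fin d)
  | bar (x : Grid d N) (i : Fin d)
  | pot (x : Grid d N)
  | res
  | work (k : ℕ)

/-- The memory that holds the grid values of `ρ⁰` and `ρ¹`, the tolerances `ε` and the state `s`,
and zeros elsewhere. -/
def memory {d N L : ℕ} (ρ₀ ρ₁ : (Fin d → ℝ) → ℝ) (ε : Fin L → ℝ) (s : State d N) :
    Reg d N L → ℝ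
  | .rho0 x => sample ρ₀ N x
  | .rho1 x => sample ρ₁ N x
  | .tol l => ε l
  | .flux x i => s.flux x i
  | .dual x i => s.dual x i
  | .bar x i => s.bar x i
  | .pot _ => 0
  | .res => 0
  | .work _ => 0

/-- The zero state. -/
def zeroState (d N : ℕ) : State d N := ⟨0, 0, 0⟩

/-- The memory holds the pair `(m, φ)` in its flux and dual registers. -/
def Holds {d N L : ℕ} (t : Reg d N L → ℝ) (y : Field d N × Field d N) : Prop :=
  (∀ x i, t (.flux x i) = y.1 x i) ∧ ∀ x i, t (.dual x i) = y.2 x i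

end EMD

end

/-!
The proof has an analytic and an algorithmic half, which meet in the geometric sum of the level
costs.

**Number of iterations.** Both subproblems of an iteration have explicit solutions: the flux is
projected onto `A_h m = ρ` by solving a discrete Neumann problem, and the dual variable is projected
at every node onto the ball dual to `‖·‖_p` (`pdStep_eq`). The optimality conditions of an iterate
and of a saddle point `z` show that `lyapunov z` decreases by at least a sixth of the residual
`G^k` (`lyapunov_step`). Since it starts at `D = ‖y⁰ - z‖²`, the residuals have sum at most `6 D`,
so the loop ends after at most `6 D / ε` iterations (`stops_and_stopIter_le`). A good tolerance
makes the output of a level `C₄ h_l^ν`-close to a saddle point, and interpolation does not increase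
the norm (`normSq_interp_le`), so `D = O(h_l^ν)` on every level
(`exists_solSet_near_levelStart`).

**Cost of an iteration.** Computations are first described as straight-line computations: sets of
known quantities that grow by one operation at a time (`Computes`). These compile to programs
(`Computes.exists_prog`); branches are not needed since `|x| = √(x * x)` gives maxima and minima.
The Neumann problem is diagonalized by cosine transforms in the `d` directions. The length `N + 1`
need not be a power of two, but a cosine transform is a Toeplitz matrix up to diagonal factors
(`cosMat_eq_re`), and a Toeplitz matrix is part of a circulant matrix whose size is a power of two
(`Computes.toeplitz`). The remaining operations take a number of steps per node that depends on `d`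
only, so for small `h` they are absorbed by the factor `log (1/h)` (`exists_loopCost_le`).

**Summation.** The level with step `2^{-j}` makes at most `(6 D / ε_L) 2^{-(n-j)α - jν}` iterations
at the cost of a fast Fourier transform, so the total is governed by `∑_j 2^{j(α - ν + d)}`. The
exponents `α - ν + d`, `d ∈ ℕ`, stay away from zero unless they vanish (`exists_gap`), which makes
the constants independent of `d` (`exists_sum_levels_le`). A good tolerance is not met by the
initial point, so there is at least one iteration on the finest level, and its cost covers that of
the potential.
-/

noncomputable section

namespace EMD

variable {S : Type} {K K' K₁ T T' : Set (S → ℝ)} {a b c : ℕ}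

/-! ### Straight-line computations -/

/-- `OneOp K v`: the quantity `v` results from quantities in `K` by a single operation. A quantity
is a real-valued function of the input `s : S`. -/
inductive OneOp {S : Type} (K : Set (S → ℝ)) : (S → ℝ) → Prop
  | const (c : ℝ) : OneOp K (fun _ => c)
  | add {f g : S → ℝ} : f ∈ K → g ∈ K → OneOp K (fun s => f s + g s)
  | sub {f g : S → ℝ} : f ∈ K → g ∈ K → OneOp K (fun s => f s - g s)
  | mul {f g : S → ℝ} : f ∈ K → g ∈ K → OneOp K (fun s => f s * g s)
  | div {f g : S → ℝ} : f ∈ K → g ∈ K → OneOp K (fun s => f s / g s)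
  | sqrt {f : S → ℝ} : f ∈ K → OneOp K (fun s => Real.sqrt (f s))

/-- `Derives K c K'`: starting with the known quantities `K`, a sequence of `c` operations, each of
which adds one quantity, leads to the known quantities `K'`. -/
inductive Derives {S : Type} : Set (S → ℝ) → ℕ → Set (S → ℝ) → Prop
  | refl (K : Set (S → ℝ)) : Derives K 0 K
  | step {K K' : Set (S → ℝ)} {v : S → ℝ} {c : ℕ} :
      OneOp K v → Derives (insert v K) c K' → Derives K (c + 1) K'

theorem OneOp.mono {v : S → ℝ} (h : OneOp K v) (hK : K ⊆ K₁) : OneOp K₁ v := by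
  cases h with
  | const c => exact .const c
  | add hf hg => exact .add (hK hf) (hK hg)
  | sub hf hg => exact .sub (hK hf) (hK hg)
  | mul hf hg => exact .mul (hK hf) (hK hg)
  | div hf hg => exact .div (hK hf) (hK hg)
  | sqrt hf => exact .sqrt (hK hf)

theorem Derives.subset (h : Derives K c K') : K ⊆ K' := by
  induction h with
  | refl K => exact subset_rfl
  | step _ _ ih => exact (Set.subset_insert _ _).trans ih

theorem Derives.mono (h : Derives K c K') : ∀ {K₁}, K ⊆ K₁ → Derives K₁ c (K₁ ∪ K') := by
  induction h with
  | refl K => intro K₁ hK; rw [Set.union_eq_self_of_subset_right hK]; exact .refl _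
  | @step K K' v c hv hd ih =>
    intro K₁ hK
    refine .step (hv.mono hK) ?_
    have hmem : v ∈ K₁ ∪ K' := Or.inr (hd.subset (Set.mem_insert _ _))
    have := ih (Set.insert_subset_insert (a := v) hK)
    rwa [Set.insert_union, Set.insert_eq_of_mem hmem] at this

theorem Derives.trans (h : Derives K a K₁) (h' : Derives K₁ b K') : Derives K (a + b) K' := by
  induction h with
  | refl K => simpa using h'
  | @step K _ v c hv hd ih =>
    rw [Nat.add_right_comm]
    exact .step hv (ih h')

/-- `Computes K c T`: from the known quantities `K`, all quantities in `T` can be computed with at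
most `c` operations. -/
def Computes (K : Set (S → ℝ)) (c : ℕ) (T : Set (S → ℝ)) : Prop :=
  ∃ c' ≤ c, ∃ K', Derives K c' K' ∧ T ⊆ K'

theorem Computes.of_subset (h : T ⊆ K) (c : ℕ := 0) : Computes K c T :=
  ⟨0, Nat.zero_le _, K, .refl K, h⟩

theorem Computes.mono (h : Computes K a T) (hK : K ⊆ K₁) (hT : T' ⊆ T) (hc : a ≤ b) :
    Computes K₁ b T' := by
  obtain ⟨c', hc', K', hd, hs⟩ := h
  exact ⟨c', hc'.trans hc, _, hd.mono hK, hT.trans (hs.trans Set.subset_union_right)⟩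

theorem Computes.le (h : Computes K a T) (hc : a ≤ b) : Computes K b T :=
  h.mono subset_rfl subset_rfl hc

theorem Computes.trans_union (h : Computes K a T) (h' : Computes (K ∪ T) b T') :
    Computes K (a + b) (T ∪ T') := by
  obtain ⟨a', ha, K', hd, hs⟩ := h
  obtain ⟨b', hb, K'', hd', hs'⟩ := h'
  refine ⟨a' + b', by omega, _, hd.trans (hd'.mono (Set.union_subset hd.subset hs)), ?_⟩
  exact Set.union_subset_union hs hs'

theorem Computes.trans (h : Computes K a T) (h' : Computes (K ∪ T) b T') :
    Computes K (a + b) T' :=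
  (h.trans_union h').mono subset_rfl Set.subset_union_right le_rfl

theorem Computes.union (h : Computes K a T) (h' : Computes K b T') :
    Computes K (a + b) (T ∪ T') :=
  h.trans_union (h'.mono Set.subset_union_left subset_rfl le_rfl)

theorem Computes.biUnion {α : Type*} (s : Finset α) {c : α → ℕ} {T : α → Set (S → ℝ)}
    (h : ∀ i ∈ s, Computes K (c i) (T i)) : Computes K (∑ i ∈ s, c i) (⋃ i ∈ s, T i) := by
  classical
  induction s using Finset.induction_on with
  | empty => exact Computes.of_subset (by simp)
  | insert i s hi ih =>
    rw [Finset.sum_insert hi, Finset.set_biUnion_insert]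
    exact (h i (Finset.mem_insert_self _ _)).union
      (ih fun j hj => h j (Finset.mem_insert_of_mem hj))

theorem Computes.iUnion {α : Type*} [Fintype α] {c : ℕ} {T : α → Set (S → ℝ)}
    (h : ∀ i, Computes K c (T i)) : Computes K (Fintype.card α * c) (⋃ i, T i) := by
  have := Computes.biUnion (Finset.univ : Finset α) (c := fun _ => c) fun i _ => h i
  simpa using this

/-- `Known K F`: all components of the vector-valued quantity `F` are in `K`. -/
def Known {α : Type*} (K : Set (S → ℝ)) (F : S → α → ℝ) : Prop := ∀ a, (fun s => F s a) ∈ K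

/-- The components of a vector-valued quantity. -/
def comps {α : Type*} (F : S → α → ℝ) : Set (S → ℝ) := Set.range fun a s => F s a

theorem known_iff {α : Type*} {F : S → α → ℝ} : Known K F ↔ comps F ⊆ K :=
  Set.range_subset_iff.symm

theorem Known.mono {α : Type*} {F : S → α → ℝ} (h : Known K F) (hK : K ⊆ K₁) : Known K₁ F :=
  fun a => hK (h a)

theorem known_union_comps {α : Type*} (K : Set (S → ℝ)) (F : S → α → ℝ) :
    Known (K ∪ comps F) F := fun a => Or.inr ⟨a, rfl⟩

theorem Computes.comps {α : Type*} [Fintype α] {F : S → α → ℝ}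
    (h : ∀ i, Computes K c {fun s => F s i}) : Computes K (Fintype.card α * c) (comps F) :=
  (Computes.iUnion h).mono subset_rfl
    (by rintro _ ⟨i, rfl⟩; exact Set.mem_iUnion.2 ⟨i, rfl⟩) le_rfl

/-! ### Costs of expressions -/

section Expr

variable {f g : S → ℝ}

theorem Computes.var (h : f ∈ K) : Computes K 0 {f} := .of_subset (by simpa using h)

theorem Computes.of_oneOp (h : OneOp K f) : Computes K 1 {f} :=
  ⟨1, le_rfl, _, .step h (.refl _), by simp⟩

theorem Computes.const (r : ℝ) : Computes K 1 {fun _ => r} := .of_oneOp (.const r)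

theorem Computes.binary {v : S → ℝ} (hf : Computes K a {f}) (hg : Computes K b {g})
    (h : ∀ {K : Set (S → ℝ)}, f ∈ K → g ∈ K → OneOp K v) : Computes K (a + b + 1) {v} :=
  (hf.union hg).trans (.of_oneOp (h (by simp) (by simp)))

theorem Computes.add (hf : Computes K a {f}) (hg : Computes K b {g}) :
    Computes K (a + b + 1) {fun s => f s + g s} := hf.binary hg .add

theorem Computes.sub (hf : Computes K a {f}) (hg : Computes K b {g}) :
    Computes K (a + b + 1) {fun s => f s - g s} := hf.binary hg .sub

theorem Computes.mul (hf : Computes K a {f}) (hg : Computes K b {g}) :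
    Computes K (a + b + 1) {fun s => f s * g s} := hf.binary hg .mul

theorem Computes.div (hf : Computes K a {f}) (hg : Computes K b {g}) :
    Computes K (a + b + 1) {fun s => f s / g s} := hf.binary hg .div

theorem Computes.sqrt (hf : Computes K a {f}) : Computes K (a + 1) {fun s => Real.sqrt (f s)} :=
  hf.trans (.of_oneOp (.sqrt (by simp)))

theorem Computes.const_mul (r : ℝ) (hf : Computes K a {f}) :
    Computes K (a + 2) {fun s => r * f s} :=
  ((Computes.const r).mul hf).le (by omega)

theorem Computes.neg (hf : Computes K a {f}) : Computes K (a + 2) {fun s => -f s} := by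
  simpa using Computes.const_mul (-1) hf

theorem Computes.sum {α : Type*} (t : Finset α) {F : α → S → ℝ}
    (h : ∀ i ∈ t, Computes K c {F i}) : Computes K (t.card * (c + 1) + 1)
      {fun s => ∑ i ∈ t, F i s} := by
  classical
  induction t using Finset.induction_on with
  | empty => simpa using Computes.const (K := K) 0
  | insert i t hi ih =>
    simp only [Finset.sum_insert hi, Finset.card_insert_of_notMem hi]
    exact ((h i (Finset.mem_insert_self _ _)).add
      (ih fun j hj => h j (Finset.mem_insert_of_mem hj))).le (by ring_nf; omega)

/-- Absolute values cost two operations, as `|x| = √(x * x)`. -/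
theorem Computes.abs (hf : Computes K a {f}) : Computes K (a + 2) {fun s => |f s|} := by
  have h : Computes (K ∪ {f}) 2 {fun s => Real.sqrt (f s * f s)} :=
    ((Computes.var (by simp)).mul (.var (by simp))).sqrt
  simpa [Real.sqrt_mul_self_eq_abs] using hf.trans h

theorem Computes.max (hf : Computes K a {f}) (hg : Computes K b {g}) :
    Computes K (a + b + 7) {fun s => f s ⊔ g s} := by
  have hf' : Computes (K ∪ ({f} ∪ {g})) 0 {f} := .var (by simp)
  have hg' : Computes (K ∪ ({f} ∪ {g})) 0 {g} := .var (by simp)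
  have h := ((hf'.add hg').add (hf'.sub hg').abs).div (Computes.const 2)
  have e : (fun s => (f s + g s + |f s - g s|) / 2) = fun s => f s ⊔ g s := by
    funext s
    rcases le_total (f s) (g s) with h | h
    · rw [sup_eq_right.2 h, abs_of_nonpos (by linarith)]; ring
    · rw [sup_eq_left.2 h, abs_of_nonneg (by linarith)]; ring
  rw [e] at h
  exact ((hf.union hg).trans h).le (by omega)

theorem Computes.min (hf : Computes K a {f}) (hg : Computes K b {g}) :
    Computes K (a + b + 7) {fun s => f s ⊓ g s} := by
  have hf' : Computes (K ∪ ({f} ∪ {g})) 0 {f} := .var (by simp)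
  have hg' : Computes (K ∪ ({f} ∪ {g})) 0 {g} := .var (by simp)
  have h := ((hf'.add hg').sub (hf'.sub hg').abs).div (Computes.const 2)
  have e : (fun s => (f s + g s - |f s - g s|) / 2) = fun s => f s ⊓ g s := by
    funext s
    rcases le_total (f s) (g s) with h | h
    · rw [inf_eq_left.2 h, abs_of_nonpos (by linarith)]; ring
    · rw [inf_eq_right.2 h, abs_of_nonneg (by linarith)]; ring
  rw [e] at h
  exact ((hf.union hg).trans h).le (by omega)

theorem Computes.sup' {α : Type*} (t : Finset α) (ht : t.Nonempty) {F : α → S → ℝ}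
    (h : ∀ i ∈ t, Computes K c {F i}) : Computes K (t.card * (c + 7))
      {fun s => t.sup' ht fun i => F i s} := by
  induction ht using Finset.Nonempty.cons_induction with
  | singleton i => simpa using (h i (by simp)).le (Nat.le_add_right c 7)
  | cons i t hi ht ih =>
    simp only [Finset.sup'_cons ht, Finset.card_cons]
    exact ((h i (by simp)).max (ih fun j hj => h j (by simp [hj]))).le (by ring_nf; omega)

end Expr

/-! ### From straight-line computations to programs -/

/-- Every quantity in `K` is held in a register that is not among the fresh ones `w k`, `k ≥ k₀`;
the memory depends on the input `s`. -/
def Stored {ι : Type} (w : ℕ → ι) (M : S → ι → ℝ) (k₀ : ℕ) (K : Set (S → ℝ)) : Prop :=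
  ∀ v ∈ K, ∃ r, (∀ k, k₀ ≤ k → r ≠ w k) ∧ ∀ s, M s r = v s

theorem Stored.write {ι : Type} {w : ℕ → ι} (hw : Function.Injective w) {M : S → ι → ℝ} {k₀ : ℕ}
    (h : Stored w M k₀ K) (v : S → ℝ) :
    Stored w (fun s => write (M s) (w k₀) (v s)) (k₀ + 1) (insert v K) := by
  rintro u (rfl | hu)
  · exact ⟨w k₀, fun k hk e => by have := hw e; omega, fun s => by simp [EMD.write]⟩
  · obtain ⟨r, hr, hM⟩ := h u hu
    exact ⟨r, fun k hk => hr k (by omega), fun s => by simp [EMD.write, hr k₀ le_rfl, hM]⟩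

theorem OneOp.exists_prog {ι : Type} {w : ℕ → ι} {M : S → ι → ℝ} {k₀ : ℕ} (h : Stored w M k₀ K)
    {v : S → ℝ} (hv : OneOp K v) (q : ι) :
    ∃ P : Prog ι, ∀ s, Exec P (M s) (write (M s) q (v s)) 1 := by
  cases hv with
  | const c => exact ⟨.const q c, fun s => .const _ _ _⟩
  | add hf hg =>
    obtain ⟨r, -, hr⟩ := h _ hf
    obtain ⟨r', -, hr'⟩ := h _ hg
    exact ⟨.add q r r', fun s => by simpa [hr, hr'] using Exec.add (M s) q r r'⟩
  | sub hf hg =>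
    obtain ⟨r, -, hr⟩ := h _ hf
    obtain ⟨r', -, hr'⟩ := h _ hg
    exact ⟨.sub q r r', fun s => by simpa [hr, hr'] using Exec.sub (M s) q r r'⟩
  | mul hf hg =>
    obtain ⟨r, -, hr⟩ := h _ hf
    obtain ⟨r', -, hr'⟩ := h _ hg
    exact ⟨.mul q r r', fun s => by simpa [hr, hr'] using Exec.mul (M s) q r r'⟩
  | div hf hg =>
    obtain ⟨r, -, hr⟩ := h _ hf
    obtain ⟨r', -, hr'⟩ := h _ hg
    exact ⟨.div q r r', fun s => by simpa [hr, hr'] using Exec.div (M s) q r r'⟩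
  | sqrt hf =>
    obtain ⟨r, -, hr⟩ := h _ hf
    exact ⟨.sqrt q r, fun s => by simpa [hr] using Exec.sqrt (M s) q r⟩

theorem Derives.exists_prog {ι : Type} {w : ℕ → ι} (hw : Function.Injective w)
    (h : Derives K c K') : ∀ (M : S → ι → ℝ) (k₀ : ℕ), Stored w M k₀ K →
      ∃ (P : Prog ι) (M' : S → ι → ℝ), (∀ s, Exec P (M s) (M' s) c) ∧ Stored w M' (k₀ + c) K' ∧
        ∀ s r, (∀ k, r ≠ w k) → M' s r = M s r := by
  induction h with
  | refl K => exact fun M k₀ hM => ⟨.skip, M, fun s => .skip _, hM, fun _ _ _ => rfl⟩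
  | @step K K' v c hv hd ih =>
    intro M k₀ hM
    obtain ⟨P, hP⟩ := hv.exists_prog hM (w k₀)
    obtain ⟨Q, M', hQ, hM', hr⟩ := ih _ _ (hM.write hw v)
    refine ⟨.seq P Q, M', fun s => ?_, ?_, fun s r h => ?_⟩
    · rw [add_comm]; exact .seq (hP s) (hQ s)
    · rwa [add_assoc, add_comm 1 c] at hM'
    · rw [hr s r h, EMD.write, if_neg (h k₀)]

/-- A straight-line computation as a program: all results are first gathered in work registers, so
that the final copies to the output registers `O` do not destroy a value that is still needed. -/
theorem Computes.exists_prog {ι : Type} {w : ℕ → ι} (hw : Function.Injective w) (O : Finset ι)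
    (hO : ∀ r ∈ O, ∀ k, r ≠ w k) (v : ι → (ι → ℝ) → ℝ) {c : ℕ}
    (h : Computes {f : (ι → ℝ) → ℝ | ∃ r, (∀ k, r ≠ w k) ∧ f = fun s => s r} c
      {f | ∃ r ∈ O, f = v r}) :
    ∃ (P : Prog ι) (c' : ℕ), c' ≤ c + 2 * O.card ∧ ∀ s, ∃ t, Exec P s t c' ∧
      (∀ r ∈ O, t r = v r s) ∧ ∀ r ∉ O, (∀ k, r ≠ w k) → t r = s r := by
  classical
  obtain ⟨c₁, hc₁, K', hd, hT⟩ := h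
  obtain ⟨P, M, hP, hM, hMr⟩ := hd.exists_prog hw (fun s => s) 0 (by
    rintro f ⟨r, hr, rfl⟩; exact ⟨r, fun k _ => hr k, fun s => rfl⟩)
  have gather : ∀ U : Finset ι, U ⊆ O → ∃ (Q : Prog ι) (M' : (ι → ℝ) → ι → ℝ) (k₁ : ℕ),
      (∀ s, Exec Q (M s) (M' s) U.card) ∧ Stored w M' k₁ K' ∧
      (∀ s r, (∀ k, r ≠ w k) → M' s r = M s r) ∧
      ∀ r ∈ U, ∃ k < k₁, ∀ s, M' s (w k) = v r s := by
    intro U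
    induction U using Finset.induction_on with
    | empty => exact fun _ => ⟨.skip, M, _, fun s => .skip _, hM, fun _ _ _ => rfl, by simp⟩
    | insert r U hr ih =>
      intro hU
      obtain ⟨Q, M', k₁, hQ, hS, hk, hU'⟩ := ih ((Finset.subset_insert _ _).trans hU)
      obtain ⟨q, hq, hqv⟩ := hS (v r) (hT ⟨r, hU (Finset.mem_insert_self _ _), rfl⟩)
      refine ⟨.seq Q (.copy (w k₁) q), _, k₁ + 1, fun s => ?_,
        fun u hu => hS.write hw (v r) u (Set.mem_insert_of_mem _ hu), fun s p hp => ?_,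
        fun p hp => ?_⟩
      · rw [Finset.card_insert_of_notMem hr]
        refine .seq (hQ s) ?_
        simpa [hqv] using Exec.copy (M' s) (w k₁) q
      · simp [EMD.write, hp k₁, hk s p hp]
      · rcases Finset.mem_insert.1 hp with rfl | hp
        · exact ⟨k₁, by omega, fun s => by simp [EMD.write]⟩
        · obtain ⟨k, hk, hkv⟩ := hU' p hp
          refine ⟨k, by omega, fun s => ?_⟩
          rw [EMD.write, if_neg (fun e => by have := hw e; omega), hkv]
  obtain ⟨Q, M', k₁, hQ, -, hk, hU⟩ := gather O subset_rfl
  have scatter : ∀ U : Finset ι, U ⊆ O → ∃ (R : Prog ι) (M'' : (ι → ℝ) → ι → ℝ),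
      (∀ s, Exec R (M' s) (M'' s) U.card) ∧ (∀ s, ∀ r ∈ U, M'' s r = v r s) ∧
      ∀ s, ∀ r ∉ U, M'' s r = M' s r := by
    intro U
    induction U using Finset.induction_on with
    | empty => exact fun _ => ⟨.skip, M', fun s => .skip _, by simp, fun _ _ _ => rfl⟩
    | insert r U hr ih =>
      intro hrU
      obtain ⟨R, M'', hR, hv, hn⟩ := ih ((Finset.subset_insert _ _).trans hrU)
      have hrO := hrU (Finset.mem_insert_self _ _)
      obtain ⟨k, -, hkv⟩ := hU r hrO
      have hwk : w k ∉ U := fun h => hO _ (hrU (Finset.mem_insert_of_mem h)) k rfl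
      refine ⟨.seq R (.copy r (w k)), fun s => write (M'' s) r (v r s), fun s => ?_,
        fun s p hp => ?_, fun s p hp => ?_⟩
      · rw [Finset.card_insert_of_notMem hr]
        refine .seq (hR s) ?_
        have := Exec.copy (M'' s) r (w k)
        rwa [hn s _ hwk, hkv] at this
      · rcases Finset.mem_insert.1 hp with rfl | hp
        · simp [EMD.write]
        · have hpr : p ≠ r := fun e => hr (e ▸ hp)
          simp only [EMD.write]
          rw [if_neg hpr, hv s p hp]
      · rw [Finset.mem_insert, not_or] at hp
        simp only [EMD.write]
        rw [if_neg hp.1, hn s p hp.2]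
  obtain ⟨R, M'', hR, hv, hn⟩ := scatter O subset_rfl
  refine ⟨.seq P (.seq Q R), c₁ + (O.card + O.card), by omega, fun s =>
    ⟨M'' s, .seq (hP s) (.seq (hQ s) (hR s)), fun r hr => hv s r hr, fun r hr hrw => ?_⟩⟩
  rw [hn s r hr, hk s r hrw, hMr s r hrw]

/-! ### Fast Fourier and cosine transforms -/

/-- The real and imaginary part of a complex quantity. -/
def parts (z : S → ℂ) : Set (S → ℝ) := {fun s => (z s).re, fun s => (z s).im}

theorem parts_subset {z : S → ℂ} :
    parts z ⊆ K ↔ (fun s => (z s).re) ∈ K ∧ (fun s => (z s).im) ∈ K := by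
  simp [parts, Set.insert_subset_iff]

theorem Computes.parts {z : S → ℂ} (h : Computes K a {fun s => (z s).re})
    (h' : Computes K b {fun s => (z s).im}) : Computes K (a + b) (parts z) :=
  h.union h'

theorem Computes.butterfly {x y : S → ℂ} (hx : EMD.parts x ⊆ K) (hy : EMD.parts y ⊆ K) (w : ℂ) :
    Computes K 12 (EMD.parts fun s => x s + w * y s) := by
  rw [parts_subset] at hx hy
  have h₁ := (Computes.var hx.1).add
    (((Computes.var hy.1).const_mul w.re).sub ((Computes.var hy.2).const_mul w.im))
  have h₂ := (Computes.var hx.2).add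
    (((Computes.var hy.2).const_mul w.re).add ((Computes.var hy.1).const_mul w.im))
  exact Computes.parts (z := fun s => x s + w * y s) (a := 6) (b := 6)
    (by simpa using h₁) (by simpa using h₂)

theorem Computes.parts_const_mul {x : S → ℂ} (hx : EMD.parts x ⊆ K) (w : ℂ) :
    Computes K 12 (EMD.parts fun s => w * x s) := by
  rw [parts_subset] at hx
  have h₁ := ((Computes.var hx.1).const_mul w.re).sub ((Computes.var hx.2).const_mul w.im)
  have h₂ := ((Computes.var hx.2).const_mul w.re).add ((Computes.var hx.1).const_mul w.im)
  exact (Computes.parts (by simpa using h₁) (by simpa using h₂)).le (by norm_num)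

theorem sum_range_two_mul {A : Type*} [AddCommMonoid A] (f : ℕ → A) (n : ℕ) :
    ∑ l ∈ Finset.range (2 * n), f l =
      ∑ l ∈ Finset.range n, f (2 * l) + ∑ l ∈ Finset.range n, f (2 * l + 1) := by
  induction n with
  | zero => simp
  | succ n ih =>
    rw [Nat.mul_succ, Finset.sum_range_succ, Finset.sum_range_succ, ih, Finset.sum_range_succ,
      Finset.sum_range_succ]
    abel

/-- The radix-two fast Fourier transform. -/
theorem Computes.fft (k : ℕ) : ∀ {K : Set (S → ℝ)} (ω : ℂ), ω ^ 2 ^ k = 1 → ∀ x : ℕ → S → ℂ,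
    (∀ l < 2 ^ k, EMD.parts (x l) ⊆ K) → Computes K (12 * (k * 2 ^ k))
      (⋃ j ∈ Finset.range (2 ^ k),
        EMD.parts fun s => ∑ l ∈ Finset.range (2 ^ k), ω ^ (j * l) * x l s) := by
  induction k with
  | zero =>
    intro K ω _ x hx
    exact Computes.of_subset (by simpa using hx 0 (by simp)) _
  | succ k ih =>
    intro K ω hω x hx
    have hω' : (ω ^ 2) ^ 2 ^ k = 1 := by rw [← pow_mul, ← pow_succ', hω]
    have he := ih (K := K) (ω ^ 2) hω' (fun l => x (2 * l))
      fun l hl => hx _ (by rw [pow_succ]; omega)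
    have ho := ih (K := K) (ω ^ 2) hω' (fun l => x (2 * l + 1))
      fun l hl => hx _ (by rw [pow_succ]; omega)
    refine (((he.union ho).trans (Computes.biUnion (Finset.range (2 ^ (k + 1)))
      (c := fun _ => 12) fun j hj => ?_))).le (b := 12 * ((k + 1) * 2 ^ (k + 1)))
      (by simp only [Finset.sum_const, Finset.card_range, smul_eq_mul]; ring_nf; omega)
    have hj' : j % 2 ^ k ∈ Finset.range (2 ^ k) := by
      simpa using Nat.mod_lt _ (by positivity)
    have e : (fun s => ∑ l ∈ Finset.range (2 ^ (k + 1)), ω ^ (j * l) * x l s) = fun s =>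
        (∑ l ∈ Finset.range (2 ^ k), (ω ^ 2) ^ (j % 2 ^ k * l) * x (2 * l) s) +
        ω ^ j * ∑ l ∈ Finset.range (2 ^ k), (ω ^ 2) ^ (j % 2 ^ k * l) * x (2 * l + 1) s := by
      funext s
      rw [pow_succ', sum_range_two_mul, Finset.mul_sum]
      have hmod : ∀ l, (ω ^ 2) ^ (j % 2 ^ k * l) = (ω ^ 2) ^ (j * l) := fun l => by
        rw [pow_mul, ← pow_eq_pow_mod _ hω', ← pow_mul]
      congr 1
      · refine Finset.sum_congr rfl fun l _ => ?_
        rw [hmod]; ring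
      · refine Finset.sum_congr rfl fun l _ => ?_
        rw [hmod]; ring
    rw [e]
    refine Computes.butterfly ?_ ?_ _
    · exact (Set.subset_biUnion_of_mem (u := fun j => EMD.parts fun s =>
        ∑ l ∈ Finset.range (2 ^ k), (ω ^ 2) ^ (j * l) * x (2 * l) s) hj').trans
        (Set.subset_union_left.trans Set.subset_union_right)
    · exact (Set.subset_biUnion_of_mem (u := fun j => EMD.parts fun s =>
        ∑ l ∈ Finset.range (2 ^ k), (ω ^ 2) ^ (j * l) * x (2 * l + 1) s) hj').trans
        (Set.subset_union_right.trans Set.subset_union_right)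

/-- A function on `ℤ / M` is a combination of powers of a root of unity. -/
theorem exists_fourier_coeff (M : ℕ) [NeZero M] (g : ZMod M → ℂ) : ∃ (ζ : ℂ) (γ : ℕ → ℂ),
    ζ ^ M = 1 ∧ ∀ b : ℤ, g b = ∑ l ∈ Finset.range M, γ l * ζ ^ ((l : ℤ) * b) := by
  have hM : (M : ℂ) ≠ 0 := NeZero.ne _
  refine ⟨Complex.exp (2 * Real.pi * Complex.I / M),
    fun l => (M : ℂ)⁻¹ * ZMod.dft g (l : ZMod M), ?_, fun b => ?_⟩
  · rw [← Complex.exp_nat_mul, Complex.exp_eq_one_iff]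
    exact ⟨1, by field_simp; simp⟩
  · have h := congrFun (ZMod.dft.symm_apply_apply g) (b : ZMod M)
    rw [ZMod.invDFT_apply] at h
    rw [← h, smul_eq_mul, Finset.mul_sum]
    have h2 : ∀ F : ZMod M → ℂ, ∑ j, F j = ∑ l ∈ Finset.range M, F (l : ZMod M) := by
      intro F
      refine (Finset.sum_bij (fun (l : ℕ) _ => (l : ZMod M)) (by simp) ?_ ?_ (by simp)).symm
      · intro l hl l' hl' e
        have := (ZMod.natCast_eq_natCast_iff' l l' M).1 e
        rwa [Nat.mod_eq_of_lt (by simpa using hl), Nat.mod_eq_of_lt (by simpa using hl')] at this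
      · exact fun z _ => ⟨z.val, by simpa using z.val_lt, by simp⟩
    rw [h2]
    refine Finset.sum_congr rfl fun l _ => ?_
    have : ((l : ZMod M) * (b : ZMod M)) = (((l : ℤ) * b : ℤ) : ZMod M) := by push_cast; rfl
    rw [this, ZMod.stdAddChar_coe, ← Complex.exp_int_mul, smul_eq_mul]
    have e : 2 * Real.pi * Complex.I * (((l : ℤ) * b : ℤ) : ℂ) / M =
        (((l : ℤ) * b : ℤ) : ℂ) * (2 * Real.pi * Complex.I / M) := by ring
    rw [e]; ring

/-- Multiplication by a Toeplitz matrix: embedded into a circulant matrix whose size is a power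
of two, it is diagonalized by the fast Fourier transform. -/
theorem Computes.toeplitz {n q : ℕ} (hq : 2 * n ≤ 2 ^ q) (t : ℤ → ℂ) (x : ℕ → S → ℂ)
    (hx : ∀ j < n, EMD.parts (x j) ⊆ K) :
    Computes K (24 * (q * 2 ^ q) + 12 * 2 ^ q + 1) (⋃ i ∈ Finset.range n,
      EMD.parts fun s => ∑ j ∈ Finset.range n, t ((i : ℤ) - j) * x j s) := by
  set M := 2 ^ q with hM
  have : NeZero M := ⟨by positivity⟩
  obtain ⟨ζ, γ, hζ, hg⟩ := exists_fourier_coeff M fun z => t z.valMinAbs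
  have hζ0 : ζ ≠ 0 := by rintro rfl; simp [NeZero.ne M] at hζ
  have hval : ∀ b : ℤ, b.natAbs < n → ((b : ZMod M)).valMinAbs = b := fun b hb => by
    rw [ZMod.valMinAbs_spec]
    refine ⟨rfl, ?_, ?_⟩ <;> omega
  have h0 : Computes K 1 {fun _ => (0 : ℝ)} := Computes.const 0
  let x' : ℕ → S → ℂ := fun j => if j < n then x j else fun _ => 0
  have hx' : ∀ j < 2 ^ q, EMD.parts (x' j) ⊆ K ∪ {fun _ => (0 : ℝ)} := by
    intro j _
    by_cases hj : j < n
    · simp only [x', if_pos hj]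
      exact (hx j hj).trans Set.subset_union_left
    · simp only [x', if_neg hj, EMD.parts]
      simp
  have h1 := Computes.fft q ζ⁻¹ (by rw [inv_pow, ← hM, hζ, inv_one]) x' hx'
  set y : ℕ → S → ℂ := fun l s => ∑ j ∈ Finset.range (2 ^ q), ζ⁻¹ ^ (l * j) * x' j s with hy
  set Y := ⋃ l ∈ Finset.range (2 ^ q), EMD.parts (y l) with hY
  have h2 : Computes (K ∪ Y) (12 * 2 ^ q)
      (⋃ l ∈ Finset.range (2 ^ q), EMD.parts fun s => γ l * y l s) := by
    refine (Computes.biUnion (Finset.range (2 ^ q)) (c := fun _ => 12) fun l hl =>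
      Computes.parts_const_mul ?_ _).le (by simp [mul_comm])
    exact (Set.subset_biUnion_of_mem (u := fun l => EMD.parts (y l)) hl).trans
      Set.subset_union_right
  set Z := ⋃ l ∈ Finset.range (2 ^ q), EMD.parts fun s => γ l * y l s with hZ
  have h3 : Computes (K ∪ Z) (12 * (q * 2 ^ q)) (⋃ i ∈ Finset.range (2 ^ q), EMD.parts fun s =>
      ∑ l ∈ Finset.range (2 ^ q), ζ ^ (i * l) * (γ l * y l s)) :=
    Computes.fft q ζ hζ (fun l s => γ l * y l s) fun l hl =>
      (Set.subset_biUnion_of_mem (u := fun l => EMD.parts fun s => γ l * y l s)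
        (Finset.mem_coe.2 (Finset.mem_range.2 hl))).trans Set.subset_union_right
  have h4 := (h0.trans h1).trans (h2.trans (h3.mono
    (Set.union_subset_union_left _ Set.subset_union_left) subset_rfl le_rfl))
  refine h4.mono subset_rfl ?_ (by rw [hM]; ring_nf; omega)
  refine Set.iUnion₂_subset fun i hi => ?_
  have hin : i < n := by simpa using hi
  refine subset_trans ?_ (Set.subset_biUnion_of_mem (u := fun i => EMD.parts fun s =>
      ∑ l ∈ Finset.range (2 ^ q), ζ ^ (i * l) * (γ l * y l s)) (x := i)
      (Finset.mem_coe.2 (Finset.mem_range.2 (by omega))))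
  refine Eq.subset (congrArg EMD.parts (funext fun s => ?_))
  have hsub : ∑ j ∈ Finset.range n, t ((i : ℤ) - j) * x j s =
      ∑ j ∈ Finset.range (2 ^ q),
        (∑ l ∈ Finset.range M, γ l * ζ ^ ((l : ℤ) * ((i : ℤ) - j))) * x' j s := by
    rw [← Finset.sum_subset (Finset.range_subset_range.2 (show n ≤ 2 ^ q by omega))]
    · refine Finset.sum_congr rfl fun j hj => ?_
      have hj : j < n := by simpa using hj
      rw [← hg, hval _ (by omega)]
      simp [x', hj]
    · intro j _ hj
      have hj : ¬ j < n := by simpa using hj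
      simp [x', hj]
  rw [hsub]
  simp only [hy, Finset.sum_mul, Finset.mul_sum]
  rw [Finset.sum_comm]
  refine Finset.sum_congr rfl fun l _ => Finset.sum_congr rfl fun j _ => ?_
  have : ζ ^ ((l : ℤ) * ((i : ℤ) - j)) = ζ ^ (i * l) * ζ⁻¹ ^ (l * j) := by
    rw [mul_sub, zpow_sub₀ hζ0, inv_pow, div_eq_mul_inv, mul_comm (l : ℤ) i]
    norm_cast
  rw [this]; ring

/-- The product of the matrix `A` with any vector can be computed with `c` operations. -/
def MatCost {n : ℕ} (A : Matrix (Fin n) (Fin n) ℝ) (c : ℕ) : Prop :=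
  ∀ (S : Type) (K : Set (S → ℝ)) (x : S → Fin n → ℝ), Known K x →
    Computes K c (comps fun s i => ∑ j, A i j * x s j)

/-- A bound for the number of operations of a cosine transform of length `n`. -/
def dctCost (n : ℕ) : ℕ :=
  24 * (Nat.clog 2 (2 * n) * 2 ^ Nat.clog 2 (2 * n)) + 12 * 2 ^ Nat.clog 2 (2 * n) + 1 + 9 * n

theorem matCost_of_toeplitz {n : ℕ} {A : Matrix (Fin n) (Fin n) ℝ} (t : ℤ → ℂ) (α β : ℕ → ℂ)
    (hA : ∀ i j : Fin n, A i j = (α i * t ((i : ℤ) - (j : ℤ)) * β j).re) :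
    MatCost A (dctCost n) := by
  intro S K x hx
  let x' : ℕ → S → ℂ := fun j s => if h : j < n then β j * (x s ⟨j, h⟩ : ℂ) else 0
  have h1 : Computes K (4 * n) (⋃ j ∈ Finset.range n, parts (x' j)) := by
    refine (Computes.biUnion (Finset.range n) (c := fun _ => 4) fun j hj => ?_).le
      (by simp [mul_comm])
    have hj : j < n := by simpa using hj
    have e : x' j = fun s => β j * (x s ⟨j, hj⟩ : ℂ) := by funext s; simp [x', hj]
    rw [e]
    have h := Computes.var (hx ⟨j, hj⟩)
    exact Computes.parts (a := 2) (b := 2) (by simpa using h.const_mul (β j).re)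
      (by simpa using h.const_mul (β j).im)
  have h2 := Computes.toeplitz (K := K ∪ ⋃ j ∈ Finset.range n, parts (x' j))
    (Nat.le_pow_clog one_lt_two (2 * n)) t x' fun j hj =>
      (Set.subset_biUnion_of_mem (u := fun j => parts (x' j))
        (Finset.mem_coe.2 (Finset.mem_range.2 hj))).trans Set.subset_union_right
  set v : ℕ → S → ℂ := fun i s => ∑ j ∈ Finset.range n, t ((i : ℤ) - j) * x' j s with hv
  have h3 : Computes (K ∪ ⋃ i ∈ Finset.range n, parts (v i)) (n * 5)
      (comps fun s (i : Fin n) => (α i * v i s).re) := by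
    refine (Computes.comps (c := 5) fun i => ?_).le (by simp)
    have := (Set.subset_biUnion_of_mem (u := fun j => parts (v j))
        (Finset.mem_coe.2 (Finset.mem_range.2 i.isLt))).trans
        (Set.subset_union_right (s := K))
    rw [parts_subset] at this
    simpa using ((Computes.var this.1).const_mul (α i).re).sub
      ((Computes.var this.2).const_mul (α i).im)
  have h4 := h1.trans (h2.trans (h3.mono
    (Set.union_subset_union_left _ Set.subset_union_left) subset_rfl le_rfl))
  refine h4.mono subset_rfl (Eq.subset (congrArg comps ?_)) (by unfold dctCost; omega)
  funext s i
  have : v i s = ∑ j : Fin n, t ((i : ℤ) - (j : ℤ)) * (β j * (x s j : ℂ)) := by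
    rw [hv]
    simp only [Finset.sum_range, x']
    simp
  rw [this, Finset.mul_sum, Complex.re_sum]
  refine Finset.sum_congr rfl fun j _ => ?_
  rw [hA, show (α i * (t ((i : ℤ) - (j : ℤ)) * (β j * (x s j : ℂ)))) =
    (α i * t ((i : ℤ) - (j : ℤ)) * β j) * (x s j : ℂ) by ring]
  simp

/-- The normalization constants of the cosine basis. -/
def cosNorm (N k : ℕ) : ℝ := if k = 0 then √(1 / ((N : ℝ) + 1)) else √(2 / ((N : ℝ) + 1))

/-- The frequency-dependent angle `π k / (2 (N + 1))`. -/
def angle (N k : ℕ) : ℝ := Real.pi * k / (2 * ((N : ℝ) + 1))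

/-- The orthonormal discrete cosine transform (of type II) of length `N + 1`. -/
def cosMat (N : ℕ) : Matrix (Fin (N + 1)) (Fin (N + 1)) ℝ :=
  fun k x => cosNorm N k * Real.cos (angle N k * (2 * (x : ℕ) + 1))

theorem two_sin_mul_sum_cos (t : ℝ) (n : ℕ) :
    2 * Real.sin t * ∑ x ∈ Finset.range n, Real.cos (t * (2 * (x : ℝ) + 1)) =
      Real.sin (2 * t * n) := by
  induction n with
  | zero => simp
  | succ n ih =>
    rw [Finset.sum_range_succ, mul_add, ih]
    have h1 : 2 * t * n = t * (2 * n + 1) - t := by ring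
    have h2 : 2 * t * ((n + 1 : ℕ) : ℝ) = t * (2 * n + 1) + t := by push_cast; ring
    rw [h1, h2, Real.sin_sub, Real.sin_add]; ring

theorem sum_cos_eq_zero (N : ℕ) (m : ℤ) (h0 : m ≠ 0) (hm : |m| < 2 * ((N : ℤ) + 1)) :
    ∑ x ∈ Finset.range (N + 1),
      Real.cos (Real.pi * m / (2 * ((N : ℝ) + 1)) * (2 * (x : ℝ) + 1)) = 0 := by
  set t : ℝ := Real.pi * m / (2 * ((N : ℝ) + 1)) with ht
  have hN : (0 : ℝ) < 2 * ((N : ℝ) + 1) := by positivity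
  have hs : Real.sin t ≠ 0 := by
    have hm' : |(m : ℝ)| < 2 * ((N : ℝ) + 1) := by exact_mod_cast hm
    have habs : |t| < Real.pi := by
      rw [ht, abs_div, abs_mul, abs_of_pos Real.pi_pos, abs_of_pos hN, div_lt_iff₀ hN]
      exact mul_lt_mul_of_pos_left hm' Real.pi_pos
    have ht0 : t ≠ 0 := by
      rw [ht]
      have : (m : ℝ) ≠ 0 := by exact_mod_cast h0
      have := Real.pi_ne_zero
      positivity
    intro h
    rw [abs_lt] at habs
    exact ht0 ((Real.sin_eq_zero_iff_of_lt_of_lt habs.1 habs.2).1 h)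
  have h := two_sin_mul_sum_cos t (N + 1)
  rw [show 2 * t * ((N + 1 : ℕ) : ℝ) = m * Real.pi by rw [ht]; push_cast; field_simp,
    Real.sin_int_mul_pi] at h
  exact (mul_eq_zero.1 h).resolve_left (mul_ne_zero two_ne_zero hs)

/-- Orthogonality of the cosine basis, from product-to-sum formulas. -/
theorem cosMat_mul_transpose (N : ℕ) : cosMat N * (cosMat N).transpose = 1 := by
  ext k l
  rw [Matrix.mul_apply]
  have hN : (0 : ℝ) < (N : ℝ) + 1 := by positivity
  have e : ∀ x : Fin (N + 1), cosMat N k x * (cosMat N).transpose x l =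
      cosNorm N k * cosNorm N l / 2 *
      (Real.cos (Real.pi * ((k : ℤ) - (l : ℤ) : ℤ) / (2 * ((N : ℝ) + 1)) * (2 * (x : ℕ) + 1)) +
       Real.cos (Real.pi * ((k : ℤ) + (l : ℤ) : ℤ) / (2 * ((N : ℝ) + 1)) * (2 * (x : ℕ) + 1))) := by
    intro x
    simp only [cosMat, Matrix.transpose_apply, angle]
    have h1 : Real.pi * ((k : ℤ) - (l : ℤ) : ℤ) / (2 * ((N : ℝ) + 1)) * (2 * ((x : ℕ) : ℝ) + 1) =
      Real.pi * (k : ℕ) / (2 * ((N : ℝ) + 1)) * (2 * ((x : ℕ) : ℝ) + 1) -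
      Real.pi * (l : ℕ) / (2 * ((N : ℝ) + 1)) * (2 * ((x : ℕ) : ℝ) + 1) := by push_cast; ring
    have h2 : Real.pi * ((k : ℤ) + (l : ℤ) : ℤ) / (2 * ((N : ℝ) + 1)) * (2 * ((x : ℕ) : ℝ) + 1) =
      Real.pi * (k : ℕ) / (2 * ((N : ℝ) + 1)) * (2 * ((x : ℕ) : ℝ) + 1) +
      Real.pi * (l : ℕ) / (2 * ((N : ℝ) + 1)) * (2 * ((x : ℕ) : ℝ) + 1) := by push_cast; ring
    rw [h1, h2, Real.cos_sub, Real.cos_add]; ring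
  rw [Finset.sum_congr rfl fun x _ => e x, ← Finset.mul_sum, Finset.sum_add_distrib,
    Fin.sum_univ_eq_sum_range (fun x => Real.cos (Real.pi * ((k : ℤ) - (l : ℤ) : ℤ) /
      (2 * ((N : ℝ) + 1)) * (2 * (x : ℝ) + 1))),
    Fin.sum_univ_eq_sum_range (fun x => Real.cos (Real.pi * ((k : ℤ) + (l : ℤ) : ℤ) /
      (2 * ((N : ℝ) + 1)) * (2 * (x : ℝ) + 1)))]
  have hk := k.isLt
  have hl := l.isLt
  by_cases hkl : k = l
  · subst hkl
    by_cases hk0 : (k : ℕ) = 0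
    · have hsq : √(1 / ((N : ℝ) + 1)) * √(1 / ((N : ℝ) + 1)) = 1 / ((N : ℝ) + 1) :=
        Real.mul_self_sqrt (by positivity)
      simp only [cosNorm, hk0, if_true, hsq]
      simp
      field_simp
      norm_num
    · have hsq : √(2 / ((N : ℝ) + 1)) * √(2 / ((N : ℝ) + 1)) = 2 / ((N : ℝ) + 1) :=
        Real.mul_self_sqrt (by positivity)
      rw [sum_cos_eq_zero N ((k : ℤ) + (k : ℤ)) (by omega) (by rw [abs_lt]; constructor <;> omega)]
      simp only [cosNorm, hk0, if_false, hsq]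
      simp
      field_simp
  · have hne : (k : ℕ) ≠ l := fun h => hkl (Fin.ext h)
    rw [sum_cos_eq_zero N _ (by omega) (by rw [abs_lt]; constructor <;> omega),
      sum_cos_eq_zero N _ (by omega) (by rw [abs_lt]; constructor <;> omega),
      Matrix.one_apply_ne hkl]
    simp

theorem cosMat_transpose_mul (N : ℕ) : (cosMat N).transpose * cosMat N = 1 :=
  mul_eq_one_comm.1 (cosMat_mul_transpose N)

/-- With `2 k x = k² + x² - (k - x)²`, the cosine transform becomes a Toeplitz matrix up to
diagonal factors, whatever the length is. -/
theorem cosMat_eq_re (N : ℕ) (k x : Fin (N + 1)) : cosMat N k x =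
    ((cosNorm N k : ℂ) * Complex.exp (angle N 1 * ((k : ℕ) + (k : ℕ) ^ 2) * Complex.I) *
      Complex.exp (-(angle N 1 * ((k : ℤ) - (x : ℤ) : ℤ) ^ 2 * Complex.I)) *
      Complex.exp (angle N 1 * (x : ℕ) ^ 2 * Complex.I)).re := by
  rw [mul_assoc, mul_assoc, ← Complex.exp_add, ← Complex.exp_add]
  have e : (angle N 1 * ((k : ℕ) + (k : ℕ) ^ 2) * Complex.I +
      (-(angle N 1 * ((k : ℤ) - (x : ℤ) : ℤ) ^ 2 * Complex.I) +
      angle N 1 * (x : ℕ) ^ 2 * Complex.I) : ℂ) =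
      ((angle N k * (2 * (x : ℕ) + 1) : ℝ) : ℂ) * Complex.I := by
    simp only [angle]; push_cast; ring
  rw [e, Complex.re_ofReal_mul, Complex.exp_ofReal_mul_I_re, cosMat]

theorem matCost_cosMat (N : ℕ) : MatCost (cosMat N) (dctCost (N + 1)) :=
  matCost_of_toeplitz (fun l => Complex.exp (-(angle N 1 * l ^ 2 * Complex.I)))
    (fun k => (cosNorm N k : ℂ) * Complex.exp (angle N 1 * (k + k ^ 2) * Complex.I))
    (fun x => Complex.exp (angle N 1 * x ^ 2 * Complex.I)) fun k x => cosMat_eq_re N k x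

theorem matCost_cosMat_transpose (N : ℕ) : MatCost (cosMat N).transpose (dctCost (N + 1)) := by
  refine matCost_of_toeplitz (fun l => Complex.exp (-(angle N 1 * l ^ 2 * Complex.I)))
    (fun x => Complex.exp (angle N 1 * x ^ 2 * Complex.I))
    (fun k => (cosNorm N k : ℂ) * Complex.exp (angle N 1 * (k + k ^ 2) * Complex.I))
    fun x k => ?_
  rw [Matrix.transpose_apply, cosMat_eq_re]
  congr 1
  rw [show (((x : ℤ) - (k : ℤ) : ℤ) : ℂ) ^ 2 = (((k : ℤ) - (x : ℤ) : ℤ) : ℂ) ^ 2 by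
    push_cast; ring]
  ring

/-! ### Tensor products of transforms -/

/-- The tensor product of the matrices `A j` applied to a function on the product grid. -/
def tensor {d n : ℕ} (A : Fin d → Matrix (Fin n) (Fin n) ℝ) (f : (Fin d → Fin n) → ℝ) :
    (Fin d → Fin n) → ℝ :=
  fun z => ∑ y, (∏ j, A j (z j) (y j)) * f y

theorem tensor_one {d n : ℕ} (f : (Fin d → Fin n) → ℝ) : tensor (fun _ => 1) f = f := by
  funext z
  rw [tensor, Finset.sum_eq_single z]
  · simp
  · intro y _ hy
    obtain ⟨j, hj⟩ := Function.ne_iff.1 hy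
    rw [Finset.prod_eq_zero (Finset.mem_univ j) (Matrix.one_apply_ne hj.symm :
      (1 : Matrix (Fin n) (Fin n) ℝ) (z j) (y j) = 0), zero_mul]
  · simp

theorem tensor_tensor {d n : ℕ} (A B : Fin d → Matrix (Fin n) (Fin n) ℝ)
    (f : (Fin d → Fin n) → ℝ) : tensor A (tensor B f) = tensor (fun j => A j * B j) f := by
  funext z
  simp only [tensor, Finset.mul_sum, Matrix.mul_apply]
  rw [Finset.sum_comm]
  refine Finset.sum_congr rfl fun y _ => ?_
  rw [Finset.prod_univ_sum, Fintype.piFinset_univ, Finset.sum_mul]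
  refine Finset.sum_congr rfl fun w _ => ?_
  rw [Finset.prod_mul_distrib, mul_assoc]

/-- A tensor product is evaluated one direction at a time. -/
theorem tensor_update {d n : ℕ} (A : Fin d → Matrix (Fin n) (Fin n) ℝ)
    (B : Matrix (Fin n) (Fin n) ℝ) (i : Fin d) (hi : A i = 1) (f : (Fin d → Fin n) → ℝ) :
    tensor (Function.update A i B) f =
      fun z => ∑ w, B (z i) w * tensor A f (Function.update z i w) := by
  funext z
  simp only [tensor, Finset.mul_sum]
  rw [Finset.sum_comm]
  refine Finset.sum_congr rfl fun y _ => ?_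
  rw [Finset.sum_eq_single (y i)]
  · rw [← Finset.mul_prod_erase _ _ (Finset.mem_univ i),
      ← Finset.mul_prod_erase (a := i) _ (fun j => A j (Function.update z i (y i) j) (y j))
        (Finset.mem_univ i)]
    simp only [Function.update_self, hi, Matrix.one_apply_eq, one_mul, mul_assoc]
    congr 2
    refine Finset.prod_congr rfl fun j hj => ?_
    rw [Function.update_of_ne (Finset.ne_of_mem_erase hj),
      Function.update_of_ne (Finset.ne_of_mem_erase hj)]
  · intro w _ hw
    rw [Finset.prod_eq_zero (Finset.mem_univ i), zero_mul, mul_zero]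
    rw [hi, Function.update_self, Matrix.one_apply_ne hw]
  · simp

theorem card_hyperplane {d n : ℕ} (i : Fin d) (v : Fin n) :
    (Finset.univ.filter fun z : Fin d → Fin n => z i = v).card = n ^ (d - 1) := by
  have : (Finset.univ.filter fun z : Fin d → Fin n => z i = v) =
      Fintype.piFinset
        (Function.update (β := fun _ => Finset (Fin n)) (fun _ => Finset.univ) i {v}) := by
    ext z
    simp only [Finset.mem_filter, Finset.mem_univ, true_and, Fintype.mem_piFinset]
    constructor
    · rintro h j
      by_cases hj : j = i
      · subst hj; simpa using h
      · simp [hj]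
    · intro h
      simpa using h i
  rw [this, Fintype.card_piFinset, ← Finset.mul_prod_erase _ _ (Finset.mem_univ i)]
  simp only [Function.update_self, Finset.card_singleton, one_mul]
  rw [Finset.prod_congr rfl (g := fun _ => n), Finset.prod_const,
    Finset.card_erase_of_mem (Finset.mem_univ i)]
  · simp
  · intro j hj
    rw [Function.update_of_ne (Finset.ne_of_mem_erase hj)]; simp

/-- A transform of all lines of the grid in the direction `i`. -/
theorem Computes.lines {d n c : ℕ} {B : Matrix (Fin n) (Fin n) ℝ} (hB : MatCost B c) (i : Fin d)
    (f : S → (Fin d → Fin n) → ℝ) (hf : Known K f) : Computes K (n ^ (d - 1) * c)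
      (EMD.comps fun s z => ∑ w, B (z i) w * f s (Function.update z i w)) := by
  rcases n.eq_zero_or_pos with rfl | hn
  · exact Computes.of_subset (by rintro _ ⟨z, -⟩; exact (z i).elim0) _
  have h := Computes.biUnion (K := K) (Finset.univ.filter fun z : Fin d → Fin n => z i = ⟨0, hn⟩)
    (c := fun _ => c) fun z _ => hB S K (fun s w => f s (Function.update z i w)) fun w => hf _
  rw [Finset.sum_const, card_hyperplane, smul_eq_mul] at h
  refine h.mono subset_rfl ?_ le_rfl
  rintro _ ⟨z, rfl⟩
  refine Set.mem_biUnion (x := Function.update z i ⟨0, hn⟩) (by simp) ⟨z i, ?_⟩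
  simp

theorem Computes.tensor {d n c : ℕ} {B : Matrix (Fin n) (Fin n) ℝ} (hB : MatCost B c)
    (f : S → (Fin d → Fin n) → ℝ) (hf : Known K f) :
    Computes K (d * (n ^ (d - 1) * c)) (EMD.comps fun s => EMD.tensor (fun _ => B) (f s)) := by
  have key : ∀ m ≤ d, Computes K (m * (n ^ (d - 1) * c))
      (EMD.comps fun s => EMD.tensor (fun j => if (j : ℕ) < m then B else 1) (f s)) := by
    intro m
    induction m with
    | zero => intro _; simpa [tensor_one] using Computes.of_subset (known_iff.1 hf) 0
    | succ m ih =>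
      intro hm
      refine ((ih (by omega)).trans (Computes.lines hB ⟨m, hm⟩ _
        (known_union_comps K _))).mono subset_rfl (Eq.subset ?_) (by ring_nf; omega)
      congr 1
      funext s
      rw [← tensor_update _ _ _ (by simp)]
      congr 1
      funext j
      by_cases hj : j = ⟨m, hm⟩
      · subst hj; simp
      · have : (j : ℕ) ≠ m := fun h => hj (Fin.ext h)
        rw [Function.update_of_ne hj]
        split_ifs <;> first | rfl | omega
  simpa using key d le_rfl

/-! ### The discrete divergence and the Neumann problem -/

section Divergence

variable {d N : ℕ}

theorem gridStep_pos (hN : 1 ≤ N) : 0 < gridStep N := by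
  unfold gridStep; positivity

/-- The neighbour `x + h e_i` (used for `x_i < 1` only). -/
def next (x : Grid d N) (i : Fin d) : Grid d N :=
  Function.update x i ⟨min ((x i : ℕ) + 1) N, by omega⟩

/-- The adjoint of the discrete divergence. -/
def adj (ψ : Scalar d N) : Field d N :=
  fun x i => if (x i : ℕ) < N then (ψ x - ψ (next x i)) / gridStep N else 0

theorem diff_eq (hN : 1 ≤ N) (m : Field d N) (i : Fin d) (x : Grid d N) :
    diff m i x = ((if (x i : ℕ) < N then m x i else 0) -
      if 0 < (x i : ℕ) then m (prev x i) i else 0) / gridStep N := by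
  have := (x i).isLt
  unfold diff
  split_ifs <;> first | omega | simp

theorem prev_next {x : Grid d N} {i : Fin d} (h : (x i : ℕ) < N) : prev (next x i) i = x := by
  funext j
  by_cases hj : j = i
  · subst hj
    ext
    simp [prev, next]; omega
  · simp [prev, next, hj]

theorem next_prev {x : Grid d N} {i : Fin d} (h : 0 < (x i : ℕ)) : next (prev x i) i = x := by
  have := (x i).isLt
  funext j
  by_cases hj : j = i
  · subst hj
    ext
    simp [prev, next]; omega
  · simp [prev, next, hj]

/-- Summation by parts in the direction `i`: the reindexing by the neighbours. -/
theorem sum_prev (i : Fin d) (F : Grid d N → Grid d N → ℝ) :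
    ∑ x, (if 0 < (x i : ℕ) then F x (prev x i) else 0) =
      ∑ x, if (x i : ℕ) < N then F (next x i) x else 0 := by
  rw [← Finset.sum_filter, ← Finset.sum_filter]
  refine Finset.sum_bij' (fun x _ => prev x i) (fun x _ => next x i) ?_ ?_ ?_ ?_ ?_
  · intro x hx
    have := (x i).isLt
    simp only [Finset.mem_filter, Finset.mem_univ, true_and] at hx ⊢
    simp [prev]; omega
  · intro x hx
    simp only [Finset.mem_filter, Finset.mem_univ, true_and] at hx ⊢
    simp [next]; omega
  · intro x hx
    exact next_prev (by simpa using hx)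
  · intro x hx
    exact prev_next (by simpa using hx)
  · intro x hx
    rw [next_prev (by simpa using hx)]

theorem vInner_adj (hN : 1 ≤ N) (ψ : Scalar d N) (m : Field d N) :
    vInner (adj ψ) m = sInner ψ (divh m) := by
  have hx : ∀ i : Fin d, ∑ x, ψ x * diff m i x = ∑ x, adj ψ x i * m x i := by
    intro i
    have h1 : ∀ x : Grid d N, ψ x * diff m i x =
        ((if (x i : ℕ) < N then ψ x * m x i else 0) -
        if 0 < (x i : ℕ) then ψ x * m (prev x i) i else 0) / gridStep N := by
      intro x
      rw [diff_eq hN]; split_ifs <;> ring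
    have h2 : ∀ x : Grid d N, adj ψ x i * m x i =
        ((if (x i : ℕ) < N then ψ x * m x i else 0) -
        if (x i : ℕ) < N then ψ (next x i) * m x i else 0) / gridStep N := by
      intro x
      unfold adj; split_ifs <;> ring
    simp only [h1, h2, ← Finset.sum_div, Finset.sum_sub_distrib]
    rw [sum_prev i fun x y => ψ x * m y i]
  simp only [vInner, sInner, divh, ← Finset.sum_mul, Finset.mul_sum]
  rw [Finset.sum_comm, Finset.sum_comm (f := fun x i => ψ x * diff m i x)]
  simp only [hx]

theorem sum_divh (hN : 1 ≤ N) (m : Field d N) : ∑ x, divh m x = 0 := by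
  have h := vInner_adj hN (fun _ => 1) m
  have h0 : adj (fun _ : Grid d N => (1 : ℝ)) = 0 := by
    funext x i; simp [adj]
  rw [h0] at h
  have hp := pow_pos (gridStep_pos hN) d
  simp only [vInner, sInner, Pi.zero_apply, zero_mul, Finset.sum_const_zero, one_mul,
    ← Finset.sum_mul] at h
  rcases mul_eq_zero.1 h.symm with h | h
  · exact h
  · exact absurd h hp.ne'

theorem divh_sub (m u : Field d N) : divh (m - u) = fun x => divh m x - divh u x := by
  funext x
  simp only [divh, ← Finset.sum_sub_distrib]
  refine Finset.sum_congr rfl fun i _ => ?_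
  unfold diff
  simp only [Pi.sub_apply]
  split_ifs <;> ring

theorem divh_adj (hN : 1 ≤ N) (ψ : Scalar d N) (x : Grid d N) :
    divh (adj ψ) x = (∑ i, ((if (x i : ℕ) < N then ψ x - ψ (next x i) else 0) -
      if 0 < (x i : ℕ) then ψ (prev x i) - ψ x else 0)) / gridStep N ^ 2 := by
  rw [Finset.sum_div, divh]
  refine Finset.sum_congr rfl fun i _ => ?_
  have := (x i).isLt
  have h : ∀ h0 : 0 < (x i : ℕ), ((prev x i) i : ℕ) < N := fun h0 => by simp [prev]; omega
  rw [diff_eq hN]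
  unfold adj
  by_cases h0 : 0 < (x i : ℕ)
  · simp only [if_pos h0, if_pos (h h0), next_prev h0]
    split_ifs <;> ring
  · simp only [if_neg h0]
    split_ifs <;> ring

/-- The eigenvalue of the Neumann Laplacian for the frequency `k`. -/
def eigenvalue (k : Grid d N) : ℝ := (∑ i, 4 * Real.sin (angle N (k i)) ^ 2) / gridStep N ^ 2

/-- Cosine vectors are eigenvectors of the second difference. The one-sided differences at the
boundary fit in, as `sin` vanishes there. -/
theorem cosMat_second_diff (k v : Fin (N + 1)) (hm : (v : ℕ) - 1 < N + 1)
    (hp : min ((v : ℕ) + 1) N < N + 1) :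
    (if (v : ℕ) < N then cosMat N k v - cosMat N k ⟨min ((v : ℕ) + 1) N, hp⟩ else 0) -
      (if 0 < (v : ℕ) then cosMat N k ⟨(v : ℕ) - 1, hm⟩ - cosMat N k v else 0) =
      4 * Real.sin (angle N k) ^ 2 * cosMat N k v := by
  set t := angle N k with ht
  have h1 : (if (v : ℕ) < N then cosMat N k v - cosMat N k ⟨min ((v : ℕ) + 1) N, hp⟩ else 0) =
      cosNorm N k * (2 * Real.sin t * Real.sin (t * (2 * (v : ℕ) + 1) + t)) := by
    split_ifs with h
    · simp only [cosMat, ← ht]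
      rw [min_eq_left (by omega)]
      have e1 : t * (2 * (((v : ℕ) + 1 : ℕ) : ℝ) + 1) = (t * (2 * (v : ℕ) + 1) + t) + t := by
        push_cast; ring
      have e2 : Real.cos (t * (2 * ((v : ℕ) : ℝ) + 1)) =
          Real.cos ((t * (2 * (v : ℕ) + 1) + t) - t) := by congr 1; ring
      rw [e1, e2, Real.cos_sub (t * (2 * (v : ℕ) + 1) + t),
        Real.cos_add (t * (2 * (v : ℕ) + 1) + t)]
      ring
    · have hv : ((v : ℕ) : ℝ) = N := by exact_mod_cast (show (v : ℕ) = N by omega)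
      have : t * (2 * (v : ℕ) + 1) + t = (k : ℕ) * Real.pi := by
        rw [hv, ht, angle]; field_simp; ring
      rw [this, Real.sin_nat_mul_pi]; ring
  have h2 : (if 0 < (v : ℕ) then cosMat N k ⟨(v : ℕ) - 1, hm⟩ - cosMat N k v else 0) =
      cosNorm N k * (2 * Real.sin t * Real.sin (t * (2 * (v : ℕ) + 1) - t)) := by
    split_ifs with h
    · simp only [cosMat, ← ht]
      rw [show t * (2 * (((v : ℕ) - 1 : ℕ) : ℝ) + 1) = t * (2 * (v : ℕ) + 1) - t - t by
        rw [Nat.cast_sub h]; push_cast; ring]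
      rw [show Real.cos (t * (2 * ((v : ℕ) : ℝ) + 1)) =
        Real.cos (t * (2 * (v : ℕ) + 1) - t + t) by congr 1; ring, Real.cos_add, Real.cos_sub]
      ring
    · have hv : ((v : ℕ) : ℝ) = 0 := by exact_mod_cast (show (v : ℕ) = 0 by omega)
      rw [hv]; simp
  rw [h1, h2, Real.sin_add, Real.sin_sub, cosMat, ← ht]
  ring

theorem divh_adj_prod_cosMat (hN : 1 ≤ N) (k x : Grid d N) :
    divh (adj fun y => ∏ j, cosMat N (k j) (y j)) x =
      eigenvalue k * ∏ j, cosMat N (k j) (x j) := by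
  rw [divh_adj hN, eigenvalue, div_mul_eq_mul_div, Finset.sum_mul]
  congr 1
  refine Finset.sum_congr rfl fun i _ => ?_
  have hu : ∀ v : Fin (N + 1), ∏ j, cosMat N (k j) (Function.update x i v j) =
      cosMat N (k i) v * ∏ j ∈ Finset.univ.erase i, cosMat N (k j) (x j) := by
    intro v
    rw [← Finset.mul_prod_erase _ _ (Finset.mem_univ i), Function.update_self]
    congr 1
    exact Finset.prod_congr rfl fun j hj => by
      rw [Function.update_of_ne (Finset.ne_of_mem_erase hj)]
  have h := cosMat_second_diff (k i) (x i) (by omega) (by omega)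
  unfold next prev
  rw [hu, hu, ← Finset.mul_prod_erase (a := i) _ (fun j => cosMat N (k j) (x j))
    (Finset.mem_univ i), ← mul_assoc, ← h]
  split_ifs <;> ring

theorem divh_adj_sum {β : Type*} [Fintype β] (hN : 1 ≤ N) (g : β → ℝ) (F : β → Scalar d N)
    (x : Grid d N) :
    divh (adj fun y => ∑ k, F k y * g k) x = ∑ k, divh (adj (F k)) x * g k := by
  simp only [divh_adj hN, ← Finset.sum_div, div_mul_eq_mul_div]
  congr 1
  simp only [Finset.sum_mul]
  rw [Finset.sum_comm]
  refine Finset.sum_congr rfl fun i _ => ?_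
  split_ifs <;> simp [sub_mul, Finset.sum_sub_distrib]

/-- The solution of the Neumann problem `A_h A_h^* ψ = r` by cosine transforms. For the frequency
zero the inverse eigenvalue is `0⁻¹ = 0`, which is harmless as `r` has mean zero. -/
def poisson (r : Scalar d N) : Scalar d N :=
  tensor (fun _ => (cosMat N).transpose)
    fun k => (eigenvalue k)⁻¹ * tensor (fun _ => cosMat N) r k

theorem divh_adj_poisson (hN : 1 ≤ N) (r : Scalar d N) (hr : ∑ x, r x = 0) :
    divh (adj (poisson r)) = r := by
  funext x
  have h1 : (poisson r : Scalar d N) = fun y => ∑ k : Grid d N, (∏ j, cosMat N (k j) (y j)) *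
      ((eigenvalue k)⁻¹ * tensor (fun _ => cosMat N) r k) := rfl
  have h2 : ∀ k : Grid d N, eigenvalue k *
      ((eigenvalue k)⁻¹ * tensor (fun _ => cosMat N) r k) = tensor (fun _ => cosMat N) r k := by
    intro k
    by_cases hk : eigenvalue k = 0
    · have hk0 : ∀ i, (k i : ℕ) = 0 := by
        intro i
        have hh := (gridStep_pos hN).ne'
        rw [eigenvalue, div_eq_zero_iff, or_iff_left (pow_ne_zero 2 hh),
          Finset.sum_eq_zero_iff_of_nonneg (fun _ _ => by positivity)] at hk
        have hs := hk i (Finset.mem_univ i)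
        have hs : Real.sin (angle N (k i)) = 0 := by simpa using hs
        by_contra h0
        have hpos : 0 < angle N (k i) := by
          have := Real.pi_pos
          have : 0 < ((k i : ℕ) : ℝ) := by exact_mod_cast Nat.pos_of_ne_zero h0
          unfold angle; positivity
        have hlt : angle N (k i) < Real.pi := by
          have : ((k i : ℕ) : ℝ) < (N : ℝ) + 1 := by exact_mod_cast (k i).isLt
          rw [angle, div_lt_iff₀ (by positivity)]
          exact mul_lt_mul_of_pos_left (by linarith) Real.pi_pos
        exact (Real.sin_pos_of_pos_of_lt_pi hpos hlt).ne' hs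
      have : tensor (fun _ => cosMat N) r k = 0 := by
        have : ∀ y : Grid d N, ∏ j, cosMat N (k j) (y j) = cosNorm N 0 ^ d := by
          intro y
          simp [cosMat, hk0, angle]
        simp only [tensor, this]
        rw [← Finset.mul_sum, hr, mul_zero]
      rw [this]; simp
    · rw [mul_inv_cancel_left₀ hk]
  rw [h1, divh_adj_sum hN]
  have h3 : ∀ k : Grid d N, divh (adj fun y => ∏ j, cosMat N (k j) (y j)) x *
      ((eigenvalue k)⁻¹ * tensor (fun _ => cosMat N) r k) =
      (∏ j, (cosMat N).transpose (x j) (k j)) * tensor (fun _ => cosMat N) r k := by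
    intro k
    rw [divh_adj_prod_cosMat hN, mul_comm (eigenvalue k), mul_assoc, h2]
    rfl
  rw [Finset.sum_congr rfl fun k _ => h3 k]
  have h4 := congrFun (tensor_tensor (fun _ => (cosMat N).transpose) (fun _ => cosMat N) r) x
  simp only [cosMat_transpose_mul, tensor_one] at h4
  exact h4

/-- A bound for the number of operations of the Poisson solver. -/
def poissonCost (d N : ℕ) : ℕ := 2 * (d * ((N + 1) ^ (d - 1) * dctCost (N + 1))) + 2 * (N + 1) ^ d

theorem Computes.poisson (r : S → Scalar d N) (hr : Known K r) :
    Computes K (poissonCost d N) (EMD.comps fun s => EMD.poisson (r s)) := by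
  have h1 := Computes.tensor (d := d) (matCost_cosMat N) r hr
  have h2 : Computes (K ∪ EMD.comps fun s => EMD.tensor (fun _ => cosMat N) (r s))
      ((N + 1) ^ d * 2) (EMD.comps fun s (k : Grid d N) =>
        (eigenvalue k)⁻¹ * EMD.tensor (fun _ => cosMat N) (r s) k) := by
    refine (Computes.comps (c := 2) fun k => ?_).le (by simp)
    exact Computes.const_mul _ (.var (known_union_comps K _ k))
  refine ((h1.trans h2).trans (Computes.tensor (d := d) (matCost_cosMat_transpose N) _
    (known_union_comps _ _))).le ?_
  unfold poissonCost; omega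

end Divergence

/-! ### The subproblems of the iteration -/

section Prox

variable {d N : ℕ}

theorem vInner_comm (u v : Field d N) : vInner u v = vInner v u := by
  simp only [vInner, mul_comm (u _ _)]

theorem vInner_add_left (u v w : Field d N) : vInner (u + v) w = vInner u w + vInner v w := by
  simp only [vInner, Pi.add_apply, add_mul, Finset.sum_add_distrib]

theorem vInner_smul_left (r : ℝ) (u w : Field d N) : vInner (r • u) w = r * vInner u w := by
  simp only [vInner, Pi.smul_apply, smul_eq_mul, Finset.mul_sum, mul_assoc]

theorem vInner_neg_left (u w : Field d N) : vInner (-u) w = -vInner u w := by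
  rw [← neg_one_smul ℝ u, vInner_smul_left]; ring

theorem vInner_sub_left (u v w : Field d N) : vInner (u - v) w = vInner u w - vInner v w := by
  rw [sub_eq_add_neg, vInner_add_left, vInner_neg_left]; ring

theorem vInner_add_right (u v w : Field d N) : vInner u (v + w) = vInner u v + vInner u w := by
  rw [vInner_comm, vInner_add_left, vInner_comm v, vInner_comm w]

theorem vInner_sub_right (u v w : Field d N) : vInner u (v - w) = vInner u v - vInner u w := by
  rw [vInner_comm, vInner_sub_left, vInner_comm v, vInner_comm w]

theorem vInner_smul_right (r : ℝ) (u w : Field d N) : vInner u (r • w) = r * vInner u w := by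
  rw [vInner_comm, vInner_smul_left, vInner_comm]

theorem gridStep_nonneg (N : ℕ) : 0 ≤ gridStep N := by unfold gridStep; positivity

theorem normSq_nonneg (u : Field d N) : 0 ≤ normSq u :=
  Finset.sum_nonneg fun _ _ => Finset.sum_nonneg fun _ _ =>
    mul_nonneg (mul_self_nonneg _) (pow_nonneg (gridStep_nonneg N) d)

theorem eq_zero_of_normSq_le (hN : 1 ≤ N) {u : Field d N} (h : normSq u ≤ 0) : u = 0 := by
  have hp := pow_pos (gridStep_pos hN) d
  have h0 : ∀ x i, 0 ≤ u x i * u x i * gridStep N ^ d := fun x i =>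
    mul_nonneg (mul_self_nonneg _) hp.le
  have h1 := (Finset.sum_eq_zero_iff_of_nonneg fun x _ => Finset.sum_nonneg fun i _ => h0 x i).1
    (le_antisymm h (normSq_nonneg u))
  funext x i
  have h2 := (Finset.sum_eq_zero_iff_of_nonneg fun i _ => h0 x i).1 (h1 x (Finset.mem_univ x)) i
    (Finset.mem_univ i)
  simpa [hp.ne'] using h2

theorem argmin_eq {E : Type} [Nonempty E] {F : E → EReal} {x₀ : E} (h : ∀ y, F x₀ ≤ F y)
    (hu : ∀ y, F y ≤ F x₀ → y = x₀) : argmin F = x₀ :=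
  hu _ (Classical.epsilon_spec (p := fun x => ∀ y, F x ≤ F y) ⟨x₀, h⟩ x₀)

/-- The variational inequality characterizes the minimizer of a linear function plus a squared
distance over a set `C` with indicator function `χ`. -/
theorem argmin_eq_of_variational (hN : 1 ≤ N) {C : Set (Field d N)} {χ : Field d N → EReal}
    (h0 : ∀ x ∈ C, χ x = 0) (h1 : ∀ x ∉ C, χ x = ⊤) (q s x₀ : Field d N) (hx₀ : x₀ ∈ C)
    (hv : ∀ x ∈ C, 0 ≤ vInner (q + (2 : ℝ) • (x₀ - s)) (x - x₀)) :
    argmin (fun x => χ x + ((vInner q x + normSq (x - s) : ℝ) : EReal)) = x₀ := by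
  have key : ∀ x ∈ C, vInner q x₀ + normSq (x₀ - s) + normSq (x - x₀) ≤
      vInner q x + normSq (x - s) := by
    intro x hx
    have h := hv x hx
    simp only [normSq, vInner_add_left, vInner_smul_left, vInner_sub_left, vInner_sub_right] at h ⊢
    rw [vInner_comm s x₀, vInner_comm s x, vInner_comm x x₀] at *
    linarith
  apply argmin_eq
  · intro x
    by_cases hx : x ∈ C
    · rw [h0 _ hx₀, h0 _ hx, zero_add, zero_add, EReal.coe_le_coe_iff]
      have := key x hx
      have := normSq_nonneg (x - x₀)
      linarith
    · rw [h1 _ hx, EReal.top_add_coe]; exact le_top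
  · intro x hle
    by_cases hx : x ∈ C
    · rw [h0 _ hx₀, h0 _ hx, zero_add, zero_add, EReal.coe_le_coe_iff] at hle
      have := key x hx
      exact sub_eq_zero.1 (eq_zero_of_normSq_le hN (by linarith))
    · rw [h0 _ hx₀, h1 _ hx, EReal.top_add_coe, zero_add] at hle
      exact absurd (top_le_iff.1 hle) (EReal.coe_ne_top _)

/-- The effective domain of `f^*`: the dual ball of the cost. -/
def dualBall (p : ℝ≥0∞) : Set (Field d N) := {φ | ∀ u, vInner φ u ≤ cost p u}

theorem cost_smul (p : ℝ≥0∞) [Fact (1 ≤ p)] {r : ℝ} (hr : 0 ≤ r) (u : Field d N) :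
    cost p (r • u) = r * cost p u := by
  simp only [cost, Finset.mul_sum]
  refine Finset.sum_congr rfl fun x _ => ?_
  have : (WithLp.toLp p ((r • u) x) : PiLp p fun _ : Fin d => ℝ) = r • WithLp.toLp p (u x) := rfl
  rw [this, norm_smul, Real.norm_of_nonneg hr, mul_assoc]

theorem costConj_of_mem {p : ℝ≥0∞} [Fact (1 ≤ p)] {φ : Field d N} (h : φ ∈ dualBall p) :
    costConj p φ = 0 := by
  apply le_antisymm
  · refine iSup_le fun u => ?_
    have := h u
    exact_mod_cast (show vInner φ u - cost p u ≤ 0 by linarith)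
  · refine le_iSup_of_le 0 ?_
    have h1 := vInner_smul_right 0 φ 0
    have h2 := cost_smul p le_rfl (0 : Field d N)
    rw [zero_smul, zero_mul] at h1 h2
    rw [h1, h2]; simp

/-- Off the dual ball the supremum is infinite, by homogeneity of the cost. -/
theorem costConj_of_notMem {p : ℝ≥0∞} [Fact (1 ≤ p)] {φ : Field d N} (h : φ ∉ dualBall p) :
    costConj p φ = ⊤ := by
  simp only [dualBall, Set.mem_ofPred_eq, not_forall, not_le] at h
  obtain ⟨u, hu⟩ := h
  rw [EReal.eq_top_iff_forall_lt]
  intro y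
  have hδ : 0 < vInner φ u - cost p u := by linarith
  refine lt_of_lt_of_le ?_ (le_iSup (fun u : Field d N => ((vInner φ u - cost p u : ℝ) : EReal))
    (((|y| + 1) / (vInner φ u - cost p u)) • u))
  rw [vInner_smul_right, cost_smul p (by positivity), ← mul_sub, div_mul_cancel₀ _ hδ.ne',
    EReal.coe_lt_coe_iff]
  linarith [le_abs_self y]

/-- The pointwise projection `q` onto the ball dual to the norm `‖·‖_p`: `q v` is in the dual
ball, and `v - q v` is normal to the dual ball at `q v`. -/
def IsDualProj (p : ℝ≥0∞) (q : (Fin d → ℝ) → Fin d → ℝ) : Prop :=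
  ∀ v, (∀ u : Fin d → ℝ, ∑ i, q v i * u i ≤ ‖(WithLp.toLp p u : PiLp p fun _ : Fin d => ℝ)‖) ∧
    ‖(WithLp.toLp p (v - q v) : PiLp p fun _ : Fin d => ℝ)‖ ≤ ∑ i, (v i - q v i) * q v i

/-- The primal update: the projection onto the constraint set. -/
def newFlux (ρ : Scalar d N) (m w : Field d N) : Field d N :=
  (m - (1 / 2 : ℝ) • w) - adj (poisson fun x => divh (m - (1 / 2 : ℝ) • w) x - ρ x)

/-- The dual update, given the projection `q` onto the dual ball of `ℝ^d`. -/
def newDual (q : (Fin d → ℝ) → Fin d → ℝ) (m φ : Field d N) : Field d N :=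
  fun x => q (φ x + (1 / 2 : ℝ) • m x)

/-- The explicit form of one iteration. -/
def explicitStep (q : (Fin d → ℝ) → Fin d → ℝ) (ρ : Scalar d N) (s : State d N) : State d N :=
  ⟨newFlux ρ s.flux s.bar, newDual q (newFlux ρ s.flux s.bar) s.dual,
    (2 : ℝ) • newDual q (newFlux ρ s.flux s.bar) s.dual - s.dual⟩

/-- The right-hand side is attained, so that the constraint set is nonempty. -/
def Feasible (ρ : Scalar d N) : Prop := ∃ m : Field d N, divh m = ρ

/-- The mean of `A_h v - ρ` vanishes when `ρ` is attained, so that the Neumann problem is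
solvable. -/
theorem divh_newFlux (hN : 1 ≤ N) {ρ : Scalar d N} (hρ : Feasible ρ) (m w : Field d N) :
    divh (newFlux ρ m w) = ρ := by
  obtain ⟨m₀, hm₀⟩ := hρ
  rw [newFlux, divh_sub, divh_adj_poisson hN]
  · funext x; simp
  · rw [← hm₀, Finset.sum_sub_distrib, sum_divh hN, sum_divh hN, sub_zero]

/-- The residual of the projection is a gradient `A_h^* ψ`, hence orthogonal to the differences of
admissible fluxes. -/
theorem newFlux_variational (hN : 1 ≤ N) {ρ : Scalar d N} (m w u : Field d N)
    (hρ : Feasible ρ) (hu : divh u = ρ) :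
    vInner ((2 : ℝ) • (m - newFlux ρ m w) - w) (u - newFlux ρ m w) = 0 := by
  have e : (2 : ℝ) • (m - newFlux ρ m w) - w =
      (2 : ℝ) • adj (poisson fun x => divh (m - (1 / 2 : ℝ) • w) x - ρ x) := by
    unfold newFlux; funext x i; simp; ring
  rw [e, vInner_smul_left, vInner_adj hN, divh_sub u, hu, divh_newFlux hN hρ]
  simp [sInner]

theorem newDual_mem {p : ℝ≥0∞} {q : (Fin d → ℝ) → Fin d → ℝ} (hq : IsDualProj p q)
    (m φ : Field d N) : newDual q m φ ∈ dualBall (N := N) p := by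
  intro u
  unfold vInner cost
  refine Finset.sum_le_sum fun x _ => ?_
  rw [← Finset.sum_mul]
  exact mul_le_mul_of_nonneg_right ((hq _).1 (u x)) (pow_nonneg (gridStep_nonneg N) d)

theorem newDual_variational {p : ℝ≥0∞} {q : (Fin d → ℝ) → Fin d → ℝ} (hq : IsDualProj p q)
    (m φ : Field d N) {ψ : Field d N} (hψ : ψ ∈ dualBall p) :
    vInner ((2 : ℝ) • (φ - newDual q m φ) + m) (ψ - newDual q m φ) ≤ 0 := by
  set r : Field d N := φ + (1 / 2 : ℝ) • m - newDual q m φ with hr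
  have e : (2 : ℝ) • (φ - newDual q m φ) + m = (2 : ℝ) • r := by
    rw [hr]; funext x i; simp; ring
  have h1 : vInner ψ r ≤ cost p r := hψ r
  have h2 : cost p r ≤ vInner r (newDual q m φ) := by
    unfold vInner cost
    refine Finset.sum_le_sum fun x _ => ?_
    rw [← Finset.sum_mul]
    exact mul_le_mul_of_nonneg_right (hq (φ x + (1 / 2 : ℝ) • m x)).2
      (pow_nonneg (gridStep_nonneg N) d)
  rw [e, vInner_smul_left, vInner_sub_right, vInner_comm r ψ]
  linarith

/-- The minimizers in the subproblems are unique, so that the iteration is given by the explicit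
formulas. -/
theorem pdStep_eq {p : ℝ≥0∞} [Fact (1 ≤ p)] {q : (Fin d → ℝ) → Fin d → ℝ}
    (hq : IsDualProj p q) (hN : 1 ≤ N) {ρ : Scalar d N} (hρ : Feasible ρ) (s : State d N) :
    pdStep p ρ s = explicitStep q ρ s := by
  have e1 : (argmin fun m => indicator ρ m +
      ((vInner s.bar m + 1 / (2 * stepμ) * normSq (m - s.flux) : ℝ) : EReal)) =
      newFlux ρ s.flux s.bar := by
    have := argmin_eq_of_variational hN (C := {m | divh m = ρ}) (χ := indicator ρ)
      (fun x hx => if_pos hx) (fun x hx => if_neg hx) s.bar s.flux (newFlux ρ s.flux s.bar)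
      (divh_newFlux hN hρ _ _) fun u hu => by
        have h := newFlux_variational hN s.flux s.bar u hρ hu
        have e : s.bar + (2 : ℝ) • (newFlux ρ s.flux s.bar - s.flux) =
          -((2 : ℝ) • (s.flux - newFlux ρ s.flux s.bar) - s.bar) := by module
        rw [e, vInner_neg_left, h, neg_zero]
    simpa [stepμ] using this
  have e2 : ∀ m' : Field d N, (argmin fun φ => costConj p φ +
      ((-vInner φ m' + 1 / (2 * stepτ) * normSq (φ - s.dual) : ℝ) : EReal)) =
      newDual q m' s.dual := by
    intro m'
    have := argmin_eq_of_variational hN (C := dualBall p) (χ := costConj p)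
      (fun x hx => costConj_of_mem hx) (fun x hx => costConj_of_notMem hx) (-m') s.dual
      (newDual q m' s.dual) (newDual_mem hq _ _) fun u hu => by
        have h := newDual_variational hq m' s.dual hu
        have e : -m' + (2 : ℝ) • (newDual q m' s.dual - s.dual) =
          -((2 : ℝ) • (s.dual - newDual q m' s.dual) + m') := by module
        rw [e, vInner_neg_left]; linarith
    simpa [stepτ, vInner_neg_left, vInner_comm m'] using this
  unfold pdStep explicitStep
  simp only [e1, e2]

end Prox

/-! ### Convergence of the iteration -/

section Convergence

variable {d N : ℕ}

/-- The optimality conditions of a saddle point. -/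
theorem solSet_conditions {p : ℝ≥0∞} [Fact (1 ≤ p)] {ρ : Scalar d N}
    {z : Field d N × Field d N} (hz : z ∈ solSet p ρ) :
    divh z.1 = ρ ∧ z.2 ∈ dualBall p ∧ (∀ φ ∈ dualBall p, vInner z.1 (φ - z.2) ≤ 0) ∧
      ∀ m, divh m = ρ → 0 ≤ vInner z.2 (m - z.1) := by
  obtain ⟨ht, hb, hmax, hmin⟩ := hz
  have h2 : z.2 ∈ dualBall p := by
    by_contra h
    exact hb (by simp [lagr, costConj_of_notMem h])
  have h1 : divh z.1 = ρ := by
    by_contra h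
    exact ht (by simp [lagr, costConj_of_mem h2, indicator, h])
  have hval : ∀ m φ, divh m = ρ → φ ∈ dualBall p → lagr p ρ m φ = ((vInner φ m : ℝ) : EReal) :=
    fun m φ hm hφ => by simp [lagr, costConj_of_mem hφ, indicator, hm]
  refine ⟨h1, h2, fun φ hφ => ?_, fun m hm => ?_⟩
  · have := hmax φ
    rw [hval _ _ h1 h2, hval _ _ h1 hφ, EReal.coe_le_coe_iff] at this
    rw [vInner_sub_right, vInner_comm z.1, vInner_comm z.1]; linarith
  · have := hmin m
    rw [hval _ _ h1 h2, hval _ _ hm h2, EReal.coe_le_coe_iff] at this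
    rw [vInner_sub_right]; linarith

/-- The Lyapunov function of the iteration with respect to the saddle point `z`; note that
`φbar^k - φ^k = φ^k - φ^{k-1}`. -/
def lyapunov (z : Field d N × Field d N) (s : State d N) : ℝ :=
  normSq (s.flux - z.1) + normSq (s.dual - z.2) - vInner (s.flux - z.1) (s.bar - s.dual) +
    1 / 2 * normSq (s.bar - s.dual)

theorem lyapunov_nonneg (z : Field d N × Field d N) (s : State d N) : 0 ≤ lyapunov z s := by
  have h1 := normSq_nonneg ((s.flux - z.1) - (s.bar - s.dual))
  have h2 := normSq_nonneg (s.flux - z.1)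
  have h3 := normSq_nonneg (s.dual - z.2)
  unfold lyapunov
  generalize s.flux - z.1 = u at *
  generalize s.bar - s.dual = v at *
  simp only [normSq, vInner_sub_left, vInner_sub_right] at h1 h2 h3 ⊢
  rw [vInner_comm v u] at h1
  linarith

/-- The Lyapunov function decreases by at least a sixth of the residual. This adds the variational
inequalities of the two updates and of the saddle point. -/
theorem lyapunov_step {q : (Fin d → ℝ) → Fin d → ℝ} {p : ℝ≥0∞} [Fact (1 ≤ p)]
    (hq : IsDualProj p q) (hN : 1 ≤ N) {ρ : Scalar d N} {z : Field d N × Field d N}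
    (hz : z ∈ solSet p ρ) (s : State d N) :
    residual s (explicitStep q ρ s) ≤ 6 * (lyapunov z s - lyapunov z (explicitStep q ρ s)) := by
  obtain ⟨h1, h2, h3, h4⟩ := solSet_conditions hz
  have hρ : Feasible ρ := ⟨_, h1⟩
  set m' := newFlux ρ s.flux s.bar with hm'
  set φ' := newDual q m' s.dual with hφ'
  have v1 : vInner ((2 : ℝ) • (s.flux - m') - s.bar) (z.1 - m') = 0 :=
    newFlux_variational hN _ _ _ hρ h1
  have v2 : vInner ((2 : ℝ) • (s.dual - φ') + m') (z.2 - φ') ≤ 0 := newDual_variational hq _ _ h2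
  have v3 : vInner z.1 (φ' - z.2) ≤ 0 := h3 _ (newDual_mem hq _ _)
  have v4 : 0 ≤ vInner z.2 (m' - z.1) := h4 _ (divh_newFlux hN hρ _ _)
  have w1 := normSq_nonneg ((m' - s.flux) - (φ' - s.dual))
  have w2 := normSq_nonneg ((m' - s.flux) + (s.bar - s.dual))
  have e : explicitStep q ρ s = ⟨m', φ', (2 : ℝ) • φ' - s.dual⟩ := rfl
  rw [e]
  simp only [residual, lyapunov, stepμ, stepτ]
  generalize z.1 = zm at *
  generalize z.2 = zf at *
  generalize s.flux = m at *
  generalize s.dual = f at *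
  generalize s.bar = g at *
  simp only [normSq, vInner_sub_left, vInner_sub_right, vInner_smul_left, vInner_smul_right,
    vInner_add_left, vInner_add_right] at v1 v2 v3 v4 w1 w2 ⊢
  simp only [vInner_comm m' m, vInner_comm φ' m', vInner_comm φ' m, vInner_comm f m',
    vInner_comm f m, vInner_comm f φ', vInner_comm g m', vInner_comm g m,
    vInner_comm g f, vInner_comm zm m', vInner_comm zm m, vInner_comm zm φ', vInner_comm zm f,
    vInner_comm zm g, vInner_comm zf m', vInner_comm zf φ', vInner_comm zf f,
    vInner_comm zf zm] at v1 v2 v3 v4 w1 w2 ⊢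
  linarith

theorem sum_resid_le {p : ℝ≥0∞} [Fact (1 ≤ p)] {q : (Fin d → ℝ) → Fin d → ℝ}
    (hq : IsDualProj p q) (hN : 1 ≤ N) {ρ : Scalar d N} {z : Field d N × Field d N}
    (hz : z ∈ solSet p ρ) (y : Field d N × Field d N) (k : ℕ) :
    ∑ j ∈ Finset.range k, resid p ρ y j ≤ 6 * pairNormSq (y - z) := by
  have hρ : Feasible ρ := ⟨_, (solSet_conditions hz).1⟩
  have h : ∑ j ∈ Finset.range k, resid p ρ y j ≤
      6 * (lyapunov z (iter p ρ y 0) - lyapunov z (iter p ρ y k)) := by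
    induction k with
    | zero => simp
    | succ k ih =>
      have := lyapunov_step hq hN hz (iter p ρ y k)
      rw [← pdStep_eq hq hN hρ] at this
      rw [Finset.sum_range_succ]
      have e : resid p ρ y k ≤ _ := this
      have e2 : iter p ρ y (k + 1) = pdStep p ρ (iter p ρ y k) := rfl
      rw [e2]
      linarith
  have h0 : lyapunov z (iter p ρ y 0) = pairNormSq (y - z) := by
    have hv := vInner_smul_right 0 (y.1 - z.1) 0
    rw [zero_smul, zero_mul] at hv
    have hn : normSq (0 : Field d N) = 0 := by simp [normSq, vInner]
    simp [lyapunov, iter, pairNormSq, hv, hn]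
  have := lyapunov_nonneg z (iter p ρ y k)
  linarith

/-- The stopping criterion is met, after at most `6 D / ε` iterations if the initial point is at
squared distance `D` from a saddle point. -/
theorem stops_and_stopIter_le {p : ℝ≥0∞} [Fact (1 ≤ p)] {q : (Fin d → ℝ) → Fin d → ℝ}
    (hq : IsDualProj p q) (hN : 1 ≤ N) {ρ : Scalar d N} {z : Field d N × Field d N}
    (hz : z ∈ solSet p ρ) (y : Field d N × Field d N) {ε : ℝ} (hε : 0 < ε) :
    Stops p ρ y ε ∧ (stopIter p ρ y ε : ℝ) * ε ≤ 6 * pairNormSq (y - z) := by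
  have key : ∀ k, (∀ j < k, ε ≤ resid p ρ y j) → (k : ℝ) * ε ≤ 6 * pairNormSq (y - z) := by
    intro k hk
    refine le_trans ?_ (sum_resid_le hq hN hz y k)
    have := Finset.card_nsmul_le_sum (Finset.range k) (fun j => resid p ρ y j) ε
      fun j hj => hk j (by simpa using hj)
    simpa using this
  refine ⟨?_, key _ fun j hj => not_lt.1 (Nat.notMem_of_lt_sInf hj)⟩
  by_contra h
  simp only [Stops, not_exists, not_lt] at h
  obtain ⟨k, hk⟩ := exists_nat_gt (6 * pairNormSq (y - z) / ε)
  rw [div_lt_iff₀ hε] at hk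
  exact absurd (key k fun j _ => h j) (not_le.2 hk)

end Convergence

/-! ### Projections onto the dual balls -/

section DualProj

variable {d : ℕ}

/-- The map `q` can be evaluated with `g` operations. -/
def MapCost (q : (Fin d → ℝ) → Fin d → ℝ) (g : ℕ) : Prop :=
  ∀ (S : Type) (K : Set (S → ℝ)) (v : S → Fin d → ℝ), Known K v →
    Computes K g (comps fun s => q (v s))

/-- Componentwise truncation to `[-1, 1]`, the projection onto the ball dual to `‖·‖_1`. -/
def projOne (v : Fin d → ℝ) (i : Fin d) : ℝ := (-1) ⊔ (1 ⊓ v i)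

theorem isDualProj_one : IsDualProj 1 (projOne (d := d)) := by
  intro v
  constructor
  · intro u
    rw [PiLp.norm_eq_of_L1]
    refine Finset.sum_le_sum fun i _ => (le_abs_self _).trans ?_
    have : |projOne v i| ≤ 1 := abs_le.2 ⟨le_sup_left, sup_le (by norm_num) inf_le_left⟩
    rw [abs_mul]
    exact mul_le_of_le_one_left (abs_nonneg _) this
  · rw [PiLp.norm_eq_of_L1]
    refine Finset.sum_le_sum fun i _ => ?_
    change |v i - projOne v i| ≤ _
    unfold projOne
    rcases le_total (v i) 1 with h | h
    · rcases le_total (v i) (-1) with h' | h'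
      · rw [inf_eq_right.2 h, sup_eq_left.2 h', abs_of_nonpos (by linarith)]; linarith
      · rw [inf_eq_right.2 h, sup_eq_right.2 h']; simp
    · rw [inf_eq_left.2 h, sup_eq_right.2 (by norm_num), abs_of_nonneg (by linarith)]; linarith

theorem mapCost_projOne : MapCost (projOne (d := d)) (d * 20) := by
  intro S K v hv
  refine (Computes.comps (c := 20) fun i => ?_).le (by simp)
  exact ((Computes.const (-1)).max ((Computes.const 1).min (.var (hv i)))).le (by norm_num)

/-- Radial truncation to the unit ball, the projection onto the ball dual to `‖·‖_2`. -/
def projTwo (v : Fin d → ℝ) (i : Fin d) : ℝ := v i / (1 ⊔ √(∑ j, v j * v j))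

theorem isDualProj_two : IsDualProj 2 (projTwo (d := d)) := by
  intro v
  set R := √(∑ j, v j * v j) with hR
  have hRv : R * R = ∑ j, v j * v j :=
    Real.mul_self_sqrt (Finset.sum_nonneg fun _ _ => mul_self_nonneg _)
  have hnorm : ∀ u : Fin d → ℝ, ‖(WithLp.toLp 2 u : PiLp 2 fun _ : Fin d => ℝ)‖ =
      √(∑ j, u j * u j) := by
    intro u
    rw [EuclideanSpace.norm_eq]
    congr 1
    refine Finset.sum_congr rfl fun i _ => ?_
    rw [Real.norm_eq_abs, sq_abs, sq]
  have hM : 0 < 1 ⊔ R := lt_of_lt_of_le one_pos le_sup_left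
  have hRM : R ≤ 1 ⊔ R := le_sup_right
  constructor
  · intro u
    have h : ∑ i, v i * u i ≤ R * √(∑ j, u j * u j) := by
      have := Real.sum_mul_le_sqrt_mul_sqrt Finset.univ v u
      simpa [sq, hR] using this
    have e : ∑ i, projTwo v i * u i = (∑ i, v i * u i) / (1 ⊔ R) := by
      rw [Finset.sum_div]
      exact Finset.sum_congr rfl fun i _ => by rw [projTwo, ← hR]; ring
    rw [e, hnorm, div_le_iff₀ hM, mul_comm]
    exact h.trans (mul_le_mul_of_nonneg_right hRM (Real.sqrt_nonneg _))
  · rcases le_total R 1 with h | h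
    · have e : projTwo v = v := by funext i; rw [projTwo, ← hR, sup_eq_left.2 h, div_one]
      simp [e]
    · have hR0 : R ≠ 0 := by linarith
      have e : ∀ i, projTwo v i = v i / R := fun i => by rw [projTwo, ← hR, sup_eq_right.2 h]
      have e1 : ∑ i, (v i - projTwo v i) * projTwo v i = R - 1 := by
        have : ∀ i, (v i - projTwo v i) * projTwo v i =
            (v i * v i) * ((1 - 1 / R) * (1 / R)) := fun i => by rw [e]; ring
        rw [Finset.sum_congr rfl fun i _ => this i, ← Finset.sum_mul, ← hRv]
        field_simp
      have e2 : ∑ i, (v - projTwo v) i * (v - projTwo v) i = (R - 1) * (R - 1) := by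
        have : ∀ i, (v - projTwo v) i * (v - projTwo v) i =
            (v i * v i) * ((1 - 1 / R) * (1 - 1 / R)) := fun i => by
          rw [Pi.sub_apply, e]; ring
        rw [Finset.sum_congr rfl fun i _ => this i, ← Finset.sum_mul, ← hRv]
        field_simp
      rw [hnorm, e1, e2, Real.sqrt_mul_self (by linarith)]

theorem mapCost_projTwo : MapCost (projTwo (d := d)) (d * 20 + 20) := by
  intro S K v hv
  have h1 : Computes K (d * 2 + 10) {fun s => 1 ⊔ √(∑ j, v s j * v s j)} :=
    ((Computes.const 1).max (Computes.sqrt (Computes.sum Finset.univ (c := 1)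
      fun i _ => (Computes.var (hv i)).mul (.var (hv i))))).le (by simp; omega)
  refine (h1.trans (Computes.comps (c := 1) fun i => ?_)).le (by simp; omega)
  exact (Computes.var (Or.inl (hv i))).div (.var (Or.inr rfl))

/-- The threshold that brings `v` into the `ℓ¹` ball, as a maximum over all sets of indices. The
empty set contributes `(0 - 1) / 0 = 0`, so that the threshold is nonnegative. -/
def threshold (v : Fin d → ℝ) : ℝ :=
  (Finset.univ : Finset (Finset (Fin d))).sup' Finset.univ_nonempty
    fun A => (∑ i ∈ A, |v i| - 1) / (A.card : ℝ)

/-- Soft thresholding, the projection onto the ball dual to `‖·‖_∞`. -/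
def projTop (v : Fin d → ℝ) (i : Fin d) : ℝ :=
  v i - ((-threshold v) ⊔ (threshold v ⊓ v i))

theorem threshold_nonneg (v : Fin d → ℝ) : 0 ≤ threshold v := by
  have := Finset.le_sup' (fun A : Finset (Fin d) => (∑ i ∈ A, |v i| - 1) / (A.card : ℝ))
    (Finset.mem_univ ∅)
  change _ ≤ threshold v at this
  simpa using this

theorem projTop_apply (v : Fin d → ℝ) (i : Fin d) :
    |projTop v i| = (|v i| - threshold v) ⊔ 0 ∧ |v i - projTop v i| ≤ threshold v ∧
      (v i - projTop v i) * projTop v i = threshold v * ((|v i| - threshold v) ⊔ 0) := by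
  have h0 := threshold_nonneg v
  unfold projTop
  generalize threshold v = t at *
  generalize v i = x
  rcases le_total x t with h | h
  · rw [inf_eq_right.2 h]
    rcases le_total x (-t) with h' | h'
    · rw [sup_eq_left.2 h', abs_of_nonpos (show x ≤ 0 by linarith),
        sup_eq_left.2 (by linarith), abs_of_nonpos (by linarith)]
      refine ⟨by ring, ?_, by ring⟩
      rw [abs_of_nonpos (by linarith)]; linarith
    · rw [sup_eq_right.2 h', sup_eq_right.2 (by linarith [abs_le.2 ⟨h', h⟩])]
      simpa using abs_le.2 ⟨h', h⟩
  · rw [inf_eq_left.2 h, sup_eq_right.2 (by linarith), abs_of_nonneg (show 0 ≤ x by linarith),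
      sup_eq_left.2 (by linarith), abs_of_nonneg (by linarith)]
    refine ⟨rfl, ?_, by ring⟩
    rw [abs_of_nonneg (by linarith)]; linarith

/-- The threshold is at least the entry of the set `{i | threshold v < |v i|}`. -/
theorem sum_softThreshold_le (v : Fin d → ℝ) : ∑ i, ((|v i| - threshold v) ⊔ 0) ≤ 1 := by
  set A : Finset (Fin d) := Finset.univ.filter fun i => threshold v < |v i| with hA
  have h1 : ∑ i, ((|v i| - threshold v) ⊔ 0) = ∑ i ∈ A, (|v i| - threshold v) := by
    rw [hA, Finset.sum_filter]
    refine Finset.sum_congr rfl fun i _ => ?_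
    split_ifs with h
    · exact sup_eq_left.2 (by linarith)
    · exact sup_eq_right.2 (by linarith)
  rw [h1, Finset.sum_sub_distrib, Finset.sum_const, nsmul_eq_mul]
  rcases A.eq_empty_or_nonempty with h | h
  · simp [h]
  · have := Finset.le_sup' (fun A : Finset (Fin d) => (∑ i ∈ A, |v i| - 1) / (A.card : ℝ))
      (Finset.mem_univ A)
    have hc : (0 : ℝ) < A.card := by exact_mod_cast h.card_pos
    change _ ≤ threshold v at this
    rw [div_le_iff₀ hc] at this
    linarith

/-- A positive threshold is attained at a nonempty set of indices. -/
theorem one_le_sum_softThreshold (v : Fin d → ℝ) (h : 0 < threshold v) :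
    1 ≤ ∑ i, ((|v i| - threshold v) ⊔ 0) := by
  obtain ⟨A, -, hA⟩ := Finset.exists_mem_eq_sup' Finset.univ_nonempty
    fun A : Finset (Fin d) => (∑ i ∈ A, |v i| - 1) / (A.card : ℝ)
  change threshold v = _ at hA
  have hne : A.Nonempty := by
    rw [Finset.nonempty_iff_ne_empty]
    rintro rfl
    simp at hA
    linarith
  have hc : (0 : ℝ) < A.card := by exact_mod_cast hne.card_pos
  rw [eq_div_iff hc.ne'] at hA
  have h1 : (1 : ℝ) = ∑ i ∈ A, (|v i| - threshold v) := by
    rw [Finset.sum_sub_distrib, Finset.sum_const, nsmul_eq_mul]; linarith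
  calc (1 : ℝ) = ∑ i ∈ A, (|v i| - threshold v) := h1
    _ ≤ ∑ i ∈ A, ((|v i| - threshold v) ⊔ 0) := Finset.sum_le_sum fun _ _ => le_sup_left
    _ ≤ ∑ i, ((|v i| - threshold v) ⊔ 0) :=
      Finset.sum_le_sum_of_subset_of_nonneg (Finset.subset_univ _) fun _ _ _ => le_sup_right

theorem isDualProj_top : IsDualProj ⊤ (projTop (d := d)) := by
  intro v
  constructor
  · intro u
    set R := ‖(WithLp.toLp ⊤ u : PiLp ⊤ fun _ : Fin d => ℝ)‖ with hR
    have hu : ∀ i, |u i| ≤ R := fun i =>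
      PiLp.norm_apply_le (WithLp.toLp ⊤ u : PiLp ⊤ fun _ : Fin d => ℝ) i
    calc ∑ i, projTop v i * u i ≤ ∑ i, ((|v i| - threshold v) ⊔ 0) * R := by
          refine Finset.sum_le_sum fun i _ => (le_abs_self _).trans ?_
          rw [abs_mul, (projTop_apply v i).1]
          exact mul_le_mul_of_nonneg_left (hu i) le_sup_right
      _ = (∑ i, ((|v i| - threshold v) ⊔ 0)) * R := (Finset.sum_mul _ _ _).symm
      _ ≤ R := mul_le_of_le_one_left (norm_nonneg _) (sum_softThreshold_le v)
  · have h1 : ‖(WithLp.toLp ⊤ (v - projTop v) : PiLp ⊤ fun _ : Fin d => ℝ)‖ ≤ threshold v := by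
      rw [PiLp.norm_eq_ciSup]
      exact Real.iSup_le (fun i => (projTop_apply v i).2.1) (threshold_nonneg v)
    rw [Finset.sum_congr rfl fun i _ => (projTop_apply v i).2.2, ← Finset.mul_sum]
    rcases (threshold_nonneg v).eq_or_lt with h | h
    · rw [← h] at h1 ⊢; simpa using h1
    · exact h1.trans (le_mul_of_one_le_right h.le (one_le_sum_softThreshold v h))

theorem mapCost_projTop : MapCost (projTop (d := d)) (2 ^ d * (3 * d + 12) + d * 20) := by
  intro S K v hv
  have h1 : Computes K (2 ^ d * (3 * d + 12)) {fun s => threshold (v s)} := by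
    refine (Computes.sup' Finset.univ Finset.univ_nonempty (c := 3 * d + 5)
      (F := fun A s => (∑ i ∈ A, |v s i| - 1) / (A.card : ℝ)) fun A _ => ?_).le (by simp)
    have hA : A.card ≤ d := by simpa using Finset.card_le_univ A
    exact (((Computes.sum A fun i _ => (Computes.var (hv i)).abs).sub
      (.const 1)).div (.const _)).le (by omega)
  refine h1.trans ((Computes.comps (c := 20) fun i => ?_).le (by simp))
  have ht : Computes (K ∪ {fun s => threshold (v s)}) 0 {fun s => threshold (v s)} :=
    .var (Or.inr rfl)
  have hvi : Computes (K ∪ {fun s => threshold (v s)}) 0 {fun s => v s i} := .var (Or.inl (hv i))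
  exact (hvi.sub (ht.neg.max (ht.min hvi))).le (by norm_num)

theorem exists_dualProj {p : ℝ≥0∞} (hp : p = 1 ∨ p = 2 ∨ p = ⊤) (d : ℕ) :
    ∃ (q : (Fin d → ℝ) → Fin d → ℝ) (g : ℕ), IsDualProj p q ∧ MapCost q g := by
  rcases hp with rfl | rfl | rfl
  · exact ⟨_, _, isDualProj_one, mapCost_projOne⟩
  · exact ⟨_, _, isDualProj_two, mapCost_projTwo⟩
  · exact ⟨_, _, isDualProj_top, mapCost_projTop⟩

end DualProj

/-! ### Interpolation -/

section Interpolation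

variable {d N M : ℕ}

open Classical in
/-- The coarse neighbours of a fine node in one coordinate; `e` tells whether this is the
direction of the field component. -/
def coordNbrs (N : ℕ) (e : Prop) (v : Fin (M + 1)) : Finset (Fin (N + 1)) :=
  Finset.univ.filter fun y => if Even (v : ℕ) then 2 * (y : ℕ) = v
    else if e then 2 * (y : ℕ) + 1 = v else (2 * (y : ℕ) + 1 = v ∨ 2 * (y : ℕ) = v + 1)

theorem mem_coordNbrs {e : Prop} [Decidable e] {v : Fin (M + 1)} {y : Fin (N + 1)} :
    y ∈ coordNbrs N e v ↔ if Even (v : ℕ) then 2 * (y : ℕ) = v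
    else if e then 2 * (y : ℕ) + 1 = v else (2 * (y : ℕ) + 1 = v ∨ 2 * (y : ℕ) = v + 1) := by
  simp only [coordNbrs, Finset.mem_filter, Finset.mem_univ, true_and]
  split_ifs <;> rfl

theorem nbrs_eq (i : Fin d) (x : Grid d M) :
    nbrs (N := N) i x = Fintype.piFinset fun j => coordNbrs N (j = i) (x j) := by
  ext y
  simp only [nbrs, Finset.mem_filter, Fintype.mem_piFinset, Finset.mem_univ, true_and, IsNbr,
    mem_coordNbrs]

theorem card_coordNbrs_le (e : Prop) (v : Fin (M + 1)) : (coordNbrs N e v).card ≤ 2 := by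
  classical
  have : (coordNbrs N e v).card ≤ ({(v : ℕ) / 2, (v : ℕ) / 2 + 1} : Finset ℕ).card := by
    refine Finset.card_le_card_of_injOn (fun y => (y : ℕ)) ?_ (Fin.val_injective.injOn)
    intro y hy
    have hy := mem_coordNbrs.1 (Finset.mem_coe.1 hy)
    simp only [Finset.coe_insert, Finset.coe_singleton, Set.mem_insert_iff, Set.mem_singleton_iff]
    split_ifs at hy with h1 h2
    · omega
    · omega
    · omega
  exact this.trans Finset.card_le_two

theorem card_nbrs_le (i : Fin d) (x : Grid d M) : (nbrs (N := N) i x).card ≤ 2 ^ d := by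
  rw [nbrs_eq, Fintype.card_piFinset]
  refine (Finset.prod_le_pow_card _ _ 2 fun j _ => card_coordNbrs_le _ _).trans ?_
  simp

theorem sum_val_eq_le (n : ℕ) (r : ℝ) (hr : 0 ≤ r) :
    ∑ v : Fin (M + 1), (if (v : ℕ) = n then r else 0) ≤ r := by
  by_cases h : n < M + 1
  · rw [Finset.sum_eq_single ⟨n, h⟩]
    · simp
    · intro v _ hv
      exact if_neg fun e => hv (Fin.ext e)
    · simp
  · rw [Finset.sum_eq_zero]
    · exact hr
    · intro v _
      exact if_neg (by omega)

open Classical in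
/-- A coarse node receives at most the weight two in each coordinate: the weight of the node
itself, and either that of one further fine node or half the weights of two of them. -/
theorem sum_coord_weights_le (e : Prop) (y : Fin (N + 1)) :
    ∑ v : Fin (2 * N + 1),
      (if y ∈ coordNbrs N e v then ((coordNbrs N e v).card : ℝ)⁻¹ else 0) ≤ 2 := by
  have hone : ∀ v : Fin (2 * N + 1), y ∈ coordNbrs N e v →
      ((coordNbrs N e v).card : ℝ)⁻¹ ≤ 1 := fun v hv =>
    inv_le_one_of_one_le₀ (by exact_mod_cast Finset.card_pos.2 ⟨y, hv⟩)
  by_cases he : e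
  · calc _ ≤ ∑ v : Fin (2 * N + 1), ((if (v : ℕ) = 2 * y then (1 : ℝ) else 0) +
          (if (v : ℕ) = 2 * y + 1 then 1 else 0)) := by
          refine Finset.sum_le_sum fun v _ => ?_
          by_cases hy : y ∈ coordNbrs N e v
          · rw [if_pos hy]
            have h1 := hone v hy
            rw [mem_coordNbrs] at hy
            split_ifs at hy ⊢ <;> first | omega | linarith
          · rw [if_neg hy]; positivity
      _ ≤ 2 := by
          rw [Finset.sum_add_distrib]
          have h1 := sum_val_eq_le (M := 2 * N) (2 * y) 1 zero_le_one
          have h2 := sum_val_eq_le (M := 2 * N) (2 * y + 1) 1 zero_le_one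
          linarith
  · calc _ ≤ ∑ v : Fin (2 * N + 1), ((if (v : ℕ) = 2 * y then (1 : ℝ) else 0) +
          ((if (v : ℕ) = 2 * y + 1 then 1 / 2 else 0) +
          (if (v : ℕ) = 2 * y - 1 then 1 / 2 else 0))) := by
          refine Finset.sum_le_sum fun v _ => ?_
          by_cases hy : y ∈ coordNbrs N e v
          · rw [if_pos hy]
            have h1 := hone v hy
            by_cases hv : Even (v : ℕ)
            · have h2 : (v : ℕ) = 2 * y := by
                rw [mem_coordNbrs, if_pos hv] at hy; exact hy.symm
              rw [if_pos h2]
              have : (0 : ℝ) ≤ (if (v : ℕ) = 2 * y + 1 then 1 / 2 else 0) +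
                (if (v : ℕ) = 2 * y - 1 then 1 / 2 else 0) := by positivity
              linarith
            · have hlt := v.isLt
              have ho := Nat.not_even_iff.1 hv
              have hcard : 2 ≤ (coordNbrs N e v).card := by
                have hsub : ({⟨(v : ℕ) / 2, by omega⟩, ⟨(v : ℕ) / 2 + 1, by omega⟩} :
                    Finset (Fin (N + 1))) ⊆ coordNbrs N e v := by
                  intro z hz
                  rw [mem_coordNbrs, if_neg hv, if_neg he]
                  rcases Finset.mem_insert.1 hz with rfl | hz
                  · simp only; omega
                  · rw [Finset.mem_singleton] at hz
                    subst hz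
                    simp only; omega
                refine le_trans (le_of_eq ?_) (Finset.card_le_card hsub)
                rw [Finset.card_pair]
                simp
              have h2 : ((coordNbrs N e v).card : ℝ)⁻¹ ≤ 1 / 2 := by
                rw [one_div]
                exact inv_anti₀ two_pos (by exact_mod_cast hcard)
              rw [mem_coordNbrs, if_neg hv, if_neg he] at hy
              have : (0 : ℝ) ≤ if (v : ℕ) = 2 * y then (1 : ℝ) else 0 := by positivity
              rcases hy with hy | hy
              · rw [if_pos (show (v : ℕ) = 2 * y + 1 by omega)]
                have : (0 : ℝ) ≤ if (v : ℕ) = 2 * y - 1 then (1 / 2 : ℝ) else 0 := by positivity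
                linarith
              · rw [if_pos (show (v : ℕ) = 2 * y - 1 by omega)]
                have : (0 : ℝ) ≤ if (v : ℕ) = 2 * y + 1 then (1 / 2 : ℝ) else 0 := by positivity
                linarith
          · rw [if_neg hy]; positivity
      _ ≤ 2 := by
          rw [Finset.sum_add_distrib, Finset.sum_add_distrib]
          have h1 := sum_val_eq_le (M := 2 * N) (2 * y) 1 zero_le_one
          have h2 := sum_val_eq_le (M := 2 * N) (2 * y + 1) (1 / 2) (by norm_num)
          have h3 := sum_val_eq_le (M := 2 * N) (2 * y - 1) (1 / 2) (by norm_num)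
          linarith

open Classical in
theorem sum_weights_le (i : Fin d) (y : Grid d N) :
    ∑ x : Grid d (2 * N),
      (if y ∈ nbrs (N := N) i x then ((nbrs (N := N) i x).card : ℝ)⁻¹ else 0) ≤ 2 ^ d := by
  have h : ∀ x : Grid d (2 * N),
      (if y ∈ nbrs (N := N) i x then ((nbrs (N := N) i x).card : ℝ)⁻¹ else 0) =
      ∏ j, if y j ∈ coordNbrs N (j = i) (x j) then
        ((coordNbrs N (j = i) (x j)).card : ℝ)⁻¹ else 0 := by
    intro x
    rw [nbrs_eq, Fintype.card_piFinset, Nat.cast_prod, ← Finset.prod_inv_distrib]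
    by_cases hy : y ∈ Fintype.piFinset fun j => coordNbrs N (j = i) (x j)
    · rw [if_pos hy]
      rw [Fintype.mem_piFinset] at hy
      exact Finset.prod_congr rfl fun j _ => (if_pos (hy j)).symm
    · rw [if_neg hy]
      rw [Fintype.mem_piFinset, not_forall] at hy
      obtain ⟨j, hj⟩ := hy
      rw [Finset.prod_eq_zero (Finset.mem_univ j) (if_neg hj)]
  rw [Finset.sum_congr rfl fun x _ => h x]
  have h2 := Finset.prod_univ_sum (fun _ : Fin d => (Finset.univ : Finset (Fin (2 * N + 1))))
    fun j v => if y j ∈ coordNbrs N (j = i) v then ((coordNbrs N (j = i) v).card : ℝ)⁻¹ else 0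
  rw [Fintype.piFinset_univ] at h2
  rw [← h2]
  calc _ ≤ ∏ _j : Fin d, (2 : ℝ) := by
        refine Finset.prod_le_prod (fun j _ => Finset.sum_nonneg fun v _ => ?_)
          fun j _ => sum_coord_weights_le _ _
        split_ifs <;> positivity
    _ = 2 ^ d := by simp

theorem gridStep_two_mul (N : ℕ) : gridStep (2 * N) = gridStep N / 2 := by
  unfold gridStep; push_cast; rw [mul_comm, div_div]

/-- Interpolation does not increase the norm. -/
theorem normSq_interp_le (u : Field d N) : normSq (interp (2 * N) u) ≤ normSq u := by
  classical
  have hj : ∀ (x : Grid d (2 * N)) (i : Fin d), interp (2 * N) u x i * interp (2 * N) u x i ≤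
      ∑ y : Grid d N, (u y i * u y i) *
        (if y ∈ nbrs (N := N) i x then ((nbrs (N := N) i x).card : ℝ)⁻¹ else 0) := by
    intro x i
    have h1 := sq_sum_le_card_mul_sum_sq (s := nbrs (N := N) i x) (f := fun y => u y i)
    have h2 : ∑ y : Grid d N, (u y i * u y i) *
        (if y ∈ nbrs (N := N) i x then ((nbrs (N := N) i x).card : ℝ)⁻¹ else 0) =
        (∑ y ∈ nbrs (N := N) i x, u y i ^ 2) * ((nbrs (N := N) i x).card : ℝ)⁻¹ := by
      rw [Finset.sum_mul]
      simp only [mul_ite, mul_zero]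
      rw [← Finset.sum_filter]
      simp [sq]
    rw [h2, interp]
    rcases Nat.eq_zero_or_pos (nbrs (N := N) i x).card with h0 | h0
    · simp [h0]
    · have hc : (0 : ℝ) < (nbrs (N := N) i x).card := by exact_mod_cast h0
      rw [← sq, div_pow, div_le_iff₀ (by positivity)]
      refine h1.trans (le_of_eq ?_)
      field_simp
  have hg := pow_nonneg (gridStep_nonneg (2 * N)) d
  calc normSq (interp (2 * N) u)
      ≤ ∑ x : Grid d (2 * N), ∑ i, (∑ y : Grid d N, (u y i * u y i) *
        (if y ∈ nbrs (N := N) i x then ((nbrs (N := N) i x).card : ℝ)⁻¹ else 0)) *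
        gridStep (2 * N) ^ d :=
      Finset.sum_le_sum fun x _ => Finset.sum_le_sum fun i _ =>
        mul_le_mul_of_nonneg_right (hj x i) hg
    _ = ∑ y : Grid d N, ∑ i, (u y i * u y i) * (∑ x : Grid d (2 * N),
        (if y ∈ nbrs (N := N) i x then ((nbrs (N := N) i x).card : ℝ)⁻¹ else 0)) *
        gridStep (2 * N) ^ d := by
      simp only [Finset.sum_mul, Finset.mul_sum]
      rw [Finset.sum_comm, Finset.sum_comm (s := (Finset.univ : Finset (Grid d N)))]
      refine Finset.sum_congr rfl fun i _ => ?_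
      rw [Finset.sum_comm]
    _ ≤ normSq u := by
      refine Finset.sum_le_sum fun y _ => Finset.sum_le_sum fun i _ => ?_
      have h := sum_weights_le (N := N) i y
      rw [mul_assoc]
      refine mul_le_mul_of_nonneg_left ?_ (mul_self_nonneg _)
      calc _ ≤ 2 ^ d * gridStep (2 * N) ^ d := mul_le_mul_of_nonneg_right h hg
        _ = gridStep N ^ d := by rw [gridStep_two_mul, ← mul_pow]; congr 1; ring

theorem interp_sub (u v : Field d N) : interp M (u - v) = interp M u - interp M v := by
  funext x i
  simp [interp, Finset.sum_sub_distrib, sub_div]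

theorem normSq_sub_le (u v w : Field d N) :
    normSq (u - w) ≤ 2 * normSq (u - v) + 2 * normSq (v - w) := by
  have h := normSq_nonneg ((u - v) - (v - w))
  have e : u - w = (u - v) + (v - w) := by abel
  rw [e]
  generalize u - v = r at *
  generalize v - w = t at *
  simp only [normSq, vInner_sub_left, vInner_sub_right, vInner_add_left, vInner_add_right] at h ⊢
  linarith

theorem pairNormSq_sub_le (u v w : Field d N × Field d N) :
    pairNormSq (u - w) ≤ 2 * pairNormSq (u - v) + 2 * pairNormSq (v - w) := by
  have h1 := normSq_sub_le u.1 v.1 w.1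
  have h2 := normSq_sub_le u.2 v.2 w.2
  simp only [pairNormSq, Prod.fst_sub, Prod.snd_sub]
  linarith

theorem pairNormSq_interpPair_sub_le (u v : Field d N × Field d N) :
    pairNormSq (interpPair (2 * N) u - interpPair (2 * N) v) ≤ pairNormSq (u - v) := by
  simp only [pairNormSq, interpPair, Prod.fst_sub, Prod.snd_sub, ← interp_sub]
  exact add_le_add (normSq_interp_le _) (normSq_interp_le _)

end Interpolation

/-! ### Initial errors on the levels -/

section Levels

variable {d : ℕ}

/-- For a good tolerance, the output is close to a saddle point: the iteration does not stop
before it is. -/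
theorem GoodTol.output_close {N : ℕ} {p : ℝ≥0∞} {ρ : Scalar d N} {y : Field d N × Field d N}
    {δ ε : ℝ} (h : GoodTol p ρ y δ ε) (hs : Stops p ρ y ε) :
    ∃ z ∈ solSet p ρ, pairNormSq (output p ρ y ε - z) ≤ δ := by
  obtain ⟨-, K₀, h1, h2⟩ := h
  refine h1 _ ?_
  by_contra hlt
  have hmem : resid p ρ y (stopIter p ρ y ε) < ε := Nat.sInf_mem hs
  exact absurd hmem (not_lt.2 (h2 _ (by omega)))

theorem GoodTol.le_resid_zero {N : ℕ} {p : ℝ≥0∞} {ρ : Scalar d N} {y : Field d N × Field d N}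
    {δ ε : ℝ} (h : GoodTol p ρ y δ ε) : ε ≤ resid p ρ y 0 := by
  obtain ⟨-, K₀, -, h2⟩ := h
  exact h2 0 (Nat.zero_le _)

theorem gridStep_two_pow_rpow (j : ℕ) (x : ℝ) : gridStep (2 ^ j) ^ x = (2 : ℝ) ^ (-(j * x)) := by
  have : gridStep (2 ^ j) = (2 : ℝ) ^ (-(j : ℝ)) := by
    rw [gridStep, Real.rpow_neg two_pos.le, Real.rpow_natCast]; simp
  rw [this, ← Real.rpow_mul two_pos.le, neg_mul]

/-- The initial point on every level is as close to a saddle point as the discretization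
permits. -/
theorem exists_solSet_near_levelStart {p : ℝ≥0∞} [Fact (1 ≤ p)] {q : (Fin d → ℝ) → Fin d → ℝ}
    (hq : IsDualProj p q) {ρ₀ ρ₁ : (Fin d → ℝ) → ℝ} {n : ℕ} {C₃ C₄ ν : ℝ} (hC₃ : 0 < C₃)
    (hC₄ : 0 < C₄) {ε : ℕ → ℝ}
    (hA : ∀ j ≤ n, SolBounded p (rhs ρ₀ ρ₁ (2 ^ j)) C₃)
    (hB : ∀ j < n, SolInterp p ρ₀ ρ₁ (2 ^ j) (2 ^ (j + 1)) C₄ ν)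
    (hε : ∀ j ≤ n, GoodTol p (rhs ρ₀ ρ₁ (2 ^ j)) (levelStart p ρ₀ ρ₁ ε j)
      (C₄ * gridStep (2 ^ j) ^ ν) (ε j)) (j : ℕ) (hj : j ≤ n) :
    ∃ z ∈ solSet p (rhs ρ₀ ρ₁ (2 ^ j)), pairNormSq (levelStart p ρ₀ ρ₁ ε j - z) ≤
      (C₃ + 4 * C₄ * 2 ^ ν) * (2 : ℝ) ^ (-(j * ν)) := by
  cases j with
  | zero =>
    obtain ⟨⟨z, hz⟩, hb⟩ := hA 0 hj
    refine ⟨z, hz, ?_⟩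
    have e : pairNormSq (levelStart p ρ₀ ρ₁ ε 0 - z) = pairNormSq z := by
      simp [levelStart, pairNormSq, normSq, vInner]
    rw [e]
    have h2 : (0 : ℝ) < 4 * C₄ * 2 ^ ν := by positivity
    simpa using (hb z hz).trans (by linarith)
  | succ j =>
    have hjn : j ≤ n := by omega
    obtain ⟨⟨z₀, hz₀⟩, -⟩ := hA j hjn
    have hs := (stops_and_stopIter_le hq Nat.one_le_two_pow hz₀ (levelStart p ρ₀ ρ₁ ε j)
      (hε j hjn).1).1
    obtain ⟨y, hy, hyδ⟩ := (hε j hjn).output_close hs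
    obtain ⟨z, hz, hzδ⟩ := hB j (by omega) y hy
    refine ⟨z, hz, ?_⟩
    rw [gridStep_two_pow_rpow] at hyδ hzδ
    have h1 := pairNormSq_sub_le (levelStart p ρ₀ ρ₁ ε (j + 1)) (interpPair (2 ^ (j + 1)) y) z
    have h2 : pairNormSq (levelStart p ρ₀ ρ₁ ε (j + 1) - interpPair (2 ^ (j + 1)) y) ≤
        pairNormSq (output p (rhs ρ₀ ρ₁ (2 ^ j)) (levelStart p ρ₀ ρ₁ ε j) (ε j) - y) := by
      have := pairNormSq_interpPair_sub_le
        (output p (rhs ρ₀ ρ₁ (2 ^ j)) (levelStart p ρ₀ ρ₁ ε j) (ε j)) y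
      rw [← pow_succ'] at this
      exact this
    have h3 : (2 : ℝ) ^ ν * (2 : ℝ) ^ (-(((j + 1 : ℕ) : ℝ) * ν)) = (2 : ℝ) ^ (-(j * ν)) := by
      rw [← Real.rpow_add two_pos]; congr 1; push_cast; ring
    have h4 : 0 < C₃ * (2 : ℝ) ^ (-(((j + 1 : ℕ) : ℝ) * ν)) := by positivity
    rw [add_mul, mul_assoc, h3]
    linarith

end Levels

/-! ### Costs of the steps of the algorithms -/

section StepCosts

variable {d N : ℕ}

/-- The components of a field-valued quantity. -/
def fieldComps (m : S → Field d N) : Set (S → ℝ) :=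
  comps fun s (xi : Grid d N × Fin d) => m s xi.1 xi.2

/-- All components of the field-valued quantity `m` are in `K`. -/
def KnownField (K : Set (S → ℝ)) (m : S → Field d N) : Prop := ∀ x i, (fun s => m s x i) ∈ K

theorem KnownField.mono {m : S → Field d N} (h : KnownField K m) (hK : K ⊆ K₁) :
    KnownField K₁ m := fun x i => hK (h x i)

theorem knownField_of_subset {m : S → Field d N} (h : fieldComps m ⊆ K) : KnownField K m :=
  fun x i => h ⟨(x, i), rfl⟩

theorem Computes.fieldComps {m : S → Field d N} (h : ∀ x i, Computes K c {fun s => m s x i}) :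
    Computes K ((N + 1) ^ d * d * c) (EMD.fieldComps m) :=
  (Computes.comps fun xi : Grid d N × Fin d => h xi.1 xi.2).le (by simp)

theorem Computes.divh {m : S → Field d N} (hm : KnownField K m) (x : Grid d N) :
    Computes K (d * 5 + 1) {fun s => EMD.divh (m s) x} := by
  refine (Computes.sum Finset.univ (c := 4) fun i _ => ?_).le (by simp)
  unfold diff
  split_ifs
  · exact ((Computes.var (hm x i)).div (.const _)).le (by norm_num)
  · exact (((Computes.var (hm x i)).sub (.var (hm _ i))).div (.const _)).le (by norm_num)
  · exact ((Computes.var (hm _ i)).neg.div (.const _)).le (by norm_num)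

theorem Computes.adj {ψ : S → Scalar d N} (hψ : Known K ψ) (x : Grid d N) (i : Fin d) :
    Computes K 3 {fun s => EMD.adj (ψ s) x i} := by
  unfold EMD.adj
  split_ifs
  · exact (((Computes.var (hψ x)).sub (.var (hψ _))).div (.const _)).le (by norm_num)
  · exact (Computes.const 0).le (by norm_num)

theorem Computes.newFlux {ρ : S → Scalar d N} {m w : S → Field d N} (hρ : Known K ρ)
    (hm : KnownField K m) (hw : KnownField K w) :
    Computes K (poissonCost d N + (N + 1) ^ d * (12 * d + 2))
      (EMD.fieldComps fun s => EMD.newFlux (ρ s) (m s) (w s)) := by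
  set v : S → Field d N := fun s => m s - (1 / 2 : ℝ) • w s with hv
  have h1 : Computes K ((N + 1) ^ d * d * 3) (EMD.fieldComps v) := Computes.fieldComps fun x i =>
    (Computes.var (hm x i)).sub ((Computes.var (hw x i)).const_mul (1 / 2))
  have hv2 : KnownField (K ∪ EMD.fieldComps v) v := knownField_of_subset Set.subset_union_right
  have h2 : Computes (K ∪ EMD.fieldComps v) ((N + 1) ^ d * (5 * d + 2))
      (EMD.comps fun s x => EMD.divh (v s) x - ρ s x) :=
    (Computes.comps (F := fun s x => EMD.divh (v s) x - ρ s x) (c := 5 * d + 2)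
      fun x => ((Computes.divh hv2 x).sub
      (.var (Or.inl (hρ x)))).le (by omega)).le (by simp)
  have h3 := Computes.poisson _ (known_union_comps (K ∪ EMD.fieldComps v)
    fun s x => EMD.divh (v s) x - ρ s x)
  have h4 : Computes ((K ∪ EMD.fieldComps v) ∪
      EMD.comps fun s => EMD.poisson fun x => EMD.divh (v s) x - ρ s x)
      ((N + 1) ^ d * d * 4) (EMD.fieldComps fun s => EMD.newFlux (ρ s) (m s) (w s)) :=
    Computes.fieldComps fun x i => (Computes.var (Or.inl (hv2 x i))).sub
      (Computes.adj (known_union_comps _ _) x i)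
  exact (h1.trans ((h2.trans h3).trans h4)).le (by ring_nf; omega)

theorem Computes.newDual {q : (Fin d → ℝ) → Fin d → ℝ} {g : ℕ} (hg : MapCost q g)
    {m φ : S → Field d N} (hm : KnownField K m) (hφ : KnownField K φ) :
    Computes K ((N + 1) ^ d * (3 * d + g))
      (EMD.fieldComps fun s => EMD.newDual q (m s) (φ s)) := by
  have h : ∀ x : Grid d N, Computes K (3 * d + g)
      (EMD.comps fun s => EMD.newDual q (m s) (φ s) x) := by
    intro x
    have h1 : Computes K (3 * d) (EMD.comps fun s => φ s x + (1 / 2 : ℝ) • m s x) :=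
      (Computes.comps (c := 3) fun i => (Computes.var (hφ x i)).add
        ((Computes.var (hm x i)).const_mul (1 / 2))).le (by simp [mul_comm])
    exact h1.trans (hg S _ _ (known_union_comps _ _))
  refine (Computes.iUnion h).mono subset_rfl ?_ (by simp)
  rintro _ ⟨⟨x, i⟩, rfl⟩
  exact Set.mem_iUnion.2 ⟨x, i, rfl⟩

/-- The components of a state-valued quantity. -/
def stateComps (σ : S → State d N) : Set (S → ℝ) :=
  fieldComps (fun s => (σ s).flux) ∪ fieldComps (fun s => (σ s).dual) ∪
    fieldComps (fun s => (σ s).bar)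

/-- A bound for the number of operations of one iteration with residual, where `g` operations
suffice for a projection onto the dual ball of `ℝ^d`. -/
def stepCost (d N g : ℕ) : ℕ := poissonCost d N + (N + 1) ^ d * (36 * d + g + 19)

theorem Computes.explicitStep {q : (Fin d → ℝ) → Fin d → ℝ} {g : ℕ} (hg : MapCost q g)
    {ρ : S → Scalar d N} {σ : S → State d N} (hρ : Known K ρ) (hσ : stateComps σ ⊆ K) :
    Computes K (poissonCost d N + (N + 1) ^ d * (18 * d + g + 2))
      (stateComps fun s => EMD.explicitStep q (ρ s) (σ s)) := by
  have hm : KnownField K fun s => (σ s).flux := knownField_of_subset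
    ((Set.subset_union_left.trans Set.subset_union_left).trans hσ)
  have hf : KnownField K fun s => (σ s).dual := knownField_of_subset
    ((Set.subset_union_right.trans Set.subset_union_left).trans hσ)
  have hb : KnownField K fun s => (σ s).bar := knownField_of_subset
    (Set.subset_union_right.trans hσ)
  set m' : S → Field d N := fun s => EMD.newFlux (ρ s) (σ s).flux (σ s).bar
  set f' : S → Field d N := fun s => EMD.newDual q (m' s) (σ s).dual with hf'
  have h1 : Computes K _ (EMD.fieldComps m') := Computes.newFlux hρ hm hb
  have h2 : Computes (K ∪ EMD.fieldComps m') _ (EMD.fieldComps f') :=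
    Computes.newDual hg (knownField_of_subset Set.subset_union_right)
      (hf.mono Set.subset_union_left)
  have h3 : Computes (K ∪ (EMD.fieldComps m' ∪ EMD.fieldComps f')) ((N + 1) ^ d * d * 3)
      (EMD.fieldComps fun s => (2 : ℝ) • f' s - (σ s).dual) :=
    Computes.fieldComps fun x i => ((Computes.var (Or.inr (Or.inr ⟨(x, i), rfl⟩))).const_mul 2).sub
      (.var (Or.inl (hf x i)))
  exact ((h1.trans_union h2).trans_union h3).mono subset_rfl (Eq.subset rfl)
    (by ring_nf; omega)

theorem Computes.vInner_sub {u u' v v' : S → Field d N} (hu : KnownField K u)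
    (hu' : KnownField K u') (hv : KnownField K v) (hv' : KnownField K v') :
    Computes K ((N + 1) ^ d * (6 * d + 2) + 1)
      {fun s => vInner (u s - u' s) (v s - v' s)} := by
  refine (Computes.sum (Finset.univ : Finset (Grid d N)) (c := 6 * d + 1) fun x _ => ?_).le
    (by simp)
  refine (Computes.sum Finset.univ (c := 5) fun i _ => ?_).le (by simp; omega)
  exact ((((Computes.var (hu x i)).sub (.var (hu' x i))).mul
    ((Computes.var (hv x i)).sub (.var (hv' x i)))).mul (.const _)).le (by norm_num)

theorem Computes.residual {σ σ' : S → State d N} (hσ : stateComps σ ⊆ K)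
    (hσ' : stateComps σ' ⊆ K) :
    Computes K ((N + 1) ^ d * (18 * d + 6) + 11) {fun s => EMD.residual (σ s) (σ' s)} := by
  have hm : KnownField K fun s => (σ s).flux := knownField_of_subset
    ((Set.subset_union_left.trans Set.subset_union_left).trans hσ)
  have hf : KnownField K fun s => (σ s).dual := knownField_of_subset
    ((Set.subset_union_right.trans Set.subset_union_left).trans hσ)
  have hm' : KnownField K fun s => (σ' s).flux := knownField_of_subset
    ((Set.subset_union_left.trans Set.subset_union_left).trans hσ')
  have hf' : KnownField K fun s => (σ' s).dual := knownField_of_subset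
    ((Set.subset_union_right.trans Set.subset_union_left).trans hσ')
  exact ((((Computes.vInner_sub hm' hm hm' hm).const_mul (1 / stepμ)).add
    ((Computes.vInner_sub hf' hf hf' hf).const_mul (1 / stepτ))).add
    ((Computes.vInner_sub hf' hf hm' hm).const_mul 2)).le (by ring_nf; omega)

theorem Computes.explicitStep_residual {q : (Fin d → ℝ) → Fin d → ℝ} {g : ℕ} (hg : MapCost q g)
    {ρ : S → Scalar d N} {σ : S → State d N} (hρ : Known K ρ) (hσ : stateComps σ ⊆ K) :
    Computes K (stepCost d N g) (stateComps (fun s => EMD.explicitStep q (ρ s) (σ s)) ∪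
      {fun s => EMD.residual (σ s) (EMD.explicitStep q (ρ s) (σ s))}) := by
  refine ((Computes.explicitStep hg hρ hσ).trans_union (Computes.residual
    (hσ.trans Set.subset_union_left) Set.subset_union_right)).le ?_
  have : 1 ≤ (N + 1) ^ d := Nat.one_le_pow _ _ (by omega)
  unfold stepCost
  generalize (N + 1) ^ d = A at *
  linarith

theorem Computes.interp {M : ℕ} {m : S → Field d N} (hm : KnownField K m) :
    Computes K ((M + 1) ^ d * d * (2 ^ d + 3)) (EMD.fieldComps fun s => EMD.interp M (m s)) := by
  refine Computes.fieldComps fun x i => ?_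
  have := card_nbrs_le (N := N) i x
  exact ((Computes.sum (nbrs i x) (c := 0) fun y _ => Computes.var (hm y i)).div
    (.const _)).le (by omega)

end StepCosts

/-! ### Programs for the steps -/

section Programs

variable {d N N' L : ℕ}

/-- The state on a grid with step `1/N'` that is stored in the registers of the nodes `e x` of
the grid with step `1/N`. -/
def readState (e : Grid d N' → Grid d N) (s : Reg d N L → ℝ) : State d N' :=
  ⟨fun x i => s (.flux (e x) i), fun x i => s (.dual (e x) i), fun x i => s (.bar (e x) i)⟩

/-- The right-hand side on the grid with step `1/N'`, from the values at the nodes `e x`. -/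
def readRhs (e : Grid d N' → Grid d N) (s : Reg d N L → ℝ) : Scalar d N' :=
  fun x => s (.rho0 (e x)) - s (.rho1 (e x))

/-- The input data and the tolerances are the same in both memories. -/
def SameInput (s t : Reg d N L → ℝ) : Prop :=
  (∀ x, t (.rho0 x) = s (.rho0 x)) ∧ (∀ x, t (.rho1 x) = s (.rho1 x)) ∧
    ∀ l, t (.tol l) = s (.tol l)

theorem SameInput.trans {s t u : Reg d N L → ℝ} (h : SameInput s t) (h' : SameInput t u) :
    SameInput s u :=
  ⟨fun x => (h'.1 x).trans (h.1 x), fun x => (h'.2.1 x).trans (h.2.1 x),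
    fun l => (h'.2.2 l).trans (h.2.2 l)⟩

theorem SameInput.readRhs_eq {s t : Reg d N L → ℝ} (h : SameInput s t)
    (e : Grid d N' → Grid d N) : readRhs e t = readRhs e s := by
  funext x; simp [readRhs, h.1, h.2.1]

/-- The contents of the registers other than the working registers. -/
def registerValues (d N L : ℕ) : Set ((Reg d N L → ℝ) → ℝ) :=
  {f | ∃ r : Reg d N L, (∀ k, r ≠ .work k) ∧ f = fun s => s r}

/-- The registers of the flux, the dual variables, the extrapolated dual variables at the nodes
`e x`, and the register of the residual. -/
def stateRegs (L : ℕ) (e : Grid d N' → Grid d N) : Finset (Reg d N L) := by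
  classical
  exact (Finset.univ.image fun xi : Grid d N' × Fin d => Reg.flux (e xi.1) xi.2) ∪
    (Finset.univ.image fun xi : Grid d N' × Fin d => Reg.dual (e xi.1) xi.2) ∪
    (Finset.univ.image fun xi : Grid d N' × Fin d => Reg.bar (e xi.1) xi.2) ∪ {Reg.res}

theorem card_stateRegs_le (e : Grid d N' → Grid d N) :
    (stateRegs L e).card ≤ (N' + 1) ^ d * (3 * d) + 1 := by
  classical
  have h : ∀ f : Grid d N' × Fin d → Reg d N L,
      (Finset.univ.image f).card ≤ (N' + 1) ^ d * d := fun f =>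
    Finset.card_image_le.trans (by simp)
  unfold stateRegs
  refine (Finset.card_union_le _ _).trans (Nat.add_le_add ?_ (by simp))
  refine (Finset.card_union_le _ _).trans ((Nat.add_le_add ((Finset.card_union_le _ _).trans
    (Nat.add_le_add (h _) (h _))) (h _)).trans ?_)
  ring_nf; omega

theorem mem_stateRegs {e : Grid d N' → Grid d N} {r : Reg d N L} : r ∈ stateRegs L e ↔
    (∃ x i, r = .flux (e x) i) ∨ (∃ x i, r = .dual (e x) i) ∨ (∃ x i, r = .bar (e x) i) ∨
      r = .res := by
  simp only [stateRegs, Finset.mem_union, Finset.mem_image, Finset.mem_univ, true_and,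
    Finset.mem_singleton, Prod.exists, or_assoc, eq_comm]

/-- The value to be stored in the register `r`, for a new state `σ` and residual `v`. -/
def stateValue (e : Grid d N' → Grid d N) (σ : State d N') (v : ℝ) : Reg d N L → ℝ
  | .flux y i => Function.extend e (fun x => σ.flux x i) 0 y
  | .dual y i => Function.extend e (fun x => σ.dual x i) 0 y
  | .bar y i => Function.extend e (fun x => σ.bar x i) 0 y
  | .res => v
  | _ => 0

theorem work_injective : Function.Injective (Reg.work : ℕ → Reg d N L) := by
  intro a b h; cases h; rfl

/-- A program that replaces the state stored at the nodes `e x` by a state that can be computed,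
and the residual by a quantity that can be computed. -/
theorem exists_state_prog {e : Grid d N' → Grid d N} (he : Function.Injective e)
    (F : (Reg d N L → ℝ) → State d N') (G : (Reg d N L → ℝ) → ℝ) {c : ℕ}
    (h : Computes (registerValues d N L) c (stateComps F ∪ {G})) :
    ∃ (P : Prog (Reg d N L)) (c' : ℕ), c' ≤ c + (N' + 1) ^ d * (6 * d) + 2 ∧
      ∀ s, ∃ t, Exec P s t c' ∧ readState e t = F s ∧ t .res = G s ∧ SameInput s t := by
  have hO : ∀ r ∈ stateRegs L e, ∀ k, r ≠ Reg.work k := by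
    intro r hr k
    rcases mem_stateRegs.1 hr with ⟨x, i, rfl⟩ | ⟨x, i, rfl⟩ | ⟨x, i, rfl⟩ | rfl <;> simp
  obtain ⟨P, c', hc, hP⟩ := Computes.exists_prog work_injective (stateRegs L e) hO
    (fun r s => stateValue e (F s) (G s) r) (c := c) (h.mono subset_rfl (by
      rintro _ ⟨r, hr, rfl⟩
      rcases mem_stateRegs.1 hr with ⟨x, i, rfl⟩ | ⟨x, i, rfl⟩ | ⟨x, i, rfl⟩ | rfl
      · exact Or.inl (Or.inl (Or.inl ⟨(x, i), by simp [stateValue, he.extend_apply]⟩))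
      · exact Or.inl (Or.inl (Or.inr ⟨(x, i), by simp [stateValue, he.extend_apply]⟩))
      · exact Or.inl (Or.inr ⟨(x, i), by simp [stateValue, he.extend_apply]⟩)
      · exact Or.inr rfl) le_rfl)
  have hcard := card_stateRegs_le (L := L) e
  refine ⟨P, c', by ring_nf at hcard hc ⊢; omega, fun s => ?_⟩
  obtain ⟨t, hE, hv, hn⟩ := hP s
  have hkeep : ∀ r, r ∉ stateRegs L e → (∀ k, r ≠ Reg.work k) → t r = s r := hn
  refine ⟨t, hE, ?_, hv _ (mem_stateRegs.2 (by simp)), fun x => ?_, fun x => ?_, fun l => ?_⟩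
  · have h1 : (readState e t).flux = (F s).flux := by
      funext x i
      exact (hv _ (mem_stateRegs.2 (Or.inl ⟨x, i, rfl⟩))).trans
        (by simp [stateValue, he.extend_apply])
    have h2 : (readState e t).dual = (F s).dual := by
      funext x i
      exact (hv _ (mem_stateRegs.2 (Or.inr (Or.inl ⟨x, i, rfl⟩)))).trans
        (by simp [stateValue, he.extend_apply])
    have h3 : (readState e t).bar = (F s).bar := by
      funext x i
      exact (hv _ (mem_stateRegs.2 (Or.inr (Or.inr (Or.inl ⟨x, i, rfl⟩))))).trans
        (by simp [stateValue, he.extend_apply])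
    cases hF : F s
    rw [hF] at h1 h2 h3
    cases hR : readState e t
    rw [hR] at h1 h2 h3
    simp_all
  · exact hkeep _ (by simp [mem_stateRegs]) (by simp)
  · exact hkeep _ (by simp [mem_stateRegs]) (by simp)
  · exact hkeep _ (by simp [mem_stateRegs]) (by simp)

theorem stateComps_readState_subset (e : Grid d N' → Grid d N) :
    stateComps (readState (L := L) e) ⊆ registerValues d N L := by
  rintro _ ((⟨⟨x, i⟩, rfl⟩ | ⟨⟨x, i⟩, rfl⟩) | ⟨⟨x, i⟩, rfl⟩)
  · exact ⟨.flux (e x) i, by simp, rfl⟩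
  · exact ⟨.dual (e x) i, by simp, rfl⟩
  · exact ⟨.bar (e x) i, by simp, rfl⟩

theorem computes_readRhs (e : Grid d N' → Grid d N) :
    Computes (registerValues d N L) ((N' + 1) ^ d) (comps (readRhs (L := L) e)) := by
  refine (Computes.comps (c := 1) fun x => ?_).le (by simp)
  have h0 : (fun s : Reg d N L → ℝ => s (.rho0 (e x))) ∈ registerValues d N L :=
    ⟨.rho0 (e x), by simp, rfl⟩
  have h1 : (fun s : Reg d N L → ℝ => s (.rho1 (e x))) ∈ registerValues d N L :=
    ⟨.rho1 (e x), by simp, rfl⟩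
  exact (Computes.var h0).sub (.var h1)

/-- A program for one iteration, which also computes the residual of this iteration. -/
theorem exists_step_prog {e : Grid d N' → Grid d N} (he : Function.Injective e)
    {q : (Fin d → ℝ) → Fin d → ℝ} {g : ℕ} (hg : MapCost q g) :
    ∃ (P : Prog (Reg d N L)) (c : ℕ), c ≤ stepCost d N' g + (N' + 1) ^ d * (6 * d + 3) ∧
      ∀ s, ∃ t, Exec P s t c ∧ readState e t = explicitStep q (readRhs e s) (readState e s) ∧
        t .res = residual (readState e s) (explicitStep q (readRhs e s) (readState e s)) ∧
        SameInput s t := by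
  have h := (computes_readRhs (L := L) e).trans (Computes.explicitStep_residual hg
    (known_union_comps _ _) ((stateComps_readState_subset e).trans Set.subset_union_left))
  obtain ⟨P, c, hc, hP⟩ := exists_state_prog he _ _ h
  have : 1 ≤ (N' + 1) ^ d := Nat.one_le_pow _ _ (by omega)
  exact ⟨P, c, hc.trans (by generalize (N' + 1) ^ d = A at *; linarith), hP⟩

/-- The body of the iteration loop: one iteration, and the residual of the following one. In this
way the state in the registers is the output when the residual falls below the tolerance. -/
theorem exists_body_prog {e : Grid d N' → Grid d N} (he : Function.Injective e)
    {q : (Fin d → ℝ) → Fin d → ℝ} {g : ℕ} (hg : MapCost q g) :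
    ∃ (P : Prog (Reg d N L)) (c : ℕ), c ≤ 2 * stepCost d N' g + (N' + 1) ^ d * (6 * d + 3) ∧
      ∀ s, ∃ t, Exec P s t c ∧ readState e t = explicitStep q (readRhs e s) (readState e s) ∧
        t .res = residual (explicitStep q (readRhs e s) (readState e s))
          (explicitStep q (readRhs e s) (explicitStep q (readRhs e s) (readState e s))) ∧
        SameInput s t := by
  have h1 := computes_readRhs (L := L) e
  have h2 := Computes.explicitStep_residual hg
    (known_union_comps (registerValues d N L) (readRhs e))
    ((stateComps_readState_subset e).trans Set.subset_union_left)
  have h3 := Computes.explicitStep_residual hg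
    ((known_union_comps (registerValues d N L) (readRhs e)).mono Set.subset_union_left)
    ((Set.subset_union_left.trans Set.subset_union_right) :
      stateComps (fun s => explicitStep q (readRhs e s) (readState e s)) ⊆
      (registerValues d N L ∪ comps (readRhs e)) ∪
        (stateComps (fun s => explicitStep q (readRhs e s) (readState e s)) ∪
        {fun s => residual (readState e s) (explicitStep q (readRhs e s) (readState e s))}))
  have h := h1.trans (h2.trans_union h3)
  obtain ⟨P, c, hc, hP⟩ := exists_state_prog he
    (fun s => explicitStep q (readRhs e s) (readState e s))
    (fun s => residual (explicitStep q (readRhs e s) (readState e s))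
          (explicitStep q (readRhs e s) (explicitStep q (readRhs e s) (readState e s))))
    (h.mono subset_rfl (by
      rintro f (hf | hf)
      · exact Or.inl (Or.inl hf)
      · exact Or.inr (Or.inr hf)) le_rfl)
  have : 1 ≤ (N' + 1) ^ d := Nat.one_le_pow _ _ (by omega)
  exact ⟨P, c, hc.trans (by generalize (N' + 1) ^ d = A at *; linarith), hP⟩

/-- A program for the interpolation from the nodes `e x` to the nodes `e' x`. -/
theorem exists_interp_prog {M' : ℕ} (e : Grid d N' → Grid d N) {e' : Grid d M' → Grid d N}
    (he' : Function.Injective e') :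
    ∃ (P : Prog (Reg d N L)) (c : ℕ), c ≤ (M' + 1) ^ d * (d * (2 * 2 ^ d + 12) + 3) ∧
      ∀ s, ∃ t, Exec P s t c ∧ readState e' t = ⟨interp M' (readState e s).flux,
        interp M' (readState e s).dual, interp M' (readState e s).dual⟩ ∧ SameInput s t := by
  have hs := stateComps_readState_subset (L := L) e
  have h1 := Computes.interp (M := M') (knownField_of_subset
    ((Set.subset_union_left.trans Set.subset_union_left).trans hs))
  have h2 := Computes.interp (M := M') (knownField_of_subset
    ((Set.subset_union_right.trans Set.subset_union_left).trans hs))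
  obtain ⟨P, c, hc, hP⟩ := exists_state_prog he'
    (fun s => ⟨interp M' (readState e s).flux, interp M' (readState e s).dual,
      interp M' (readState e s).dual⟩) (fun _ => 0)
    (((h1.union h2).union (.const 0)).mono subset_rfl (by
      rintro f (((hf | hf) | hf) | hf)
      · exact Or.inl (Or.inl hf)
      · exact Or.inl (Or.inr hf)
      · exact Or.inl (Or.inr hf)
      · exact Or.inr hf) le_rfl)
  have : 1 ≤ (M' + 1) ^ d := Nat.one_le_pow _ _ (by omega)
  refine ⟨P, c, hc.trans (by generalize (M' + 1) ^ d = A at *; linarith), fun s => ?_⟩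
  obtain ⟨t, hE, hst, -, hin⟩ := hP s
  exact ⟨t, hE, hst, hin⟩

/-- A program for the potential. -/
theorem exists_potential_prog (d N L : ℕ) :
    ∃ (P : Prog (Reg d N L)) (c : ℕ), c ≤ poissonCost d N + (N + 1) ^ d * (5 * d + 3) ∧
      ∀ s, ∃ t, Exec P s t c ∧ (∀ x, t (.pot x) = poisson (divh fun y i => s (.dual y i)) x) ∧
        (∀ x i, t (.flux x i) = s (.flux x i)) ∧ ∀ x i, t (.dual x i) = s (.dual x i) := by
  classical
  have hk : KnownField (registerValues d N L) fun s y i => s (.dual y i) :=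
    fun y i => ⟨.dual y i, by simp, rfl⟩
  have h1 : Computes (registerValues d N L) ((N + 1) ^ d * (d * 5 + 1))
      (comps fun s => divh fun y i => s (.dual y i)) :=
    (Computes.comps fun x => Computes.divh hk x).le (by simp)
  have h2 := h1.trans (Computes.poisson _ (known_union_comps _ _))
  obtain ⟨P, c, hc, hP⟩ := Computes.exists_prog (work_injective (d := d) (N := N) (L := L))
    (Finset.univ.image fun x : Grid d N => Reg.pot x) (by simp)
    (fun r s => match r with
      | .pot x => poisson (divh fun y i => s (.dual y i)) x
      | _ => 0) (h2.mono subset_rfl (by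
        rintro _ ⟨r, hr, rfl⟩
        simp only [Finset.mem_image, Finset.mem_univ, true_and] at hr
        obtain ⟨x, rfl⟩ := hr
        exact ⟨x, rfl⟩) le_rfl)
  have hcard : (Finset.univ.image fun x : Grid d N => (Reg.pot x : Reg d N L)).card ≤ (N + 1) ^ d :=
    Finset.card_image_le.trans (by simp)
  refine ⟨P, c, hc.trans (by ring_nf at hcard ⊢; omega), fun s => ?_⟩
  obtain ⟨t, hE, hv, hn⟩ := hP s
  exact ⟨t, hE, fun x => hv _ (by simp), fun x i => hn _ (by simp) (by simp),
    fun x i => hn _ (by simp) (by simp)⟩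

theorem isPotential_poisson {M : ℕ} (hM : 1 ≤ M) (φ : Field d M) :
    IsPotential φ (poisson (divh φ)) :=
  ⟨adj (poisson (divh φ)), vInner_adj hM _, divh_adj_poisson hM _ (sum_divh hM φ)⟩

/-- Execution of a loop whose condition fails after each of the first passes. -/
theorem Exec.untilLt_of_seq {ι : Type} {P : Prog ι} {a b : ι} {c : ℕ} (K : ℕ) :
    ∀ u : ℕ → ι → ℝ, (∀ k ≤ K, Exec P (u k) (u (k + 1)) c) →
      (∀ k < K, ¬ u (k + 1) a < u (k + 1) b) → u (K + 1) a < u (K + 1) b →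
      Exec (.untilLt P a b) (u 0) (u (K + 1)) ((K + 1) * (c + 1)) := by
  induction K with
  | zero => intro u hE _ hlt; simpa using Exec.untilStop (hE 0 le_rfl) hlt
  | succ K ih =>
    intro u hE hn hlt
    have h := Exec.untilLoop (hE 0 (Nat.zero_le _)) (hn 0 (Nat.succ_pos _))
      (ih (fun k => u (k + 1)) (fun k hk => hE (k + 1) (by omega))
        (fun k hk => hn (k + 1) (by omega)) hlt)
    have e : c + 1 + (K + 1) * (c + 1) = (K + 1 + 1) * (c + 1) := by ring
    rwa [e] at h

/-- A program for the single-level algorithm on the grid with step `1/N'`; the initial residual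
exceeds the tolerance, so that at least one iteration is to be made. -/
theorem exists_loop_prog {p : ℝ≥0∞} [Fact (1 ≤ p)] {e : Grid d N' → Grid d N}
    (he : Function.Injective e) (hN' : 1 ≤ N') {q : (Fin d → ℝ) → Fin d → ℝ}
    (hq : IsDualProj p q) {g : ℕ} (hg : MapCost q g) (l : Fin L) :
    ∃ (P : Prog (Reg d N L)) (c : ℕ), c ≤ 2 * stepCost d N' g + (N' + 1) ^ d * (6 * d + 4) ∧
      ∀ s y, Feasible (readRhs e s) → readState e s = ⟨y.1, y.2, y.2⟩ →
        Stops p (readRhs e s) y (s (.tol l)) → s (.tol l) ≤ resid p (readRhs e s) y 0 →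
        ∃ t, Exec P s t (stopIter p (readRhs e s) y (s (.tol l)) * c) ∧
          readState e t = iter p (readRhs e s) y (stopIter p (readRhs e s) y (s (.tol l))) ∧
          SameInput s t := by
  obtain ⟨P, c, hc, hP⟩ := exists_body_prog (L := L) he hg
  refine ⟨.untilLt P .res (.tol l), c + 1, ?_, fun s y hf hy hst h0 => ?_⟩
  · have : 1 ≤ (N' + 1) ^ d := Nat.one_le_pow _ _ (by omega)
    generalize (N' + 1) ^ d = A at *
    linarith
  choose Φ hΦ using hP
  set ρ := readRhs e s with hρ
  set ε := s (.tol l) with hε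
  let u : ℕ → Reg d N L → ℝ := fun k => Φ^[k] s
  have hu : ∀ k, u (k + 1) = Φ (u k) := fun k => Function.iterate_succ_apply' _ _ _
  have hin : ∀ k, SameInput s (u k) := by
    intro k
    induction k with
    | zero => exact ⟨fun _ => rfl, fun _ => rfl, fun _ => rfl⟩
    | succ k ih => rw [hu]; exact ih.trans (hΦ (u k)).2.2.2
  have hstate : ∀ k, readState e (u k) = iter p ρ y k := by
    intro k
    induction k with
    | zero => exact hy
    | succ k ih =>
      rw [hu, (hΦ (u k)).2.1, ih, (hin k).readRhs_eq, ← hρ, ← pdStep_eq hq hN' hf]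
      rfl
  have hres : ∀ k, u (k + 1) .res = resid p ρ y (k + 1) := by
    intro k
    have h := (hΦ (u k)).2.2.1
    rw [hstate, (hin k).readRhs_eq, ← hρ, ← pdStep_eq hq hN' hf, ← pdStep_eq hq hN' hf] at h
    rw [hu, h]
    rfl
  have hK0 : stopIter p ρ y ε ≠ 0 := by
    intro h
    have hmem : resid p ρ y (stopIter p ρ y ε) < ε := Nat.sInf_mem hst
    rw [h] at hmem
    exact absurd hmem (not_lt.2 h0)
  obtain ⟨k, hk⟩ := Nat.exists_eq_succ_of_ne_zero hK0
  refine ⟨u (stopIter p ρ y ε), ?_, hstate _, hin _⟩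
  rw [hk]
  refine Exec.untilLt_of_seq k u (fun j _ => ?_) (fun j hj => ?_) ?_
  · rw [hu]; exact (hΦ (u j)).1
  · rw [hres, (hin _).2.2 l]
    intro hlt
    have : stopIter p ρ y ε ≤ j + 1 := Nat.sInf_le hlt
    omega
  · rw [hres, (hin _).2.2 l]
    have hmem : resid p ρ y (stopIter p ρ y ε) < ε := Nat.sInf_mem hst
    rw [hk] at hmem
    exact hmem

end Programs

/-! ### The multilevel program -/

section Multilevel

variable {d : ℕ}

/-- The node with the same position on the finest grid. -/
def levelEmb {n j : ℕ} (hj : j ≤ n) (x : Grid d (2 ^ j)) : Grid d (2 ^ n) := fun i =>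
  ⟨2 ^ (n - j) * (x i : ℕ), by
    have h1 : (x i : ℕ) ≤ 2 ^ j := Nat.lt_succ_iff.1 (x i).isLt
    have h2 : 2 ^ (n - j) * 2 ^ j = 2 ^ n := by rw [← pow_add, Nat.sub_add_cancel hj]
    have h3 := Nat.mul_le_mul_left (2 ^ (n - j)) h1
    omega⟩

theorem levelEmb_injective {n j : ℕ} (hj : j ≤ n) :
    Function.Injective (levelEmb (d := d) hj) := by
  intro x y h
  funext i
  have h1 := congrArg Fin.val (congrFun h i)
  exact Fin.ext (Nat.eq_of_mul_eq_mul_left (by positivity) h1)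

theorem levelEmb_self (n : ℕ) (x : Grid d (2 ^ n)) : levelEmb le_rfl x = x := by
  funext i; ext; simp [levelEmb]

theorem sample_levelEmb {n j : ℕ} (hj : j ≤ n) (ρ : (Fin d → ℝ) → ℝ) (x : Grid d (2 ^ j)) :
    sample ρ (2 ^ n) (levelEmb hj x) = sample ρ (2 ^ j) x := by
  unfold sample
  congr 1
  funext i
  have h2 : (2 : ℝ) ^ n = 2 ^ (n - j) * 2 ^ j := by rw [← pow_add, Nat.sub_add_cancel hj]
  simp only [levelEmb, gridStep]
  push_cast
  rw [h2]
  field_simp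

theorem readRhs_levelEmb {n j L : ℕ} (hj : j ≤ n) {ρ₀ ρ₁ : (Fin d → ℝ) → ℝ}
    {s : Reg d (2 ^ n) L → ℝ} (h0 : ∀ x, s (.rho0 x) = sample ρ₀ (2 ^ n) x)
    (h1 : ∀ x, s (.rho1 x) = sample ρ₁ (2 ^ n) x) :
    readRhs (levelEmb hj) s = rhs ρ₀ ρ₁ (2 ^ j) := by
  funext x
  simp [readRhs, rhs, h0, h1, sample_levelEmb]

/-- A bound for the number of operations of one pass through the iteration loop. -/
def loopCost (d N g : ℕ) : ℕ := 2 * stepCost d N g + (N + 1) ^ d * (6 * d + 4)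

/-- A bound for the number of operations of the interpolation. -/
def interpCost (d N : ℕ) : ℕ := (N + 1) ^ d * (d * (2 * 2 ^ d + 12) + 3)

/-- A program for the first levels of the multilevel algorithm. Every level keeps its fields in
the registers of its own nodes. -/
theorem exists_levels_prog {p : ℝ≥0∞} [Fact (1 ≤ p)] {q : (Fin d → ℝ) → Fin d → ℝ}
    (hq : IsDualProj p q) {g : ℕ} (hg : MapCost q g) (n j : ℕ) (hj : j ≤ n) :
    ∃ P : Prog (Reg d (2 ^ n) (n + 1)),
      ∀ (ρ₀ ρ₁ : (Fin d → ℝ) → ℝ) (ε : ℕ → ℝ) (s : Reg d (2 ^ n) (n + 1) → ℝ),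
        (∀ x, s (.rho0 x) = sample ρ₀ (2 ^ n) x) → (∀ x, s (.rho1 x) = sample ρ₁ (2 ^ n) x) →
        (∀ l, s (.tol l) = ε l) →
        readState (levelEmb (Nat.zero_le n)) s = ⟨0, 0, 0⟩ →
        (∀ i ≤ j, Feasible (d := d) (rhs ρ₀ ρ₁ (2 ^ i)) ∧
          Stops p (rhs ρ₀ ρ₁ (2 ^ i)) (levelStart p ρ₀ ρ₁ ε i) (ε i) ∧
          ε i ≤ resid p (rhs ρ₀ ρ₁ (2 ^ i)) (levelStart p ρ₀ ρ₁ ε i) 0) →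
        ∃ t c, Exec P s t c ∧
          c ≤ ∑ i ∈ Finset.range (j + 1),
            (stopIter p (rhs ρ₀ ρ₁ (2 ^ i)) (levelStart p ρ₀ ρ₁ ε i) (ε i) *
              loopCost d (2 ^ i) g + interpCost d (2 ^ i)) ∧
          readState (levelEmb hj) t = iter p (rhs ρ₀ ρ₁ (2 ^ j)) (levelStart p ρ₀ ρ₁ ε j)
            (stopIter p (rhs ρ₀ ρ₁ (2 ^ j)) (levelStart p ρ₀ ρ₁ ε j) (ε j)) ∧
          SameInput s t := by
  induction j with
  | zero =>
    obtain ⟨P, c, hc, hP⟩ := exists_loop_prog (L := n + 1) (levelEmb_injective hj)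
      Nat.one_le_two_pow hq hg ⟨0, by omega⟩
    refine ⟨P, fun ρ₀ ρ₁ ε s h0 h1 hε hs hcond => ?_⟩
    obtain ⟨hf, hst, hr⟩ := hcond 0 le_rfl
    have h := hP s (levelStart p ρ₀ ρ₁ ε 0)
    rw [readRhs_levelEmb hj h0 h1, hε] at h
    obtain ⟨t, hE, hrd, hin⟩ := h hf hs hst hr
    refine ⟨t, _, hE, ?_, hrd, hin⟩
    rw [Finset.sum_range_one]
    exact (Nat.mul_le_mul_left _ hc).trans (Nat.le_add_right _ _)
  | succ j ih =>
    obtain ⟨P, hP⟩ := ih (by omega)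
    obtain ⟨Q, cQ, hcQ, hQ⟩ := exists_interp_prog (L := n + 1)
      (levelEmb (d := d) (show j ≤ n by omega)) (levelEmb_injective hj)
    obtain ⟨R, cR, hcR, hR⟩ := exists_loop_prog (L := n + 1) (levelEmb_injective hj)
      Nat.one_le_two_pow hq hg ⟨j + 1, by omega⟩
    refine ⟨.seq (.seq P Q) R, fun ρ₀ ρ₁ ε s h0 h1 hε hs hcond => ?_⟩
    obtain ⟨t, c, hE, hc, hrd, hin⟩ := hP ρ₀ ρ₁ ε s h0 h1 hε hs
      fun i hi => hcond i (by omega)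
    obtain ⟨t', hE', hrd', hin'⟩ := hQ t
    have hin2 := hin.trans hin'
    obtain ⟨hf, hst, hr⟩ := hcond (j + 1) le_rfl
    have h := hR t' (levelStart p ρ₀ ρ₁ ε (j + 1))
    rw [readRhs_levelEmb hj (fun x => (hin2.1 x).trans (h0 x))
      (fun x => (hin2.2.1 x).trans (h1 x)), hin2.2.2, hε] at h
    rw [hrd] at hrd'
    obtain ⟨t'', hE'', hrd'', hin''⟩ := h hf hrd' hst hr
    refine ⟨t'', _, .seq (.seq hE hE') hE'', ?_, hrd'', hin2.trans hin''⟩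
    rw [Finset.sum_range_succ]
    have h3 := Nat.mul_le_mul_left (stopIter p (rhs ρ₀ ρ₁ (2 ^ (j + 1)))
      (levelStart p ρ₀ ρ₁ ε (j + 1)) (ε (j + 1))) hcR
    have h4 : cQ ≤ interpCost d (2 ^ (j + 1)) := hcQ
    unfold loopCost at *
    change _ ≤ _ + (stopIter p (rhs ρ₀ ρ₁ (2 ^ (j + 1)))
      (levelStart p ρ₀ ρ₁ ε (j + 1)) (ε (j + 1)) * _ + _)
    simp only at h3 ⊢
    omega

end Multilevel

/-! ### Asymptotic bounds -/

section Asymptotics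

theorem dctCost_le {n : ℕ} (hn : 2 ≤ n) : (dctCost n : ℝ) ≤ 600 * (n * Real.log n) := by
  set k := Nat.clog 2 (2 * n) with hk
  have hn' : (2 : ℝ) ≤ n := by exact_mod_cast hn
  have hlog2 : (0.69 : ℝ) < Real.log 2 := by linarith [Real.log_two_gt_d9]
  have hlog : Real.log 2 ≤ Real.log n := Real.log_le_log two_pos hn'
  have hk1 : 2 ^ k ≤ 4 * n := by
    have h1 : 2 ^ (k - 1) < 2 * n := Nat.pow_pred_clog_lt_self one_lt_two (by omega)
    have h2 : 0 < k := Nat.clog_pos one_lt_two (by omega)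
    have h3 : 2 ^ k = 2 * 2 ^ (k - 1) := by rw [← pow_succ']; congr 1; omega
    omega
  have hk2 : (2 : ℝ) ^ k ≤ 4 * n := by exact_mod_cast hk1
  have hk3 : (k : ℝ) ≤ 5 * Real.log n := by
    have h1 : k * Real.log 2 ≤ Real.log (4 * n) := by
      rw [← Real.log_pow]; exact Real.log_le_log (by positivity) hk2
    have h2 : Real.log (4 * n) = 2 * Real.log 2 + Real.log n := by
      rw [Real.log_mul (by norm_num) (by linarith), show (4 : ℝ) = 2 ^ 2 by norm_num, Real.log_pow]
      norm_num
    have h3 : (k : ℝ) * 0.69 ≤ k * Real.log 2 := mul_le_mul_of_nonneg_left hlog2.le (by positivity)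
    linarith
  have h1 : (k : ℝ) * 2 ^ k ≤ 5 * Real.log n * (4 * n) :=
    mul_le_mul hk3 hk2 (by positivity) (by linarith)
  have h2 : (n : ℝ) * 0.69 ≤ n * Real.log n := mul_le_mul_of_nonneg_left (by linarith) (by linarith)
  have h3 : (dctCost n : ℝ) = 24 * (k * 2 ^ k) + 12 * 2 ^ k + 1 + 9 * n := by
    unfold dctCost; push_cast; rfl
  rw [h3]
  linarith

/-- The grid has at most `2 N^d` nodes if `N ≥ 2 d`, by Bernoulli's inequality. -/
theorem succ_pow_le {d N : ℕ} (hN : 2 * d ≤ N) : ((N : ℝ) + 1) ^ d ≤ 2 * (N : ℝ) ^ d := by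
  have h1 : (0 : ℝ) < (N : ℝ) + 1 := by positivity
  have h2 := one_add_mul_le_pow (a := -1 / ((N : ℝ) + 1)) (by
    rw [le_div_iff₀ h1]; linarith [(Nat.cast_nonneg N : (0 : ℝ) ≤ N)]) d
  have h3 : (1 : ℝ) + -1 / ((N : ℝ) + 1) = N / (N + 1) := by field_simp; ring
  have h4 : (1 : ℝ) / 2 ≤ 1 + d * (-1 / ((N : ℝ) + 1)) := by
    have : (d : ℝ) * (-1 / ((N : ℝ) + 1)) = -(d / ((N : ℝ) + 1)) := by ring
    rw [this]
    have h5 : (d : ℝ) / ((N : ℝ) + 1) ≤ 1 / 2 := by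
      have : (2 : ℝ) * d ≤ N := by exact_mod_cast hN
      rw [div_le_iff₀ h1]; linarith
    linarith
  have h5 := h4.trans h2
  rw [h3, div_pow, le_div_iff₀ (by positivity)] at h5
  linarith

/-- The cost of an iteration is that of a fast Fourier transform: the projections and the linear
operations, whose costs depend on `d` but not on `N` per node, are dominated for large `N`. -/
theorem exists_loopCost_le (d g : ℕ) (hd : 1 ≤ d) : ∃ N₀ : ℕ, 1 ≤ N₀ ∧ ∀ N, N₀ ≤ N →
    (loopCost d N g : ℝ) ≤ 10000 * (d * (N : ℝ) ^ d * Real.log N) := by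
  have hlim := Real.tendsto_log_atTop.comp tendsto_natCast_atTop_atTop
  obtain ⟨N₁, hN₁⟩ := Filter.eventually_atTop.1
    (hlim.eventually_ge_atTop ((78 * d + 2 * g + 46 : ℕ) : ℝ))
  refine ⟨max N₁ (2 * d + 2), by omega, fun N hN => ?_⟩
  have h1 : ((78 * d + 2 * g + 46 : ℕ) : ℝ) ≤ Real.log N := hN₁ N (by omega)
  have h2 := succ_pow_le (d := d) (N := N) (by omega)
  have hN2 : (2 : ℝ) ≤ N := by exact_mod_cast (show 2 ≤ N by omega)
  have h3 := dctCost_le (n := N + 1) (by omega)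
  have hlogN : Real.log ((N + 1 : ℕ) : ℝ) ≤ 2 * Real.log N := by
    have : Real.log ((N : ℝ) ^ 2) = 2 * Real.log N := by rw [Real.log_pow]; norm_num
    rw [← this]
    refine Real.log_le_log (by positivity) ?_
    push_cast
    nlinarith
  have hl0 : 0 ≤ Real.log N := Real.log_nonneg (by linarith)
  have e : (loopCost d N g : ℝ) = 4 * (d * (((N : ℝ) + 1) ^ (d - 1) * dctCost (N + 1))) +
      ((N : ℝ) + 1) ^ d * ((78 * d + 2 * g + 46 : ℕ) : ℝ) := by
    unfold loopCost stepCost poissonCost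
    push_cast
    ring
  have hd' : (1 : ℝ) ≤ d := by exact_mod_cast hd
  have h4 : ((N : ℝ) + 1) ^ (d - 1) * dctCost (N + 1) ≤ 2400 * ((N : ℝ) ^ d * Real.log N) := by
    calc ((N : ℝ) + 1) ^ (d - 1) * dctCost (N + 1)
        ≤ ((N : ℝ) + 1) ^ (d - 1) * (600 * (((N + 1 : ℕ) : ℝ) * (2 * Real.log N))) := by
          refine mul_le_mul_of_nonneg_left (h3.trans ?_) (by positivity)
          exact mul_le_mul_of_nonneg_left (mul_le_mul_of_nonneg_left hlogN (by positivity))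
            (by norm_num)
      _ = ((N : ℝ) + 1) ^ d * (1200 * Real.log N) := by
          obtain ⟨k, rfl⟩ := Nat.exists_eq_add_of_le' hd
          push_cast
          ring
      _ ≤ (2 * (N : ℝ) ^ d) * (1200 * Real.log N) :=
          mul_le_mul_of_nonneg_right h2 (by positivity)
      _ = _ := by ring
  have h5 : ((N : ℝ) + 1) ^ d * ((78 * d + 2 * g + 46 : ℕ) : ℝ) ≤ 2 * (N : ℝ) ^ d * Real.log N :=
    mul_le_mul h2 h1 (by positivity) (by positivity)
  have h6 : (N : ℝ) ^ d * Real.log N ≤ d * ((N : ℝ) ^ d * Real.log N) :=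
    le_mul_of_one_le_left (by positivity) hd'
  have h7 := mul_le_mul_of_nonneg_left h4 (show (0 : ℝ) ≤ d by linarith)
  rw [e]
  have h8 : 0 ≤ (d : ℝ) * ((N : ℝ) ^ d * Real.log N) := by positivity
  linarith

/-- The total cost of the interpolations is that of the finest level. -/
theorem exists_sum_interpCost_le (d : ℕ) (hd : 1 ≤ d) : ∃ n₀ : ℕ, ∀ n, n₀ ≤ n →
    ((∑ j ∈ Finset.range (n + 1), interpCost d (2 ^ j) : ℕ) : ℝ) ≤
      50 * (d * 2 ^ d * ((2 : ℝ) ^ n) ^ d) := by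
  set B : ℕ := (2 * d + 1) ^ d with hB
  have hlim : Filter.Tendsto (fun n : ℕ => ((n : ℝ) ^ 1 / (2 : ℝ) ^ n)) Filter.atTop (nhds 0) :=
    tendsto_pow_const_div_const_pow_of_one_lt 1 one_lt_two
  obtain ⟨n₁, hn₁⟩ := Filter.eventually_atTop.1
    (hlim.eventually_lt_const (show (0 : ℝ) < 1 / (2 * B) by positivity))
  refine ⟨max n₁ 1, fun n hn => ?_⟩
  have h1 : ∀ j : ℕ, ((2 : ℝ) ^ j + 1) ^ d ≤ 2 * ((2 : ℝ) ^ j) ^ d + B := by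
    intro j
    by_cases hj : 2 * d ≤ 2 ^ j
    · have := succ_pow_le hj
      push_cast at this
      have hB0 : (0 : ℝ) ≤ B := by positivity
      linarith
    · have h2 : ((2 : ℝ) ^ j + 1) ^ d ≤ B := by
        rw [hB]; push_cast
        refine pow_le_pow_left₀ (by positivity) ?_ d
        have : (2 : ℝ) ^ j ≤ 2 * d := by exact_mod_cast (not_le.1 hj).le
        linarith
      have : (0 : ℝ) ≤ 2 * ((2 : ℝ) ^ j) ^ d := by positivity
      linarith
  have hc : ((d * (2 * 2 ^ d + 12) + 3 : ℕ) : ℝ) ≤ 10 * (d * 2 ^ d) := by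
    have h2 : 2 ≤ 2 ^ d := by
      calc 2 = 2 ^ 1 := rfl
        _ ≤ 2 ^ d := Nat.pow_le_pow_right two_pos hd
    have : d * (2 * 2 ^ d + 12) + 3 ≤ 10 * (d * 2 ^ d) := by nlinarith
    exact_mod_cast this
  have hgeo : ∀ m : ℕ, ∑ j ∈ Finset.range (m + 1), ((2 : ℝ) ^ j) ^ d ≤ 2 * ((2 : ℝ) ^ m) ^ d := by
    intro m
    induction m with
    | zero => simp
    | succ m ih =>
      rw [Finset.sum_range_succ]
      have : 2 * ((2 : ℝ) ^ m) ^ d ≤ ((2 : ℝ) ^ (m + 1)) ^ d := by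
        rw [pow_succ, mul_pow, mul_comm]
        refine mul_le_mul_of_nonneg_left ?_ (by positivity)
        calc (2 : ℝ) = 2 ^ 1 := by norm_num
          _ ≤ 2 ^ d := pow_le_pow_right₀ one_le_two hd
      linarith
  have hnB : ((n : ℝ) + 1) * B ≤ ((2 : ℝ) ^ n) ^ d := by
    have h2 := hn₁ n (by omega)
    rw [pow_one, div_lt_div_iff₀ (by positivity) (by positivity)] at h2
    have h3 : (1 : ℝ) ≤ n := by exact_mod_cast (show 1 ≤ n by omega)
    have h4 : (2 : ℝ) ^ n ≤ ((2 : ℝ) ^ n) ^ d :=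
      le_self_pow₀ (one_le_pow₀ one_le_two) (by omega)
    have hB0 : (0 : ℝ) ≤ B := by positivity
    nlinarith
  calc ((∑ j ∈ Finset.range (n + 1), interpCost d (2 ^ j) : ℕ) : ℝ)
      = ∑ j ∈ Finset.range (n + 1), ((2 : ℝ) ^ j + 1) ^ d *
          ((d * (2 * 2 ^ d + 12) + 3 : ℕ) : ℝ) := by
        unfold interpCost; push_cast; rfl
    _ ≤ ∑ j ∈ Finset.range (n + 1), (2 * ((2 : ℝ) ^ j) ^ d + B) * (10 * (d * 2 ^ d)) :=
        Finset.sum_le_sum fun j _ => mul_le_mul (h1 j) hc (by positivity) (by positivity)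
    _ = (2 * ∑ j ∈ Finset.range (n + 1), ((2 : ℝ) ^ j) ^ d + ((n : ℝ) + 1) * B) *
          (10 * (d * 2 ^ d)) := by
        rw [← Finset.sum_mul, Finset.sum_add_distrib, ← Finset.mul_sum]
        simp
    _ ≤ (5 * ((2 : ℝ) ^ n) ^ d) * (10 * (d * 2 ^ d)) := by
        refine mul_le_mul_of_nonneg_right ?_ (by positivity)
        linarith [hgeo n]
    _ = _ := by ring

/-- The exponents `α - ν + d`, `d ∈ ℕ`, are bounded away from zero unless they vanish. -/
theorem exists_gap (α ν : ℝ) : ∃ γ : ℝ, 0 < γ ∧ ∀ d : ℕ,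
    (ν - d < α → γ ≤ α - ν + d) ∧ (α < ν - d → α - ν + d ≤ -γ) := by
  have h1 := Int.lt_floor_add_one (ν - α)
  have h2 := Int.ceil_lt_add_one (ν - α)
  refine ⟨min (⌊ν - α⌋ + 1 - (ν - α)) (ν - α - ⌈ν - α⌉ + 1), ?_,
    fun d => ⟨fun h => ?_, fun h => ?_⟩⟩
  · exact lt_min (by linarith) (by linarith)
  · have h3 : ⌊ν - α⌋ < (d : ℤ) := Int.floor_lt.2 (by push_cast; linarith)
    have h4 : ((⌊ν - α⌋ + 1 : ℤ) : ℝ) ≤ ((d : ℤ) : ℝ) := by exact_mod_cast h3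
    push_cast at h4
    exact (min_le_left _ _).trans (by linarith)
  · have h3 : (d : ℤ) < ⌈ν - α⌉ := Int.lt_ceil.2 (by push_cast; linarith)
    have h4 : (((d : ℤ) + 1 : ℤ) : ℝ) ≤ (⌈ν - α⌉ : ℝ) := by exact_mod_cast h3
    push_cast at h4
    have := min_le_right (⌊ν - α⌋ + 1 - (ν - α)) (ν - α - ⌈ν - α⌉ + 1)
    linarith

theorem geom_sum_le_of_one_lt {x x₀ : ℝ} (hx₀ : 1 < x₀) (hx : x₀ ≤ x) (n : ℕ) :
    ∑ j ∈ Finset.range (n + 1), x ^ j ≤ x₀ / (x₀ - 1) * x ^ n := by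
  have h0 : 0 < x₀ - 1 := by linarith
  induction n with
  | zero =>
    simp only [zero_add, Finset.range_one, Finset.sum_singleton, pow_zero, mul_one]
    rw [le_div_iff₀ h0]; linarith
  | succ n ih =>
    rw [Finset.sum_range_succ]
    have h1 : x₀ / (x₀ - 1) * x ^ (n + 1) - x ^ (n + 1) - x₀ / (x₀ - 1) * x ^ n =
        (x - x₀) / (x₀ - 1) * x ^ n := by field_simp; ring
    have h2 : 0 ≤ (x - x₀) / (x₀ - 1) * x ^ n := by
      have : 0 ≤ x - x₀ := by linarith
      have : 0 ≤ x := by linarith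
      positivity
    linarith

theorem geom_sum_le_of_lt_one {x x₀ : ℝ} (hx0 : 0 ≤ x) (hx : x ≤ x₀) (hx₀ : x₀ < 1) (n : ℕ) :
    ∑ j ∈ Finset.range (n + 1), x ^ j ≤ 1 / (1 - x₀) := by
  have h := mul_neg_geom_sum x (n + 1)
  have h1 : 0 ≤ x ^ (n + 1) := pow_nonneg hx0 _
  have h2 : 0 ≤ ∑ j ∈ Finset.range (n + 1), x ^ j := Finset.sum_nonneg fun _ _ => pow_nonneg hx0 _
  rw [le_div_iff₀ (by linarith)]
  nlinarith

/-- Summation of the costs of all levels. If `W j` is the cost of an iteration on level `j`, at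
most of the order of a fast Fourier transform on all but finitely many levels, and
`K j ≤ T 2^{-(n-j)α - jν}` the number of iterations, the total cost is governed by the geometric
sum `∑ 2^{j(α - ν + d)}`. The coarse levels contribute `2^{-nα}` times a constant that may depend
on `d`, and that the factor `n` absorbs. -/
theorem exists_sum_levels_le (α ν : ℝ) : ∃ A : ℝ, 0 < A ∧ ∀ d : ℕ, 1 ≤ d → ∀ (W : ℕ → ℝ) (j₀ : ℕ),
    (∀ j, 0 ≤ W j) →
    (∀ j, j₀ ≤ j → W j ≤ 10000 * (d * ((2 : ℝ) ^ j) ^ d * (j * Real.log 2))) →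
    ∃ n₀ : ℕ, 1 ≤ n₀ ∧ ∀ n, n₀ ≤ n → ∀ (T : ℝ) (K : ℕ → ℝ), 0 ≤ T →
      (∀ j ≤ n, K j ≤ T * (2 : ℝ) ^ (-(((n : ℝ) - j) * α) - j * ν)) →
      (ν - d < α → ∑ j ∈ Finset.range (n + 1), K j * W j ≤
        A * (T * (d * (2 : ℝ) ^ ((n : ℝ) * (d - ν)) * n))) ∧
      (α = ν - d → ∑ j ∈ Finset.range (n + 1), K j * W j ≤
        A * (T * (d * (2 : ℝ) ^ ((n : ℝ) * (d - ν)) * (n : ℝ) ^ 2))) ∧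
      (α < ν - d → ∑ j ∈ Finset.range (n + 1), K j * W j ≤
        A * (T * (d * (2 : ℝ) ^ (-((n : ℝ) * α)) * n))) := by
  obtain ⟨γ, hγ, hgap⟩ := exists_gap α ν
  set x₁ : ℝ := (2 : ℝ) ^ γ with hx₁
  set x₂ : ℝ := (2 : ℝ) ^ (-γ) with hx₂
  have hx₁1 : 1 < x₁ := Real.one_lt_rpow one_lt_two hγ
  have hx₂1 : x₂ < 1 := Real.rpow_lt_one_of_one_lt_of_neg one_lt_two (by linarith)
  have hA₁ : 0 < x₁ / (x₁ - 1) := div_pos (by linarith) (by linarith)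
  have hA₂ : 0 < 1 / (1 - x₂) := div_pos one_pos (by linarith)
  refine ⟨10000 * (x₁ / (x₁ - 1)) + 10000 * (1 / (1 - x₂)) + 20001, by positivity,
    fun d hd W j₀ hW0 hW => ?_⟩
  set B : ℝ := ∑ j ∈ Finset.range j₀, (2 : ℝ) ^ ((j : ℝ) * (α - ν)) * W j with hB
  obtain ⟨n₁, hn₁⟩ := exists_nat_ge B
  refine ⟨max n₁ 1, le_max_right _ _, fun n hn T K hT hK => ?_⟩
  have hnB : B ≤ n := hn₁.trans (by exact_mod_cast (le_max_left _ _).trans hn)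
  have hn1 : (1 : ℝ) ≤ n := by exact_mod_cast (le_max_right _ _).trans hn
  have hd' : (1 : ℝ) ≤ d := by exact_mod_cast hd
  set β : ℝ := α - ν + d with hβ
  set x : ℝ := (2 : ℝ) ^ β with hx
  have hx0 : 0 < x := Real.rpow_pos_of_pos two_pos _
  have hxj : ∀ j : ℕ, x ^ j = (2 : ℝ) ^ ((j : ℝ) * β) := fun j => by
    rw [hx, ← Real.rpow_natCast, ← Real.rpow_mul two_pos.le, mul_comm]
  have key : ∑ j ∈ Finset.range (n + 1), K j * W j ≤
      T * (2 : ℝ) ^ (-((n : ℝ) * α)) *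
        (d * n * (10000 * ∑ j ∈ Finset.range (n + 1), x ^ j + 1)) := by
    have hterm : ∀ j ∈ Finset.range (n + 1), K j * W j ≤ T * (2 : ℝ) ^ (-((n : ℝ) * α)) *
        (10000 * (d * n) * x ^ j + if j < j₀ then (2 : ℝ) ^ ((j : ℝ) * (α - ν)) * W j else 0) := by
      intro j hj
      have hjn : j ≤ n := by simpa [Nat.lt_succ_iff] using hj
      have hjn' : (j : ℝ) ≤ n := by exact_mod_cast hjn
      have e : (2 : ℝ) ^ (-(((n : ℝ) - j) * α) - j * ν) =
          (2 : ℝ) ^ (-((n : ℝ) * α)) * (2 : ℝ) ^ ((j : ℝ) * (α - ν)) := by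
        rw [← Real.rpow_add two_pos]; congr 1; ring
      have h1 := mul_le_mul_of_nonneg_right (hK j hjn) (hW0 j)
      rw [e] at h1
      refine h1.trans ?_
      rw [show T * ((2 : ℝ) ^ (-((n : ℝ) * α)) * (2 : ℝ) ^ ((j : ℝ) * (α - ν))) * W j =
        T * (2 : ℝ) ^ (-((n : ℝ) * α)) * ((2 : ℝ) ^ ((j : ℝ) * (α - ν)) * W j) by ring]
      refine mul_le_mul_of_nonneg_left ?_ (by positivity)
      by_cases hj₀ : j < j₀
      · rw [if_pos hj₀]
        have : 0 ≤ 10000 * ((d : ℝ) * n) * x ^ j := by positivity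
        linarith
      · rw [if_neg hj₀, add_zero]
        have hlog : Real.log 2 ≤ 1 := by linarith [Real.log_two_lt_d9]
        have h2 : W j ≤ 10000 * (d * ((2 : ℝ) ^ j) ^ d * n) := by
          refine (hW j (by omega)).trans ?_
          have : (j : ℝ) * Real.log 2 ≤ n :=
            (mul_le_of_le_one_right (by positivity) hlog).trans hjn'
          gcongr
        have h3 : (2 : ℝ) ^ ((j : ℝ) * (α - ν)) * ((2 : ℝ) ^ j) ^ d = x ^ j := by
          rw [hxj, ← pow_mul, ← Real.rpow_natCast, ← Real.rpow_add two_pos]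
          congr 1; rw [hβ]; push_cast; ring
        calc (2 : ℝ) ^ ((j : ℝ) * (α - ν)) * W j
            ≤ (2 : ℝ) ^ ((j : ℝ) * (α - ν)) * (10000 * (d * ((2 : ℝ) ^ j) ^ d * n)) :=
              mul_le_mul_of_nonneg_left h2 (by positivity)
          _ = 10000 * (d * n) * ((2 : ℝ) ^ ((j : ℝ) * (α - ν)) * ((2 : ℝ) ^ j) ^ d) := by ring
          _ = _ := by rw [h3]
    refine (Finset.sum_le_sum hterm).trans ?_
    rw [← Finset.mul_sum, Finset.sum_add_distrib, ← Finset.mul_sum]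
    refine mul_le_mul_of_nonneg_left ?_ (by positivity)
    have h4 : ∑ j ∈ Finset.range (n + 1),
        (if j < j₀ then (2 : ℝ) ^ ((j : ℝ) * (α - ν)) * W j else 0) ≤ B := by
      rw [← Finset.sum_filter, hB]
      refine Finset.sum_le_sum_of_subset_of_nonneg ?_ fun j _ _ =>
        mul_nonneg (by positivity) (hW0 j)
      intro j hj
      simpa using (Finset.mem_filter.1 hj).2
    have h5 : (n : ℝ) ≤ d * n := le_mul_of_one_le_left (by positivity) hd'
    linarith
  have hpos : 0 ≤ T * (2 : ℝ) ^ (-((n : ℝ) * α)) * (d * n) := by positivity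
  refine ⟨fun h => ?_, fun h => ?_, fun h => ?_⟩
  · have h1 : x₁ ≤ x := Real.rpow_le_rpow_of_exponent_le one_le_two ((hgap d).1 h)
    have h2 := geom_sum_le_of_one_lt hx₁1 h1 n
    have h3 : 1 ≤ x ^ n := one_le_pow₀ (by linarith)
    have e : (2 : ℝ) ^ ((n : ℝ) * (d - ν)) = (2 : ℝ) ^ (-((n : ℝ) * α)) * x ^ n := by
      rw [hxj, ← Real.rpow_add two_pos]; congr 1; rw [hβ]; ring
    have h4 : 10000 * ∑ j ∈ Finset.range (n + 1), x ^ j + 1 ≤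
        (10000 * (x₁ / (x₁ - 1)) + 10000 * (1 / (1 - x₂)) + 20001) * x ^ n := by
      have : 0 ≤ 10000 * (1 / (1 - x₂)) * x ^ n := by positivity
      linarith
    calc _ ≤ _ := key
      _ = T * (2 : ℝ) ^ (-((n : ℝ) * α)) * (d * n) *
          (10000 * ∑ j ∈ Finset.range (n + 1), x ^ j + 1) := by ring
      _ ≤ _ := mul_le_mul_of_nonneg_left h4 hpos
      _ = _ := by rw [e]; ring
  · have hβ0 : β = 0 := by rw [hβ]; linarith
    have hx1 : x = 1 := by rw [hx, hβ0, Real.rpow_zero]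
    have e : (2 : ℝ) ^ ((n : ℝ) * (d - ν)) = (2 : ℝ) ^ (-((n : ℝ) * α)) := by
      congr 1; rw [h]; ring
    have h4 : 10000 * ∑ j ∈ Finset.range (n + 1), x ^ j + 1 ≤
        (10000 * (x₁ / (x₁ - 1)) + 10000 * (1 / (1 - x₂)) + 20001) * n := by
      have h5 : 0 ≤ 10000 * (1 / (1 - x₂)) * n := by positivity
      have h6 : 0 ≤ 10000 * (x₁ / (x₁ - 1)) * n := by positivity
      simp only [hx1, one_pow, Finset.sum_const, Finset.card_range, nsmul_eq_mul, mul_one]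
      push_cast
      linarith
    calc _ ≤ _ := key
      _ = T * (2 : ℝ) ^ (-((n : ℝ) * α)) * (d * n) *
          (10000 * ∑ j ∈ Finset.range (n + 1), x ^ j + 1) := by ring
      _ ≤ _ := mul_le_mul_of_nonneg_left h4 hpos
      _ = _ := by rw [e]; ring
  · have h1 : x ≤ x₂ := Real.rpow_le_rpow_of_exponent_le one_le_two ((hgap d).2 h)
    have h2 := geom_sum_le_of_lt_one hx0.le h1 hx₂1 n
    calc _ ≤ _ := key
      _ = T * (2 : ℝ) ^ (-((n : ℝ) * α)) * (d * n) *
          (10000 * ∑ j ∈ Finset.range (n + 1), x ^ j + 1) := by ring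
      _ ≤ T * (2 : ℝ) ^ (-((n : ℝ) * α)) * (d * n) *
          (10000 * (x₁ / (x₁ - 1)) + 10000 * (1 / (1 - x₂)) + 20001) :=
        mul_le_mul_of_nonneg_left (by linarith) hpos
      _ = _ := by ring

end Asymptotics

/-! ### Cost of the algorithms -/

theorem feasible_of_solBounded {d N : ℕ} {p : ℝ≥0∞} [Fact (1 ≤ p)] {ρ : Scalar d N} {C : ℝ}
    (h : SolBounded p ρ C) : Feasible ρ :=
  ⟨_, (solSet_conditions h.1.some_mem).1⟩

theorem fact_one_le {p : ℝ≥0∞} (hp : p = 1 ∨ p = 2 ∨ p = ⊤) : Fact (1 ≤ p) := by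
  rcases hp with rfl | rfl | rfl
  · exact ⟨le_rfl⟩
  · exact ⟨one_le_two⟩
  · exact ⟨le_top⟩

theorem one_div_gridStep (N : ℕ) : 1 / gridStep N = N := by simp [gridStep]

theorem div_gridStep_pow (N d : ℕ) (r : ℝ) : r / gridStep N ^ d = r * (N : ℝ) ^ d := by
  simp [gridStep, div_eq_mul_inv]

theorem div_gridStep_rpow (n : ℕ) (r x : ℝ) :
    r / gridStep (2 ^ n) ^ x = r * (2 : ℝ) ^ ((n : ℝ) * x) := by
  rw [gridStep_two_pow_rpow, Real.rpow_neg two_pos.le, div_inv_eq_mul]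

theorem log_one_div_gridStep (n : ℕ) : Real.log (1 / gridStep (2 ^ n)) = n * Real.log 2 := by
  rw [one_div_gridStep, Nat.cast_pow, Real.log_pow]; simp

theorem tolerance_eq (εL α : ℝ) (n j : ℕ) :
    tolerance εL α n j = εL * (2 : ℝ) ^ (((n : ℝ) - j) * α) := by
  have h : ∀ k : ℕ, gridStep (2 ^ k) = (2 : ℝ) ^ (-(k : ℝ)) := fun k => by
    simpa using gridStep_two_pow_rpow k 1
  rw [tolerance, h, h, ← Real.rpow_sub two_pos, ← Real.rpow_mul two_pos.le]
  congr 2; ring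

/-- One iteration costs a fast Fourier transform; the constant is absolute. -/
theorem cost_one_iteration (p : ℝ≥0∞) (hp : p = 1 ∨ p = 2 ∨ p = ⊤) :
    ∃ P : (d N : ℕ) → Prog (Reg d N 1), ∃ C : ℝ,
      ∀ d : ℕ, 1 ≤ d → ∃ N₀ : ℕ, ∀ N : ℕ, N₀ ≤ N → ∀ ρ₀ ρ₁ : (Fin d → ℝ) → ℝ,
      (∃ m : Field d N, divh m = rhs ρ₀ ρ₁ N) → ∀ s : State d N, ∃ (t : Reg d N 1 → ℝ) (c : ℕ),
        Exec (P d N) (memory ρ₀ ρ₁ 0 s) t c ∧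
        Holds t ((pdStep p (rhs ρ₀ ρ₁ N) s).flux, (pdStep p (rhs ρ₀ ρ₁ N) s).dual) ∧
        (∀ x i, t (.bar x i) = (pdStep p (rhs ρ₀ ρ₁ N) s).bar x i) ∧
        t .res = residual s (pdStep p (rhs ρ₀ ρ₁ N) s) ∧
        (c : ℝ) ≤ C * (d / gridStep N ^ d * Real.log (1 / gridStep N)) := by
  have := fact_one_le hp
  choose q g hq hg using fun d => exists_dualProj hp d
  choose P c hc hP using fun d N => exists_step_prog (L := 1) (N := N)
    (Function.injective_id (α := Grid d N)) (hg d)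
  refine ⟨P, 10000, fun d hd => ?_⟩
  obtain ⟨N₀, hN₀, hW⟩ := exists_loopCost_le d (g d) hd
  refine ⟨N₀, fun N hN ρ₀ ρ₁ hρ s => ?_⟩
  obtain ⟨t, hE, hst, hres, -⟩ := hP d N (memory ρ₀ ρ₁ 0 s)
  change readState id t = explicitStep (q d) (rhs ρ₀ ρ₁ N) s at hst
  change t .res = residual s (explicitStep (q d) (rhs ρ₀ ρ₁ N) s) at hres
  rw [← pdStep_eq (hq d) (hN₀.trans hN) hρ] at hst hres
  refine ⟨t, c d N, hE, ⟨fun x i => ?_, fun x i => ?_⟩, fun x i => ?_, hres, ?_⟩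
  · rw [← hst]; rfl
  · rw [← hst]; rfl
  · rw [← hst]; rfl
  · have h1 : c d N ≤ loopCost d N (g d) := by
      refine (hc d N).trans ?_
      unfold loopCost
      have : (N + 1) ^ d * (6 * d + 3) ≤ (N + 1) ^ d * (6 * d + 4) :=
        Nat.mul_le_mul_left _ (by omega)
      omega
    rw [one_div_gridStep, div_gridStep_pow]
    exact (Nat.cast_le.2 h1).trans (hW N hN)

/-- The single-level algorithm: at most `6 C₃ / ε` iterations, as the initial point is zero. -/
theorem cost_single_level (p : ℝ≥0∞) (hp : p = 1 ∨ p = 2 ∨ p = ⊤) :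
    ∃ P : (d N : ℕ) → Prog (Reg d N 1),
      ∀ C₃ C₄ ν : ℝ, 0 < C₃ → 0 < C₄ → 0 < ν → ∃ C : ℝ,
      ∀ d : ℕ, 1 ≤ d → ∃ N₀ : ℕ, ∀ N : ℕ, N₀ ≤ N → ∀ ρ₀ ρ₁ : (Fin d → ℝ) → ℝ,
      SolBounded p (rhs ρ₀ ρ₁ N) C₃ →
      ∀ ε : ℝ, GoodTol p (rhs ρ₀ ρ₁ N) (0, 0) (C₄ * gridStep N ^ ν) ε →
        Stops p (rhs ρ₀ ρ₁ N) (0, 0) ε ∧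
        ∃ (t : Reg d N 1 → ℝ) (c : ℕ),
          Exec (P d N) (memory ρ₀ ρ₁ (fun _ => ε) (zeroState d N)) t c ∧
          Holds t (output p (rhs ρ₀ ρ₁ N) (0, 0) ε) ∧
          (c : ℝ) ≤ C * (1 / ε * (d / gridStep N ^ d) * Real.log (1 / gridStep N)) := by
  have := fact_one_le hp
  choose q g hq hg using fun d => exists_dualProj hp d
  have hex : ∀ d N, ∃ (P : Prog (Reg d N 1)) (c : ℕ), 1 ≤ N → c ≤ loopCost d N (g d) ∧
      ∀ s y, Feasible (readRhs id s) → readState id s = ⟨y.1, y.2, y.2⟩ →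
        Stops p (readRhs id s) y (s (.tol 0)) → s (.tol 0) ≤ resid p (readRhs id s) y 0 →
        ∃ t, Exec P s t (stopIter p (readRhs id s) y (s (.tol 0)) * c) ∧
          readState id t = iter p (readRhs id s) y (stopIter p (readRhs id s) y (s (.tol 0))) ∧
          SameInput s t := by
    intro d N
    by_cases hN : 1 ≤ N
    · obtain ⟨P, c, h⟩ := exists_loop_prog (L := 1) (N := N)
        (Function.injective_id (α := Grid d N)) hN (hq d) (hg d) 0
      exact ⟨P, c, fun _ => h⟩
    · exact ⟨.skip, 0, fun h => absurd h hN⟩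
  choose P c hP using hex
  refine ⟨P, fun C₃ C₄ ν hC₃ hC₄ hν => ⟨60000 * C₃, fun d hd => ?_⟩⟩
  obtain ⟨N₀, hN₀, hW⟩ := exists_loopCost_le d (g d) hd
  refine ⟨N₀, fun N hN ρ₀ ρ₁ hA ε hε => ?_⟩
  have hN1 : 1 ≤ N := hN₀.trans hN
  obtain ⟨hc, hrun⟩ := hP d N hN1
  obtain ⟨z, hz⟩ := hA.1
  obtain ⟨hst, hK⟩ := stops_and_stopIter_le (hq d) hN1 hz (0, 0) hε.1
  have hD : pairNormSq ((0, 0) - z : Field d N × Field d N) ≤ C₃ := by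
    have : pairNormSq ((0, 0) - z : Field d N × Field d N) = pairNormSq z := by
      simp [pairNormSq, normSq, vInner]
    rw [this]; exact hA.2 z hz
  refine ⟨hst, ?_⟩
  obtain ⟨t, hE, hrd, -⟩ := hrun (memory ρ₀ ρ₁ (fun _ => ε) (zeroState d N)) (0, 0)
    (feasible_of_solBounded hA) rfl hst hε.le_resid_zero
  change readState id t = iter p (rhs ρ₀ ρ₁ N) (0, 0) (stopIter p (rhs ρ₀ ρ₁ N) (0, 0) ε) at hrd
  refine ⟨t, _, hE, ⟨fun x i => ?_, fun x i => ?_⟩, ?_⟩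
  · rw [output, iterPair, ← hrd]; rfl
  · rw [output, iterPair, ← hrd]; rfl
  · change ((stopIter p (rhs ρ₀ ρ₁ N) (0, 0) ε * c d N : ℕ) : ℝ) ≤ _
    rw [one_div_gridStep, div_gridStep_pow, Nat.cast_mul]
    have h1 : (stopIter p (rhs ρ₀ ρ₁ N) (0, 0) ε : ℝ) ≤ 6 * C₃ / ε := by
      rw [le_div_iff₀ hε.1]; linarith
    have h2 : (c d N : ℝ) ≤ 10000 * (d * (N : ℝ) ^ d * Real.log N) :=
      (Nat.cast_le.2 hc).trans (hW N hN)
    have h3 := hε.1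
    calc _ ≤ 6 * C₃ / ε * (10000 * (d * (N : ℝ) ^ d * Real.log N)) :=
          mul_le_mul h1 h2 (by positivity) (by positivity)
      _ = _ := by ring

/-- The multilevel algorithm: the programs of all levels, followed by the potential. -/
theorem cost_multilevel (p : ℝ≥0∞) (hp : p = 1 ∨ p = 2 ∨ p = ⊤) :
    ∃ P : (d n : ℕ) → Prog (Reg d (2 ^ n) (n + 1)),
      ∀ C₃ C₄ ν α : ℝ, 0 < C₃ → 0 < C₄ → 0 < ν → ∃ C : ℝ,
      ∀ d : ℕ, 1 ≤ d → ∃ n₀ : ℕ, ∀ n : ℕ, n₀ ≤ n →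
      ∀ ρ₀ ρ₁ : (Fin d → ℝ) → ℝ,
      (∀ j ≤ n, SolBounded p (rhs ρ₀ ρ₁ (2 ^ j)) C₃) →
      (∀ j < n, SolInterp p ρ₀ ρ₁ (2 ^ j) (2 ^ (j + 1)) C₄ ν) →
      ∀ εL : ℝ,
      (∀ j ≤ n, GoodTol p (rhs ρ₀ ρ₁ (2 ^ j))
        (levelStart p ρ₀ ρ₁ (tolerance εL α n) j)
        (C₄ * gridStep (2 ^ j) ^ ν) (tolerance εL α n j)) →
        (∀ j ≤ n, Stops p (rhs ρ₀ ρ₁ (2 ^ j))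
          (levelStart p ρ₀ ρ₁ (tolerance εL α n) j) (tolerance εL α n j)) ∧
        ∃ (t : Reg d (2 ^ n) (n + 1) → ℝ) (c : ℕ),
          Exec (P d n) (memory ρ₀ ρ₁ (fun l => tolerance εL α n l)
            (zeroState d (2 ^ n))) t c ∧
          Holds t (levelOutput p ρ₀ ρ₁ (tolerance εL α n) n) ∧
          IsPotential (levelOutput p ρ₀ ρ₁ (tolerance εL α n) n).2
            (fun x => t (.pot x)) ∧
          (ν - d < α → (c : ℝ) ≤ C * (
            1 / εL * (d / gridStep (2 ^ n) ^ ((d : ℝ) - ν)) *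
              Real.log (1 / gridStep (2 ^ n)) +
            d * 2 ^ d / gridStep (2 ^ n) ^ d)) ∧
          (α = ν - d → (c : ℝ) ≤ C * (
            1 / εL * (d / gridStep (2 ^ n) ^ ((d : ℝ) - ν)) *
              Real.log (1 / gridStep (2 ^ n)) ^ 2 +
            d * 2 ^ d / gridStep (2 ^ n) ^ d)) ∧
          (α < ν - d → (c : ℝ) ≤ C * (
            1 / εL * (d / gridStep (2 ^ n) ^ (-α)) *
              Real.log (1 / gridStep (2 ^ n)) +
            d * 2 ^ d / gridStep (2 ^ n) ^ d)) := by
  have := fact_one_le hp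
  choose q g hq hg using fun d => exists_dualProj hp d
  choose P hP using fun d n => exists_levels_prog (hq d) (hg d) n n le_rfl
  choose R cR hcR hR using fun d n => exists_potential_prog d (2 ^ n) (n + 1)
  refine ⟨fun d n => .seq (P d n) (R d n), fun C₃ C₄ ν α hC₃ hC₄ hν => ?_⟩
  obtain ⟨A, hA0, hAb⟩ := exists_sum_levels_le α ν
  set D : ℝ := C₃ + 4 * C₄ * 2 ^ ν with hD
  have hD0 : 0 < D := by positivity
  refine ⟨48 * D * A + 50, fun d hd => ?_⟩
  obtain ⟨N₀, hN₀, hW⟩ := exists_loopCost_le d (g d) hd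
  obtain ⟨n₁, hn₁, hsum⟩ := hAb d hd (fun j => (loopCost d (2 ^ j) (g d) : ℝ)) N₀
    (fun j => by positivity) (fun j hj => by
      have h1 : j < 2 ^ j := Nat.lt_two_pow_self
      have h2 := hW (2 ^ j) (by omega)
      rw [Nat.cast_pow, Real.log_pow] at h2
      simpa using h2)
  obtain ⟨n₂, hI⟩ := exists_sum_interpCost_le d hd
  refine ⟨max n₁ n₂, fun n hn ρ₀ ρ₁ hA hB εL hε => ?_⟩
  set ε := tolerance εL α n with hεdef
  have hnear := exists_solSet_near_levelStart (hq d) hC₃ hC₄ hA hB hε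
  have hlev : ∀ j ≤ n, Stops p (rhs ρ₀ ρ₁ (2 ^ j)) (levelStart p ρ₀ ρ₁ ε j) (ε j) ∧
      (stopIter p (rhs ρ₀ ρ₁ (2 ^ j)) (levelStart p ρ₀ ρ₁ ε j) (ε j) : ℝ) * ε j ≤
        6 * (D * (2 : ℝ) ^ (-(j * ν))) := by
    intro j hj
    obtain ⟨z, hz, hzD⟩ := hnear j hj
    obtain ⟨h1, h2⟩ := stops_and_stopIter_le (hq d) Nat.one_le_two_pow hz
      (levelStart p ρ₀ ρ₁ ε j) (hε j hj).1
    exact ⟨h1, h2.trans (by linarith)⟩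
  have hεL : 0 < εL := by
    have := (hε n le_rfl).1
    rw [hεdef, tolerance_eq, sub_self, zero_mul, Real.rpow_zero, mul_one] at this
    exact this
  refine ⟨fun j hj => (hlev j hj).1, ?_⟩
  obtain ⟨t, c, hE, hc, hrd, -⟩ := hP d n ρ₀ ρ₁ ε
    (memory ρ₀ ρ₁ (fun l => ε l) (zeroState d (2 ^ n))) (fun _ => rfl) (fun _ => rfl)
    (fun _ => rfl) rfl fun i hi =>
      ⟨feasible_of_solBounded (hA i hi), (hlev i hi).1, (hε i hi).le_resid_zero⟩
  obtain ⟨t', hE', hpot, hflux, hdual⟩ := hR d n t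
  have hflux' : ∀ x i, t (.flux x i) = (levelOutput p ρ₀ ρ₁ ε n).1 x i := by
    intro x i
    have := congrFun (congrFun (congrArg State.flux hrd) x) i
    simp only [readState, levelEmb_self] at this
    exact this
  have hdual' : ∀ x i, t (.dual x i) = (levelOutput p ρ₀ ρ₁ ε n).2 x i := by
    intro x i
    have := congrFun (congrFun (congrArg State.dual hrd) x) i
    simp only [readState, levelEmb_self] at this
    exact this
  refine ⟨t', _, .seq hE hE', ⟨fun x i => (hflux x i).trans (hflux' x i),
    fun x i => (hdual x i).trans (hdual' x i)⟩, ?_, ?_⟩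
  · have e : (fun x => t' (.pot x)) = poisson (divh (levelOutput p ρ₀ ρ₁ ε n).2) := by
      funext x
      rw [hpot]
      congr 2
      funext y i
      exact hdual' y i
    rw [e]
    exact isPotential_poisson Nat.one_le_two_pow _
  set k : ℕ → ℕ := fun j => stopIter p (rhs ρ₀ ρ₁ (2 ^ j)) (levelStart p ρ₀ ρ₁ ε j) (ε j) with hk
  -- A good tolerance is not met initially, so at least one iteration is made on the finest level;
  -- it pays for the computation of the potential.
  have hkn : 1 ≤ k n := by
    by_contra h0
    have h0 : k n = 0 := by omega
    have hmem : resid p (rhs ρ₀ ρ₁ (2 ^ n)) (levelStart p ρ₀ ρ₁ ε n) (k n) < ε n :=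
      Nat.sInf_mem (hlev n le_rfl).1
    rw [h0] at hmem
    exact absurd hmem (not_lt.2 (hε n le_rfl).le_resid_zero)
  have hpotc : cR d n ≤ ∑ j ∈ Finset.range (n + 1), k j * loopCost d (2 ^ j) (g d) := by
    have h1 : cR d n ≤ loopCost d (2 ^ n) (g d) := by
      refine (hcR d n).trans ?_
      unfold loopCost stepCost
      have : (2 ^ n + 1) ^ d * (5 * d + 3) ≤ (2 ^ n + 1) ^ d * (6 * d + 4) :=
        Nat.mul_le_mul_left _ (by omega)
      omega
    have h2 : k n * loopCost d (2 ^ n) (g d) ≤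
        ∑ j ∈ Finset.range (n + 1), k j * loopCost d (2 ^ j) (g d) :=
      Finset.single_le_sum (f := fun j => k j * loopCost d (2 ^ j) (g d))
        (fun _ _ => Nat.zero_le _) (by simp)
    have h3 := Nat.mul_le_mul_right (loopCost d (2 ^ n) (g d)) hkn
    omega
  have htotal : ((c + cR d n : ℕ) : ℝ) ≤
      2 * (∑ j ∈ Finset.range (n + 1), (k j : ℝ) * (loopCost d (2 ^ j) (g d) : ℝ)) +
      50 * (d * 2 ^ d * ((2 : ℝ) ^ n) ^ d) := by
    rw [Finset.sum_add_distrib] at hc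
    have h1 : ((c + cR d n : ℕ) : ℝ) ≤ ((2 * (∑ j ∈ Finset.range (n + 1),
        k j * loopCost d (2 ^ j) (g d)) +
        ∑ j ∈ Finset.range (n + 1), interpCost d (2 ^ j) : ℕ) : ℝ) :=
      Nat.cast_le.2 (by simp only [hk] at hpotc ⊢; omega)
    refine h1.trans ?_
    rw [Nat.cast_add]
    refine add_le_add (le_of_eq (by push_cast; rfl)) (hI n ((le_max_right _ _).trans hn))
  have hT : 0 ≤ 6 * D / εL := by positivity
  have hkT : ∀ j ≤ n, (k j : ℝ) ≤ 6 * D / εL * (2 : ℝ) ^ (-(((n : ℝ) - j) * α) - j * ν) := by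
    intro j hj
    have h1 := (hlev j hj).2
    have hεj : ε j = εL * (2 : ℝ) ^ (((n : ℝ) - j) * α) := tolerance_eq _ _ _ _
    rw [← le_div_iff₀ (hε j hj).1] at h1
    refine h1.trans (le_of_eq ?_)
    rw [hεj, Real.rpow_sub two_pos, Real.rpow_neg two_pos.le, Real.rpow_neg two_pos.le]
    field_simp
  obtain ⟨hs1, hs2, hs3⟩ := hsum n ((le_max_left _ _).trans hn) (6 * D / εL) (fun j => (k j : ℝ))
    hT hkT
  have hn0 : (1 : ℝ) ≤ n := by exact_mod_cast hn₁.trans ((le_max_left _ _).trans hn)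
  have hlog2 : (1 / 2 : ℝ) ≤ Real.log 2 := by linarith [Real.log_two_gt_d9]
  have hDA : 0 ≤ D * A := by positivity
  -- The factor `48 = 2 * 6 * 4` leaves room for `1 ≤ 4 * (log 2) ^ 2`.
  have final : ∀ X Y l l' : ℝ, 0 ≤ X → 0 ≤ Y → 0 ≤ l → l ≤ 4 * l' →
      ∑ j ∈ Finset.range (n + 1), (k j : ℝ) * (loopCost d (2 ^ j) (g d) : ℝ) ≤
        A * (6 * D / εL * (d * X * l)) →
      2 * (∑ j ∈ Finset.range (n + 1), (k j : ℝ) * (loopCost d (2 ^ j) (g d) : ℝ)) + 50 * Y ≤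
        (48 * D * A + 50) * (1 / εL * (d * X) * l' + Y) := by
    intro X Y l l' hX hY hl hll h
    have hl' : 0 ≤ l' := by linarith
    have h1 : A * (6 * D / εL * (d * X * l)) ≤ A * (6 * D / εL * (d * X * (4 * l'))) := by
      gcongr
    have h2 : A * (6 * D / εL * (d * X * (4 * l'))) = 24 * (D * A) * (1 / εL * (d * X) * l') := by
      ring
    have h3 : 0 ≤ 1 / εL * (d * X) * l' := by positivity
    have h4 : 0 ≤ D * A * Y := by positivity
    linarith
  have hlin : (n : ℝ) ≤ 4 * (n * Real.log 2) := by nlinarith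
  have hsq : (n : ℝ) ^ 2 ≤ 4 * (n * Real.log 2) ^ 2 := by
    have h1 : (1 : ℝ) ≤ 4 * Real.log 2 ^ 2 := by nlinarith
    calc (n : ℝ) ^ 2 ≤ (n : ℝ) ^ 2 * (4 * Real.log 2 ^ 2) :=
          le_mul_of_one_le_right (by positivity) h1
      _ = _ := by ring
  have hY : d * 2 ^ d / gridStep (2 ^ n) ^ d = (d : ℝ) * 2 ^ d * ((2 : ℝ) ^ n) ^ d := by
    rw [div_gridStep_pow]; push_cast; ring
  refine ⟨fun h => htotal.trans ?_, fun h => htotal.trans ?_, fun h => htotal.trans ?_⟩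
  · rw [log_one_div_gridStep, div_gridStep_rpow, hY]
    exact final _ _ _ _ (by positivity) (by positivity) (by positivity) hlin (hs1 h)
  · rw [log_one_div_gridStep, div_gridStep_rpow, hY]
    exact final _ _ _ _ (by positivity) (by positivity) (by positivity) hsq (hs2 h)
  · rw [log_one_div_gridStep, div_gridStep_rpow, hY]
    have h3 := hs3 h
    rw [← mul_neg] at h3
    exact final _ _ _ _ (by positivity) (by positivity) (by positivity) hlin h3

end EMD

end

theorem theorem4p6 (p : ℝ≥0∞) (hp : p = 1 ∨ p = 2 ∨ p = ⊤) :
    -- the cost of one iteration, including the residual for the stopping test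
    (∃ P : (d N : ℕ) → EMD.Prog (EMD.Reg d N 1), ∃ C : ℝ,
      ∀ d : ℕ, 1 ≤ d → ∃ N₀ : ℕ, ∀ N : ℕ, N₀ ≤ N →
      ∀ ρ₀ ρ₁ : (Fin d → ℝ) → ℝ,
      (∃ m : EMD.Field d N, EMD.divh m = EMD.rhs ρ₀ ρ₁ N) →
      ∀ s : EMD.State d N, ∃ (t : EMD.Reg d N 1 → ℝ) (c : ℕ),
        EMD.Exec (P d N) (EMD.memory ρ₀ ρ₁ 0 s) t c ∧
        EMD.Holds t ((EMD.pdStep p (EMD.rhs ρ₀ ρ₁ N) s).flux,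
          (EMD.pdStep p (EMD.rhs ρ₀ ρ₁ N) s).dual) ∧
        (∀ x i, t (.bar x i) = (EMD.pdStep p (EMD.rhs ρ₀ ρ₁ N) s).bar x i) ∧
        t .res = EMD.residual s (EMD.pdStep p (EMD.rhs ρ₀ ρ₁ N) s) ∧
        (c : ℝ) ≤ C * (d / EMD.gridStep N ^ d * Real.log (1 / EMD.gridStep N)))
    ∧
    -- the single-level algorithm
    (∃ P : (d N : ℕ) → EMD.Prog (EMD.Reg d N 1),
      ∀ C₃ C₄ ν : ℝ, 0 < C₃ → 0 < C₄ → 0 < ν → ∃ C : ℝ,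
      ∀ d : ℕ, 1 ≤ d → ∃ N₀ : ℕ, ∀ N : ℕ, N₀ ≤ N →
      ∀ ρ₀ ρ₁ : (Fin d → ℝ) → ℝ,
      EMD.SolBounded p (EMD.rhs ρ₀ ρ₁ N) C₃ →
      ∀ ε : ℝ, EMD.GoodTol p (EMD.rhs ρ₀ ρ₁ N) (0, 0) (C₄ * EMD.gridStep N ^ ν) ε →
        EMD.Stops p (EMD.rhs ρ₀ ρ₁ N) (0, 0) ε ∧
        ∃ (t : EMD.Reg d N 1 → ℝ) (c : ℕ),
          EMD.Exec (P d N) (EMD.memory ρ₀ ρ₁ (fun _ => ε) (EMD.zeroState d N)) t c ∧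
          EMD.Holds t (EMD.output p (EMD.rhs ρ₀ ρ₁ N) (0, 0) ε) ∧
          (c : ℝ) ≤ C * (1 / ε * (d / EMD.gridStep N ^ d) * Real.log (1 / EMD.gridStep N)))
    ∧
    -- the multilevel algorithm with `h = 2^{-n}` and `n + 1` levels
    (∃ P : (d n : ℕ) → EMD.Prog (EMD.Reg d (2 ^ n) (n + 1)),
      ∀ C₃ C₄ ν α : ℝ, 0 < C₃ → 0 < C₄ → 0 < ν → ∃ C : ℝ,
      ∀ d : ℕ, 1 ≤ d → ∃ n₀ : ℕ, ∀ n : ℕ, n₀ ≤ n →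
      ∀ ρ₀ ρ₁ : (Fin d → ℝ) → ℝ,
      (∀ j ≤ n, EMD.SolBounded p (EMD.rhs ρ₀ ρ₁ (2 ^ j)) C₃) →
      (∀ j < n, EMD.SolInterp p ρ₀ ρ₁ (2 ^ j) (2 ^ (j + 1)) C₄ ν) →
      ∀ εL : ℝ,
      (∀ j ≤ n, EMD.GoodTol p (EMD.rhs ρ₀ ρ₁ (2 ^ j))
        (EMD.levelStart p ρ₀ ρ₁ (EMD.tolerance εL α n) j)
        (C₄ * EMD.gridStep (2 ^ j) ^ ν) (EMD.tolerance εL α n j)) →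
        (∀ j ≤ n, EMD.Stops p (EMD.rhs ρ₀ ρ₁ (2 ^ j))
          (EMD.levelStart p ρ₀ ρ₁ (EMD.tolerance εL α n) j) (EMD.tolerance εL α n j)) ∧
        ∃ (t : EMD.Reg d (2 ^ n) (n + 1) → ℝ) (c : ℕ),
          EMD.Exec (P d n) (EMD.memory ρ₀ ρ₁ (fun l => EMD.tolerance εL α n l)
            (EMD.zeroState d (2 ^ n))) t c ∧
          EMD.Holds t (EMD.levelOutput p ρ₀ ρ₁ (EMD.tolerance εL α n) n) ∧
          EMD.IsPotential (EMD.levelOutput p ρ₀ ρ₁ (EMD.tolerance εL α n) n).2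
            (fun x => t (.pot x)) ∧
          (ν - d < α → (c : ℝ) ≤ C * (
            1 / εL * (d / EMD.gridStep (2 ^ n) ^ ((d : ℝ) - ν)) *
              Real.log (1 / EMD.gridStep (2 ^ n)) +
            d * 2 ^ d / EMD.gridStep (2 ^ n) ^ d)) ∧
          (α = ν - d → (c : ℝ) ≤ C * (
            1 / εL * (d / EMD.gridStep (2 ^ n) ^ ((d : ℝ) - ν)) *
              Real.log (1 / EMD.gridStep (2 ^ n)) ^ 2 +
            d * 2 ^ d / EMD.gridStep (2 ^ n) ^ d)) ∧
          (α < ν - d → (c : ℝ) ≤ C * (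
            1 / εL * (d / EMD.gridStep (2 ^ n) ^ (-α)) *
              Real.log (1 / EMD.gridStep (2 ^ n)) +
            d * 2 ^ d / EMD.gridStep (2 ^ n) ^ d))) := by
  exact ⟨EMD.cost_one_iteration p hp, EMD.cost_single_level p hp, EMD.cost_multilevel p hp⟩
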